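/- **Setting.** A quad mesh $M$ consists of finitely many faces, each parametrized by the square $[0,1]^2$, whose sides are glued in pairs: each side is glued with at most one other side, which belongs to a different face. Let $F_2,F_1,F_0$ be the numbers of faces, edges and vertices of $M$. An edge is interior if it is shared by two faces; a vertex is interior if all edges at it are. For integers $r\ge -1$, $k\ge 0$ let $\mathcal U^r_k$ be the space of piecewise polynomial functions of degree $\le k$ on the subdivision $[0,\frac12,1]$ that are of class $C^r$ (no condition at $\frac12$ if $r=-1$). For $r\ge 0$ let $\mathcal R^r_k=\mathcal U^r_k\otimes\mathcal U^r_k$ be the space of 4-split $C^r$ macro-patches of bi-degree $\le(k,k)$ on the square. **Gluing data.** Let $\tau$ be an interior edge with an end point $\gamma$ and adjacent faces $\sigma_1,\sigma_0$. Use coordinates $(u_1,v_1)$ on $\sigma_1$ and $(u_0,v_0)$ on $\sigma_0$ with origin $\gamma$, such that $\tau$ is $\{v_1=0\}$ in $\sigma_1$ and $\{u_0=0\}$ in $\sigma_0$. The gluing data are continuous piecewise polynomials $a,b,c$ on $[0,\frac12,1]$, with $b,c$ nowhere zero on $[0,1]$; put $\mathfrak a=a/c$, $\mathfrak b=b/c$.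 They give the first-order transition map $(u_1,v_1)\mapsto(u_0,v_0)=(v_1\mathfrak b(u_1),\,u_1+v_1\mathfrak a(u_1))$. The triple of the inverse map is $(-a,c,b)$, and the triple at the other end point of $\tau$ is $(-a(1-u),b(1-u),c(1-u))$. A family $f=(f_\sigma)_\sigma$ with $f_\sigma\in\mathcal R^r_k$ satisfies the $G^1$ condition across $\tau$ if, for $u\in[0,1]$, $$f_{\sigma_1}(u,0)=f_{\sigma_0}(0,u),\qquad \partial_{v_1}f_{\sigma_1}(u,0)=\mathfrak b(u)\,\partial_{u_0}f_{\sigma_0}(0,u)+\mathfrak a(u)\,\partial_{v_0}f_{\sigma_0}(0,u)$$ (the second relation for $u\neq\frac12$; this matters only if $r=0$). Let $\mathcal S^{1,r}_k(M)$ be the space of families satisfying it across all interior edges. An interior edge $\tau$ is a crossing edge at its end point $\gamma$ if $\mathfrak a(0)=0$; put $\mathfrak c_\tau(\gamma)=1$ in this case, and $\mathfrak c_\tau(\gamma)=0$ otherwise and for boundary edges. A crossing vertex is an interior vertex at which all edges are crossing edges; put $\mathfrak c_+(\gamma)=1$ for these, $0$ for all other vertices, and let $F_+$ be their number. **Compatibility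 assumptions.** (1) Let $\gamma$ be an interior vertex, with edges $\tau_1,\dots,\tau_F$ and faces in cyclic order, and let $[\mathfrak a_i,\mathfrak b_i]$ be the data at $\gamma$ along $\tau_i$, with $\sigma_1$ the face before $\tau_i$ and $\sigma_0$ the face after $\tau_i$. Then $\begin{pmatrix}0&1\\ \mathfrak b_1(0)&\mathfrak a_1(0)\end{pmatrix}\cdots\begin{pmatrix}0&1\\ \mathfrak b_F(0)&\mathfrak a_F(0)\end{pmatrix}=I_2$. (2) Every crossing vertex has exactly four edges, and there $$\mathfrak a_1'(0)+\tfrac{\mathfrak b_4'(0)}{\mathfrak b_4(0)}=-\mathfrak b_1(0)\Bigl(\mathfrak a_3'(0)+\tfrac{\mathfrak b_2'(0)}{\mathfrak b_2(0)}\Bigr),\qquad \mathfrak a_2'(0)+\tfrac{\mathfrak b_1'(0)}{\mathfrak b_1(0)}=-\mathfrak b_2(0)\Bigl(\mathfrak a_4'(0)+\tfrac{\mathfrak b_3'(0)}{\mathfrak b_3(0)}\Bigr).$$ **Separability.** The Taylor data of $f$ at a corner of a face $\sigma$ are the values there of $f_\sigma,\partial_uf_\sigma,\partial_vf_\sigma,\partial_u\partial_vf_\sigma$.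 For an edge $\tau$ with end points $\gamma,\gamma'$, let $M_\tau$ be the mesh of the one or two faces adjacent to $\tau$, glued along $\tau$ only. Let $T_\gamma$ (resp. $T_{\gamma'}$) collect the Taylor data at the end $\gamma$ (resp. $\gamma'$) of $\tau$ on these faces, let $T_{\gamma,\gamma'}=(T_\gamma,T_{\gamma'})$, and let $\mathcal S^{1,r}(M_\tau)=\bigcup_j\mathcal S^{1,r}_j(M_\tau)$. The separability $\mathfrak s(\tau)$ is the least $k$ with $T_{\gamma,\gamma'}(\mathcal S^{1,r}_k(M_\tau))=T_\gamma(\mathcal S^{1,r}(M_\tau))\times T_{\gamma'}(\mathcal S^{1,r}(M_\tau))$, and $\infty$ if there is none; $\mathfrak s^*$ is the maximum of $\mathfrak s(\tau)$ over all edges. **Theorem.** Let $r\ge0$, $k\ge r$ and $k\ge\mathfrak s^*$. For an interior edge $\tau$ let $\tilde d_\tau(k,r)$ be the dimension of $$\{(A,B,C)\in\mathcal U^{r-1}_{k-1}\times\mathcal U^r_k\times\mathcal U^r_k:\ Aa+Bb+Cc=0\},$$ where $[a,b,c]$ are the gluing data along $\tau$; for a boundary edge put $\tilde d_\tau(k,r)=4k-2r+3$.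 Then $$\dim\mathcal S^{1,r}_k(M)=(2k-r-3)^2F_2+\sum_\tau\tilde d_\tau(k,r)+4F_2-9F_1+3F_0+F_+ ,$$ the sum being over all edges. Moreover $\mathcal S^{1,r}_k(M)$ has a basis that is the disjoint union of * for each vertex $\gamma$, with $F(\gamma)$ face corners at $\gamma$: $F(\gamma)+3-\sum_{\tau\ni\gamma}\mathfrak c_\tau(\gamma)+\mathfrak c_+(\gamma)$ splines (the sum being over the edge ends at $\gamma$) that are supported on the faces containing $\gamma$, vanish with their first derivatives along all edges not containing $\gamma$, and have zero Taylor data at all other vertices; * for each edge $\tau$ with ends $\gamma,\gamma'$: $\tilde d_\tau(k,r)-9+\mathfrak c_\tau(\gamma)+\mathfrak c_\tau(\gamma')$ splines that are supported on the faces adjacent to $\tau$, vanish with their first derivatives along all other edges, and have zero Taylor data at all vertices; * for each face $\sigma$: $(2k-r-3)^2$ splines that are supported on $\sigma$ and vanish with their first derivatives along all edges. -/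

import Mathlib

noncomputable section

open Polynomial

/-! ### Univariate splines and 4-split macro-patches -/

/-- The function equal to the polynomial `p` up to the node `1/2` and to `q` after it. Only its
restriction to `[0, 1]` matters; extending the two pieces to `ℝ` makes one-sided derivatives at
the end points `0` and `1` ordinary derivatives. -/
def piecewisePoly (p q : ℝ[X]) : ℝ → ℝ :=
  fun x => if x ≤ 1 / 2 then p.eval x else q.eval x

/-- Splines on the subdivision `[0, 1/2, 1]` whose two pieces have degree `< n` and agree at `1/2`
together with their derivatives of order `< s`, i.e. of class `C^(s-1)` (no condition if `s = 0`).
So `splineSpace (r + 1) (k + 1)` is the space of `C^r` splines of degree at most `k`, and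
`splineSpace r k` is the space of `C^(r-1)` splines of degree at most `k - 1`. -/
def splineSpace (s n : ℕ) : Submodule ℝ (ℝ → ℝ) where
  carrier := {f | ∃ p q : ℝ[X], p.degree < n ∧ q.degree < n ∧
    (∀ j < s, (derivative^[j] p).eval (1 / 2) = (derivative^[j] q).eval (1 / 2)) ∧
    f = piecewisePoly p q}
  add_mem' := by
    rintro _ _ ⟨p, q, hp, hq, h, rfl⟩ ⟨p', q', hp', hq', h', rfl⟩
    refine ⟨p + p', q + q', (degree_add_le _ _).trans_lt (max_lt hp hp'),
      (degree_add_le _ _).trans_lt (max_lt hq hq'), fun j hj => ?_, ?_⟩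
    · simp only [iterate_map_add, eval_add, h j hj, h' j hj]
    · funext x
      simp only [piecewisePoly, Pi.add_apply]
      split_ifs <;> simp
  zero_mem' := by
    refine ⟨0, 0, ?_, ?_, fun j _ => rfl, ?_⟩
    · simp
    · simp
    · funext x
      simp [piecewisePoly]
  smul_mem' := by
    rintro c _ ⟨p, q, hp, hq, h, rfl⟩
    refine ⟨c • p, c • q, (degree_smul_le _ _).trans_lt hp, (degree_smul_le _ _).trans_lt hq,
      fun j hj => ?_, ?_⟩
    · simp only [iterate_derivative_smul, eval_smul, h j hj]
    · funext x
      simp only [piecewisePoly, Pi.smul_apply]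
      split_ifs <;> simp

/-- Functions on a face: the tensor product of the space of `C^r` splines of degree at most `k`
with itself, i.e. the 4-split `C^r` macro-patches of bi-degree at most `(k, k)`. -/
def macroPatch (r k : ℕ) : Submodule ℝ (ℝ → ℝ → ℝ) :=
  Submodule.span ℝ {F | ∃ g ∈ splineSpace (r + 1) (k + 1), ∃ h ∈ splineSpace (r + 1) (k + 1),
    F = fun u v => g u * h v}

/-- The syzygies `(A, B, C)` of `(a, b, c)`, with `A` of class `C^(r-1)` and degree at most `k - 1`,
and `B`, `C` of class `C^r` and degree at most `k`. -/
def syzygies (r k : ℕ) (a b c : ℝ → ℝ) : Submodule ℝ ((ℝ → ℝ) × (ℝ → ℝ) × (ℝ → ℝ)) where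
  carrier := {S | S.1 ∈ splineSpace r k ∧ S.2.1 ∈ splineSpace (r + 1) (k + 1) ∧
    S.2.2 ∈ splineSpace (r + 1) (k + 1) ∧
    ∀ u ∈ Set.Icc (0 : ℝ) 1, S.1 u * a u + S.2.1 u * b u + S.2.2 u * c u = 0}
  add_mem' := by
    rintro S T ⟨h1, h2, h3, h4⟩ ⟨h1', h2', h3', h4'⟩
    refine ⟨add_mem h1 h1', add_mem h2 h2', add_mem h3 h3', fun u hu => ?_⟩
    have := h4 u hu
    have := h4' u hu
    simp only [Prod.fst_add, Prod.snd_add, Pi.add_apply]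
    linarith
  zero_mem' := ⟨zero_mem _, zero_mem _, zero_mem _, fun u _ => by simp⟩
  smul_mem' := by
    rintro t S ⟨h1, h2, h3, h4⟩
    refine ⟨Submodule.smul_mem _ t h1, Submodule.smul_mem _ t h2, Submodule.smul_mem _ t h3,
      fun u hu => ?_⟩
    have := h4 u hu
    simp only [Prod.smul_fst, Prod.smul_snd, Pi.smul_apply, smul_eq_mul]
    linear_combination t * this

/-! ### Quad meshes -/

/-- A flag: a face (with parameter domain the unit square), the corner of the square with
coordinates `(cu, cv)` (`false` for `0`, `true` for `1`), and one of the two sides of the square at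
this corner: the side along the first coordinate if `axis = false`, along the second one if
`axis = true`. Equivalently: a side of a face directed away from one of its end points. -/
structure MeshFlag (Φ : Type*) where
  face : Φ
  cu : Bool
  cv : Bool
  axis : Bool

namespace MeshFlag

variable {Φ : Type*}

/-- The same side, directed from its other end point. -/
def rev (d : MeshFlag Φ) : MeshFlag Φ :=
  if d.axis then { d with cv := !d.cv } else { d with cu := !d.cu }

/-- The other side of the face at the same corner. -/
def turn (d : MeshFlag Φ) : MeshFlag Φ := { d with axis := !d.axis }

/-- The reflection of `[0, 1]` if `b = true`, the identity otherwise. -/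
def flip (b : Bool) (x : ℝ) : ℝ := if b then 1 - x else x

/-- A function on the face of `d`, written in the coordinates `(x, y)` of the square adapted to `d`:
the corner of `d` is `(0, 0)` and the side of `d` is `{(x, 0) : 0 ≤ x ≤ 1}`. -/
def adapted (d : MeshFlag Φ) (F : ℝ → ℝ → ℝ) : ℝ → ℝ → ℝ :=
  fun x y => if d.axis then F (flip d.cu y) (flip d.cv x) else F (flip d.cu x) (flip d.cv y)

end MeshFlag

/-- A quad mesh with set of faces `Φ`: sides of different faces are glued in pairs, each side with
at most one other side. `glue d` is the flag identified with `d`, and `glue d = d` means that the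
side of `d` is not glued. -/
structure QuadMesh (Φ : Type*) where
  glue : MeshFlag Φ → MeshFlag Φ
  glue_glue : ∀ d, glue (glue d) = d
  glue_rev : ∀ d, glue d.rev = (glue d).rev
  face_ne : ∀ d, glue d ≠ d → (glue d).face ≠ d.face

namespace QuadMesh

variable {Φ : Type*} (M : QuadMesh Φ)

/-- The side of `d` is glued: it lies on an interior edge. -/
def Glued (d : MeshFlag Φ) : Prop := M.glue d ≠ d

/-- Edges: sides of faces, up to gluing. -/
def Edge : Type _ := Quot fun d e : MeshFlag Φ => e = d.rev ∨ e = M.glue d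

/-- Vertices: corners of faces, up to gluing. -/
def Vertex : Type _ := Quot fun d e : MeshFlag Φ => e = d.turn ∨ e = M.glue d

def edge (d : MeshFlag Φ) : M.Edge := Quot.mk _ d

/-- The vertex at which the flag is based; the other end point of its edge is `vertex d.rev`. -/
def vertex (d : MeshFlag Φ) : M.Vertex := Quot.mk _ d

def IsInterior (γ : M.Vertex) : Prop := ∀ d, M.vertex d = γ → M.Glued d

/-- Turning around the vertex of `d`: from the side of `d` cross to the face on its other side, and
take the other side of that face at the vertex. -/
def rot (d : MeshFlag Φ) : MeshFlag Φ := (M.glue d).turn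

/-- The number of faces around the vertex of `d`, if this vertex is interior. -/
def period (d : MeshFlag Φ) : ℕ := Function.minimalPeriod M.rot d

/-- The number of face corners at the vertex `γ` (each corner carries exactly one flag whose side
is along the first coordinate). -/
def numCorners (γ : M.Vertex) : ℕ := Nat.card {d : MeshFlag Φ // M.vertex d = γ ∧ d.axis = false}

end QuadMesh

/-! ### Gluing data -/

/-- Gluing data on a mesh: continuous splines `a, b, c`, with `c` nowhere zero on `[0, 1]`, for each
glued flag `d`. Writing `σ₁` for the face of `d`, with coordinates `(u₁, v₁)` such that the edge is
`v₁ = 0`, and `σ₀` for the face of `glue d`, with coordinates `(u₀, v₀)` such that the edge is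
`u₀ = 0`, the transition map from `σ₁` to `σ₀` is, to first order in `v₁`,
`(u₁, v₁) ↦ (u₀, v₀) = (v₁ b(u₁) / c(u₁), u₁ + v₁ a(u₁) / c(u₁))`.
The data of an edge are determined by those at one of its four flags: `rev_` describes the change of
end point, and `glue_` the inverse transition map; the latter also makes `b` nowhere zero. -/
structure GluingData {Φ : Type*} (M : QuadMesh Φ) where
  a : MeshFlag Φ → ℝ → ℝ
  b : MeshFlag Φ → ℝ → ℝ
  c : MeshFlag Φ → ℝ → ℝ
  spline : ∀ d, M.Glued d → ∃ n : ℕ,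
    a d ∈ splineSpace 1 n ∧ b d ∈ splineSpace 1 n ∧ c d ∈ splineSpace 1 n
  c_ne_zero : ∀ d, M.Glued d → ∀ u ∈ Set.Icc (0 : ℝ) 1, c d u ≠ 0
  rev_a : ∀ d, M.Glued d → ∀ u, a d.rev u = -a d (1 - u)
  rev_b : ∀ d, M.Glued d → ∀ u, b d.rev u = b d (1 - u)
  rev_c : ∀ d, M.Glued d → ∀ u, c d.rev u = c d (1 - u)
  glue_a : ∀ d, M.Glued d → ∀ u, a (M.glue d) u = -a d u
  glue_b : ∀ d, M.Glued d → ∀ u, b (M.glue d) u = c d u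
  glue_c : ∀ d, M.Glued d → ∀ u, c (M.glue d) u = b d u

/-! Regularity of macro-patches away from the node, used to see that splines form a subspace. -/

theorem piecewisePoly_differentiableAt (p q : ℝ[X]) {x : ℝ} (hx : x ≠ 1 / 2) :
    DifferentiableAt ℝ (piecewisePoly p q) x := by
  rcases lt_or_gt_of_ne hx with h | h
  · refine p.differentiableAt.congr_of_eventuallyEq ?_
    filter_upwards [Iio_mem_nhds h] with y hy
    exact if_pos (le_of_lt hy)
  · refine q.differentiableAt.congr_of_eventuallyEq ?_
    filter_upwards [Ioi_mem_nhds h] with y hy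
    exact if_neg (not_le_of_gt hy)

theorem splineSpace_differentiableAt {s n : ℕ} {f : ℝ → ℝ} (hf : f ∈ splineSpace s n) {x : ℝ}
    (hx : x ≠ 1 / 2) : DifferentiableAt ℝ f x := by
  obtain ⟨p, q, -, -, -, rfl⟩ := hf
  exact piecewisePoly_differentiableAt p q hx

theorem macroPatch_differentiableAt {r k : ℕ} {F : ℝ → ℝ → ℝ} (hF : F ∈ macroPatch r k) :
    (∀ u v : ℝ, u ≠ 1 / 2 → DifferentiableAt ℝ (fun x => F x v) u) ∧
    (∀ u v : ℝ, v ≠ 1 / 2 → DifferentiableAt ℝ (fun y => F u y) v) := by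
  induction hF using Submodule.span_induction with
  | mem F h =>
    obtain ⟨g, hg, h, hh, rfl⟩ := h
    exact ⟨fun u v hu => (splineSpace_differentiableAt hg hu).mul_const _,
      fun u v hv => (splineSpace_differentiableAt hh hv).const_mul _⟩
  | zero => exact ⟨fun u v _ => differentiableAt_const _, fun u v _ => differentiableAt_const _⟩
  | add F G _ _ hF hG =>
    exact ⟨fun u v hu => (hF.1 u v hu).add (hG.1 u v hu),
      fun u v hv => (hF.2 u v hv).add (hG.2 u v hv)⟩
  | smul t F _ hF =>
    exact ⟨fun u v hu => (hF.1 u v hu).const_mul t, fun u v hv => (hF.2 u v hv).const_mul t⟩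

theorem MeshFlag.flip_ne_half {b : Bool} {x : ℝ} (hx : x ≠ 1 / 2) : MeshFlag.flip b x ≠ 1 / 2 := by
  unfold MeshFlag.flip
  split_ifs
  · intro h
    exact hx (by linarith)
  · exact hx

theorem MeshFlag.flip_differentiableAt (b : Bool) (x : ℝ) : DifferentiableAt ℝ (MeshFlag.flip b) x := by
  cases b
  · exact differentiableAt_id
  · exact (differentiableAt_const (1 : ℝ)).sub differentiableAt_id

theorem MeshFlag.adapted_differentiableAt {Φ : Type*} (d : MeshFlag Φ) {r k : ℕ} {F : ℝ → ℝ → ℝ}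
    (hF : F ∈ macroPatch r k) :
    (∀ u v : ℝ, u ≠ 1 / 2 → DifferentiableAt ℝ (fun x => d.adapted F x v) u) ∧
    (∀ u v : ℝ, v ≠ 1 / 2 → DifferentiableAt ℝ (fun y => d.adapted F u y) v) := by
  obtain ⟨h1, h2⟩ := macroPatch_differentiableAt hF
  obtain ⟨σ, p, q, ax⟩ := d
  cases ax
  · constructor
    · intro u v hu
      exact (h1 (flip p u) (flip q v) (flip_ne_half hu)).comp u (flip_differentiableAt p u)
    · intro u v hv
      exact (h2 (flip p u) (flip q v) (flip_ne_half hv)).comp v (flip_differentiableAt q v)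
  · constructor
    · intro u v hu
      exact (h2 (flip p v) (flip q u) (flip_ne_half hu)).comp u (flip_differentiableAt q u)
    · intro u v hv
      exact (h1 (flip p v) (flip q u) (flip_ne_half hv)).comp v (flip_differentiableAt p v)

theorem MeshFlag.adapted_add {Φ : Type*} (d : MeshFlag Φ) (F G : ℝ → ℝ → ℝ) (x y : ℝ) :
    d.adapted (F + G) x y = d.adapted F x y + d.adapted G x y := by
  unfold MeshFlag.adapted
  split_ifs <;> rfl

theorem MeshFlag.adapted_smul {Φ : Type*} (d : MeshFlag Φ) (t : ℝ) (F : ℝ → ℝ → ℝ) (x y : ℝ) :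
    d.adapted (t • F) x y = t * d.adapted F x y := by
  unfold MeshFlag.adapted
  split_ifs <;> rfl

theorem MeshFlag.adapted_zero {Φ : Type*} (d : MeshFlag Φ) (x y : ℝ) :
    d.adapted (0 : ℝ → ℝ → ℝ) x y = 0 := by
  unfold MeshFlag.adapted
  split_ifs <;> rfl

/-- The 1-jet data `f, ∂_x f, ∂_y f, ∂_x ∂_y f` at the origin. -/
def taylor (g : ℝ → ℝ → ℝ) : Fin 4 → ℝ :=
  ![g 0 0, deriv (fun x => g x 0) 0, deriv (fun y => g 0 y) 0,
    deriv (fun x => deriv (fun y => g x y) 0) 0]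

/-- The Taylor data of a family of functions on the faces at the corner of the flag `d`. -/
def cornerTaylor {Φ : Type*} (f : Φ → ℝ → ℝ → ℝ) (d : MeshFlag Φ) : Fin 4 → ℝ :=
  taylor (d.adapted (f d.face))

/-- The restriction of `f` to the face of `d` vanishes to first order along the side of `d`. -/
def VanishesAlong {Φ : Type*} (f : Φ → ℝ → ℝ → ℝ) (d : MeshFlag Φ) : Prop :=
  ∀ u ∈ Set.Icc (0 : ℝ) 1, d.adapted (f d.face) u 0 = 0 ∧
    deriv (fun y => d.adapted (f d.face) u y) 0 = 0

namespace GluingData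

variable {Φ : Type*} {M : QuadMesh Φ} (G : GluingData M)

/-- The function `𝔞 = a / c`. -/
def fa (d : MeshFlag Φ) : ℝ → ℝ := fun u => G.a d u / G.c d u

/-- The function `𝔟 = b / c`. -/
def fb (d : MeshFlag Φ) : ℝ → ℝ := fun u => G.b d u / G.c d u

/-- The edge of `d` is a crossing edge at the vertex of `d`. -/
def IsCrossing (d : MeshFlag Φ) : Prop := M.Glued d ∧ G.fa d 0 = 0

/-- Crossing vertex: interior, and all edges at it are crossing edges there. -/
def IsCrossingVertex (γ : M.Vertex) : Prop := ∀ d, M.vertex d = γ → G.IsCrossing d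

/-- First compatibility condition, at the interior vertices: the first-order jets of the transition
maps compose to the identity around the vertex. -/
def Compat₁ : Prop := ∀ d, M.IsInterior (M.vertex d) →
  ((List.range (M.period d)).map fun i =>
    !![0, 1; G.fb (M.rot^[i] d) 0, G.fa (M.rot^[i] d) 0]).prod = 1

/-- Second compatibility condition, at the crossing vertices, which have exactly four edges:
`d, d₂, d₃, d₄` are the consecutive edges around the vertex. -/
def Compat₂ : Prop := ∀ d, G.IsCrossingVertex (M.vertex d) →
  M.period d = 4 ∧
  let d₂ := M.rot d
  let d₃ := M.rot d₂
  let d₄ := M.rot d₃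
  deriv (G.fa d) 0 + deriv (G.fb d₄) 0 / G.fb d₄ 0 =
      -G.fb d 0 * (deriv (G.fa d₃) 0 + deriv (G.fb d₂) 0 / G.fb d₂ 0) ∧
  deriv (G.fa d₂) 0 + deriv (G.fb d) 0 / G.fb d 0 =
      -G.fb d₂ 0 * (deriv (G.fa d₄) 0 + deriv (G.fb d₃) 0 / G.fb d₃ 0)

/-- The `G¹` conditions across the edge of `d` (none if it is a boundary edge), in the coordinates
adapted to `d` and to `glue d`, where `x` runs along the edge on both sides. The node `1/2` is
excluded only because `C^0` macro-patches need not be differentiable there; for `r ≥ 1` the relation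
at the node follows by continuity. -/
def GluedAlong (d : MeshFlag Φ) (f : Φ → ℝ → ℝ → ℝ) : Prop :=
  M.Glued d → ∀ u ∈ Set.Icc (0 : ℝ) 1,
    d.adapted (f d.face) u 0 = (M.glue d).adapted (f (M.glue d).face) u 0 ∧
    (u ≠ 1 / 2 → deriv (fun y => d.adapted (f d.face) u y) 0 =
      G.fb d u * deriv (fun y => (M.glue d).adapted (f (M.glue d).face) u y) 0 +
      G.fa d u * deriv (fun x => (M.glue d).adapted (f (M.glue d).face) x 0) u)

/-- The space of `G¹` splines of bi-degree at most `(k, k)` on the mesh. -/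
def splines (r k : ℕ) : Submodule ℝ (Φ → ℝ → ℝ → ℝ) where
  carrier := {f | (∀ σ, f σ ∈ macroPatch r k) ∧ ∀ d, G.GluedAlong d f}
  add_mem' := by
    rintro f g ⟨hf, hf'⟩ ⟨hg, hg'⟩
    refine ⟨fun σ => add_mem (hf σ) (hg σ), fun d hd u hu => ?_⟩
    obtain ⟨e1, e2⟩ := hf' d hd u hu
    obtain ⟨e1', e2'⟩ := hg' d hd u hu
    have h0 : (0 : ℝ) ≠ 1 / 2 := by norm_num
    refine ⟨?_, fun hu' => ?_⟩
    · simp only [Pi.add_apply f g, MeshFlag.adapted_add, e1, e1']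
    · simp only [Pi.add_apply f g, MeshFlag.adapted_add]
      rw [deriv_fun_add ((d.adapted_differentiableAt (hf _)).2 u 0 h0)
          ((d.adapted_differentiableAt (hg _)).2 u 0 h0),
        deriv_fun_add (((M.glue d).adapted_differentiableAt (hf _)).2 u 0 h0)
          (((M.glue d).adapted_differentiableAt (hg _)).2 u 0 h0),
        deriv_fun_add (((M.glue d).adapted_differentiableAt (hf _)).1 u 0 hu')
          (((M.glue d).adapted_differentiableAt (hg _)).1 u 0 hu'), e2 hu', e2' hu']
      ring
  zero_mem' := by
    refine ⟨fun σ => zero_mem _, fun d _ u _ => ⟨?_, fun _ => ?_⟩⟩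
    · simp only [Pi.zero_apply, MeshFlag.adapted_zero]
    · simp only [Pi.zero_apply, MeshFlag.adapted_zero, deriv_const, mul_zero, add_zero]
  smul_mem' := by
    rintro t f ⟨hf, hf'⟩
    refine ⟨fun σ => Submodule.smul_mem _ t (hf σ), fun d hd u hu => ?_⟩
    obtain ⟨e1, e2⟩ := hf' d hd u hu
    refine ⟨?_, fun hu' => ?_⟩
    · simp only [Pi.smul_apply t f, MeshFlag.adapted_smul, e1]
    · simp only [Pi.smul_apply t f, MeshFlag.adapted_smul, deriv_const_mul_field, e2 hu']
      ring

/-! ### Separability of an edge -/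

/-- The `G¹` splines of bi-degree at most `(k, k)` on the sub-mesh made of the faces adjacent to the
edge of `d`, glued along this edge (extended by zero to the other faces). -/
def edgeSplines (r k : ℕ) (d : MeshFlag Φ) : Set (Φ → ℝ → ℝ → ℝ) :=
  {f | (∀ σ, f σ ∈ macroPatch r k) ∧ (∀ σ, σ ≠ d.face → σ ≠ (M.glue d).face → f σ = 0) ∧
    G.GluedAlong d f}

end GluingData

/-- The Taylor map at the end point of the edge of `d` at which `d` is based: Taylor data on the
face(s) adjacent to the edge. -/
def QuadMesh.endTaylor {Φ : Type*} (M : QuadMesh Φ) (d : MeshFlag Φ) (f : Φ → ℝ → ℝ → ℝ) :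
    (Fin 4 → ℝ) × (Fin 4 → ℝ) :=
  (cornerTaylor f d, cornerTaylor f (M.glue d))

namespace GluingData

variable {Φ : Type*} {M : QuadMesh Φ} (G : GluingData M)

/-- In degree `k`, the joint Taylor map at the two end points of the edge of `d` takes all pairs
whose components are Taylor data at the respective end point of splines of arbitrary degree on the
faces adjacent to the edge. -/
def Separates (r k : ℕ) (d : MeshFlag Φ) : Prop :=
  (fun f => (M.endTaylor d f, M.endTaylor d.rev f)) '' G.edgeSplines r k d =
    (⋃ j, M.endTaylor d '' G.edgeSplines r j d) ×ˢ (⋃ j, M.endTaylor d.rev '' G.edgeSplines r j d)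

/-- The separability of the edge of `d`: the least degree in which the end points are separated. -/
def separability (r : ℕ) (d : MeshFlag Φ) : ℕ∞ := ⨅ k ∈ {k : ℕ | G.Separates r k d}, (k : ℕ∞)

/-- The maximal separability over all edges. -/
def maxSeparability (r : ℕ) : ℕ∞ := ⨆ d, G.separability r d

/-! ### Dimensions and the parts of a basis -/

open Classical in
/-- The dimension of the space of syzygies of the gluing data along the edge `τ`. A boundary edge
has no gluing data; by convention the number is then `4k - 2r + 3`. (On an interior edge the
dimension does not depend on the flag chosen to represent the edge.) -/
def dTilde (r k : ℕ) (τ : M.Edge) : ℤ :=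
  if M.Glued τ.out then
    (Module.finrank ℝ (syzygies r k (G.a τ.out) (G.b τ.out) (G.c τ.out)) : ℤ)
  else 4 * k - 2 * r + 3

open Classical in
/-- `𝔠_τ(γ)`, for `τ` the edge of `d` and `γ` the vertex of `d`. -/
def crossing (d : MeshFlag Φ) : ℤ := if G.IsCrossing d then 1 else 0

open Classical in
/-- `𝔠_+(γ)`. -/
def crossingVertex (γ : M.Vertex) : ℤ := if G.IsCrossingVertex γ then 1 else 0

/-- The number of crossing edges at `γ`, counted with their ends at `γ`: exactly two flags, `d` and
`glue d`, represent an interior edge at a given end. -/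
def numCrossingEdges (γ : M.Vertex) : ℕ :=
  Nat.card {d : MeshFlag Φ // M.vertex d = γ ∧ G.IsCrossing d} / 2

end GluingData

namespace QuadMesh

variable {Φ : Type*} (M : QuadMesh Φ)

/-- `f` is attached to the vertex `γ`: it is supported on the faces containing `γ`, vanishes to
first order along the edges not containing `γ`, and its Taylor data vanish at the other vertices. -/
def AttachedToVertex (γ : M.Vertex) (f : Φ → ℝ → ℝ → ℝ) : Prop :=
  (∀ σ, (∀ d : MeshFlag Φ, d.face = σ → M.vertex d ≠ γ) → f σ = 0) ∧
  (∀ d : MeshFlag Φ, M.vertex d ≠ γ → M.vertex d.rev ≠ γ → VanishesAlong f d) ∧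
  (∀ d : MeshFlag Φ, M.vertex d ≠ γ → cornerTaylor f d = 0)

/-- `f` is attached to the edge `τ`: it is supported on the faces adjacent to `τ`, vanishes to first
order along all the other edges, and its Taylor data vanish at all vertices. -/
def AttachedToEdge (τ : M.Edge) (f : Φ → ℝ → ℝ → ℝ) : Prop :=
  (∀ σ, (∀ d : MeshFlag Φ, d.face = σ → M.edge d ≠ τ) → f σ = 0) ∧
  (∀ d : MeshFlag Φ, M.edge d ≠ τ → VanishesAlong f d) ∧
  (∀ d : MeshFlag Φ, cornerTaylor f d = 0)

end QuadMesh

/-- `f` is attached to the face `σ`: it is supported on `σ` and vanishes to first order along all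
edges. -/
def AttachedToFace {Φ : Type*} (σ : Φ) (f : Φ → ℝ → ℝ → ℝ) : Prop :=
  (∀ σ', σ' ≠ σ → f σ' = 0) ∧ ∀ d : MeshFlag Φ, VanishesAlong f d

end

/-!
A spline on the mesh is known by three layers of data: its Taylor data at the vertices, then its
1-jets (restriction and normal derivative) along the edges, then what is left inside the faces. If
all Taylor data vanish, the jets along different edges no longer interact; if all jets vanish, the
spline is an arbitrary family of clamped macro-patches, one on each face. So the spline space `S` has
a filtration `S ⊇ ker taylorMap ⊇ ker edgeMap`, whose successive quotients embed into products of
local spaces: `vertexSpace γ` over the vertices, `clampedEdgeSpace` over the edges and `clampedPatch`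
over the faces. The theorem says that these embeddings are onto, with preimages of small support
(`exists_attachedToVertex`, `exists_attachedToEdge`), and gives the dimensions of the local spaces.

*Lifting.* By Coons interpolation (`exists_sideJet_eq`) jets along the four sides of a face come from
a macro-patch as soon as they agree at the corners up to the mixed derivative. This needs cardinal
functions for Hermite interpolation at `0` and `1`, which exist because separability lets one
prescribe value and derivative at both ends of any one edge (`exists_isHermiteBasis`). Hence
splines can be built edge by edge (`exists_spline_jets_eq`). Given compatible Taylor data at a vertex,
separability provides jets along each edge at this vertex with the given data at this end and zero
data at the other end; elsewhere the jets are chosen to be zero.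

*Dimension at an edge.* Differentiating the restriction turns the jets along an interior edge into a
value at one end and a syzygy of `(a, b, c)`, so the space of jets has dimension `dTilde + 1`. The
Taylor data occurring at one end form an explicit space `endSpace` (`iUnion_endTaylor`) of dimension
`5`, or `4` if the edge is a crossing edge there: the mixed derivatives on the two faces are linked
exactly when `𝔞(0) = 0`. By separability both ends are independent, and the kernel has the dimension
stated.

*Dimension at a vertex.* The faces at a vertex form a fan, closed or not (`exists_isFan`). Going around
it, the Taylor data at a corner determine those at the next one, except for a free mixed derivative
at each edge which is not a crossing edge (`finrank_chainSpace`). At an interior vertex the chain has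
to close up (`chain_closes`): for values and gradients this is the first compatibility condition.
If the vertex is not a crossing vertex, start the fan behind an edge that is not a crossing edge, so
that the mixed derivative imposes no condition on closing; at a crossing vertex the second
compatibility condition makes it close by itself, and this accounts for the term `𝔠₊`.

Throughout, piecewise polynomials are represented by pairs of polynomials (`PolyPair`), which turns
the gluing conditions into polynomial identities (`gluedAlong_iff`).
-/

noncomputable section

open Polynomial

/-! ### Pairs of polynomials -/

/-- A pair of polynomials, thought of as the two pieces of a function on `[0, 1/2, 1]`. -/
abbrev PolyPair : Type := ℝ[X] × ℝ[X]

namespace PolyPair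

/-- The piecewise polynomial function with given pieces. -/
def toFun : PolyPair →ₐ[ℝ] (ℝ → ℝ) where
  toFun P := piecewisePoly P.1 P.2
  map_one' := by funext x; simp [piecewisePoly]
  map_mul' _ _ := by
    funext x
    simp only [piecewisePoly, Pi.mul_apply, Prod.fst_mul, Prod.snd_mul]
    split_ifs <;> simp
  map_zero' := by funext x; simp [piecewisePoly]
  map_add' _ _ := by
    funext x
    simp only [piecewisePoly, Pi.add_apply, Prod.fst_add, Prod.snd_add]
    split_ifs <;> simp
  commutes' t := by
    funext x
    simp [piecewisePoly]

theorem toFun_of_le (P : PolyPair) {x : ℝ} (hx : x ≤ 1 / 2) : toFun P x = P.1.eval x := if_pos hx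

theorem toFun_of_gt (P : PolyPair) {x : ℝ} (hx : 1 / 2 < x) : toFun P x = P.2.eval x :=
  if_neg (not_le.2 hx)

theorem eq_of_eqOn {P Q : PolyPair}
    (h : ∀ u ∈ Set.Icc (0 : ℝ) 1, u ≠ 1 / 2 → toFun P u = toFun Q u) : P = Q := by
  ext1
  · refine eq_of_infinite_eval_eq _ _ ((Set.Ioo_infinite (by norm_num : (0 : ℝ) < 1 / 2)).mono ?_)
    intro x hx
    have := h x ⟨hx.1.le, by linarith [hx.2]⟩ hx.2.ne
    rwa [toFun_of_le _ hx.2.le, toFun_of_le _ hx.2.le] at this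
  · refine eq_of_infinite_eval_eq _ _ ((Set.Ioo_infinite (by norm_num : (1 / 2 : ℝ) < 1)).mono ?_)
    intro x hx
    have := h x ⟨by linarith [hx.1], hx.2.le⟩ hx.1.ne'
    rwa [toFun_of_gt _ hx.1, toFun_of_gt _ hx.1] at this

theorem toFun_injective : Function.Injective toFun := fun _ _ h =>
  eq_of_eqOn fun u _ _ => congrFun h u

/-- A linear left inverse of `PolyPair.toFun`, with junk values off the piecewise polynomials. -/
def ofFun : (ℝ → ℝ) →ₗ[ℝ] PolyPair :=
  (toFun.toLinearMap.exists_leftInverse_of_injective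
    (LinearMap.ker_eq_bot.2 toFun_injective)).choose

@[simp] theorem ofFun_toFun (P : PolyPair) : ofFun (toFun P) = P :=
  LinearMap.congr_fun (toFun.toLinearMap.exists_leftInverse_of_injective
    (LinearMap.ker_eq_bot.2 toFun_injective)).choose_spec P

/-- The pairs of polynomials which are the pieces of the elements of `splineSpace s n`. -/
def spline (s n : ℕ) : Submodule ℝ PolyPair := (splineSpace s n).comap toFun.toLinearMap

theorem mem_spline {s n : ℕ} {P : PolyPair} : P ∈ spline s n ↔
    P.1.degree < n ∧ P.2.degree < n ∧
      ∀ j < s, (derivative^[j] P.1).eval (1 / 2) = (derivative^[j] P.2).eval (1 / 2) := by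
  constructor
  · rintro ⟨p, q, hp, hq, h, e⟩
    obtain rfl : P = (p, q) := toFun_injective e
    exact ⟨hp, hq, h⟩
  · rintro ⟨hp, hq, h⟩
    exact ⟨P.1, P.2, hp, hq, h, rfl⟩

theorem exists_of_mem {s n : ℕ} {f : ℝ → ℝ} (hf : f ∈ splineSpace s n) :
    ∃ P ∈ spline s n, toFun P = f := by
  obtain ⟨p, q, hp, hq, h, rfl⟩ := hf
  exact ⟨(p, q), mem_spline.2 ⟨hp, hq, h⟩, rfl⟩

theorem spline_mono {s n m : ℕ} (h : n ≤ m) : spline s n ≤ spline s m := fun P hP => by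
  rw [mem_spline] at hP ⊢
  have : (n : WithBot ℕ) ≤ m := by exact_mod_cast h
  exact ⟨hP.1.trans_le this, hP.2.1.trans_le this, hP.2.2⟩

theorem diag_mem_spline {s n : ℕ} {p : ℝ[X]} (hp : p.degree < n) : (p, p) ∈ spline s n :=
  mem_spline.2 ⟨hp, hp, fun _ _ => rfl⟩

/-- The reflection of `[0, 1]`. -/
def reflect : PolyPair →ₐ[ℝ] PolyPair :=
  ((aeval (1 - X : ℝ[X])).comp (AlgHom.snd ℝ ℝ[X] ℝ[X])).prod
    ((aeval (1 - X : ℝ[X])).comp (AlgHom.fst ℝ ℝ[X] ℝ[X]))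

theorem reflect_fst (P : PolyPair) : (reflect P).1 = P.2.comp (1 - X) := rfl

theorem reflect_snd (P : PolyPair) : (reflect P).2 = P.1.comp (1 - X) := rfl

@[simp] theorem reflect_reflect (P : PolyPair) : reflect (reflect P) = P := by
  ext1
  · rw [reflect_fst, reflect_snd, comp_assoc]; simp
  · rw [reflect_snd, reflect_fst, comp_assoc]; simp

theorem toFun_reflect (P : PolyPair) {x : ℝ} (hx : x ≠ 1 / 2) :
    toFun (reflect P) x = toFun P (1 - x) := by
  rcases lt_or_gt_of_ne hx with h | h
  · rw [toFun_of_le _ h.le, toFun_of_gt _ (by linarith), reflect_fst]; simp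
  · rw [toFun_of_gt _ h, toFun_of_le _ (by linarith), reflect_snd]; simp

/-- The derivatives of the two pieces. -/
def deriv : PolyPair →ₗ[ℝ] PolyPair := derivative.prodMap derivative

theorem deriv_fst (P : PolyPair) : (deriv P).1 = derivative P.1 := rfl

theorem deriv_snd (P : PolyPair) : (deriv P).2 = derivative P.2 := rfl

theorem deriv_reflect (P : PolyPair) : deriv (reflect P) = -reflect (deriv P) := by
  ext1
  · simp [deriv_fst, reflect_fst, deriv_snd, derivative_comp]
  · simp [deriv_fst, reflect_snd, deriv_snd, derivative_comp]

theorem hasDerivAt_toFun (P : PolyPair) {x : ℝ} (hx : x ≠ 1 / 2) :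
    HasDerivAt (toFun P) (toFun (deriv P) x) x := by
  rcases lt_or_gt_of_ne hx with h | h
  · rw [toFun_of_le _ h.le, deriv_fst]
    refine (P.1.hasDerivAt x).congr_of_eventuallyEq ?_
    filter_upwards [Iio_mem_nhds h] with y hy
    exact if_pos (le_of_lt hy)
  · rw [toFun_of_gt _ h, deriv_snd]
    refine (P.2.hasDerivAt x).congr_of_eventuallyEq ?_
    filter_upwards [Ioi_mem_nhds h] with y hy
    exact if_neg (not_le_of_gt hy)

theorem degree_comp_one_sub {p : ℝ[X]} : (p.comp (1 - X)).degree = p.degree := by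
  have h : (1 - X : ℝ[X]).natDegree = 1 := by
    rw [← natDegree_neg, neg_sub]; exact natDegree_X_sub_C (1 : ℝ)
  by_cases hp : p = 0
  · simp [hp]
  have h2 : p.comp (1 - X) ≠ 0 := by
    intro h0
    apply hp
    have : (p.comp (1 - X)).comp (1 - X) = p := by rw [comp_assoc]; simp
    rw [← this, h0, zero_comp]
  rw [degree_eq_natDegree hp, degree_eq_natDegree h2, natDegree_comp, h, mul_one]

theorem iterate_derivative_comp_one_sub_eval (p : ℝ[X]) (j : ℕ) (x : ℝ) :
    (derivative^[j] (p.comp (1 - X))).eval x = (-1) ^ j * (derivative^[j] p).eval (1 - x) := by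
  rw [iterate_derivative_comp_one_sub_X]
  simp

theorem reflect_mem_spline {s n : ℕ} {P : PolyPair} (hP : P ∈ spline s n) :
    reflect P ∈ spline s n := by
  rw [mem_spline] at hP ⊢
  rw [reflect_fst, reflect_snd, degree_comp_one_sub, degree_comp_one_sub]
  refine ⟨hP.2.1, hP.1, fun j hj => ?_⟩
  rw [iterate_derivative_comp_one_sub_eval, iterate_derivative_comp_one_sub_eval,
    show (1 : ℝ) - 1 / 2 = 1 / 2 by norm_num, hP.2.2 j hj]

theorem toFun_half_of_mem {s n : ℕ} {P : PolyPair} (hP : P ∈ spline (s + 1) n) :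
    P.1.eval (1 / 2) = P.2.eval (1 / 2) := (mem_spline.1 hP).2.2 0 (Nat.succ_pos _)

theorem toFun_reflect_of_mem {s n : ℕ} {P : PolyPair} (hP : P ∈ spline (s + 1) n) (x : ℝ) :
    toFun (reflect P) x = toFun P (1 - x) := by
  by_cases hx : x = 1 / 2
  · subst hx
    rw [toFun_of_le _ le_rfl, toFun_of_le _ (by norm_num), reflect_fst]
    simp only [eval_comp, eval_sub, eval_one, eval_X]
    rw [show (1 : ℝ) - 1 / 2 = 1 / 2 by norm_num, toFun_half_of_mem hP]
  · exact toFun_reflect P hx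

/-- The reflection of `[0, 1]` if `c = true`, the identity otherwise; see `MeshFlag.flip`. -/
def flip (c : Bool) : PolyPair →ₐ[ℝ] PolyPair := if c then reflect else AlgHom.id ℝ _

@[simp] theorem flip_false (P : PolyPair) : flip false P = P := rfl

@[simp] theorem flip_true (P : PolyPair) : flip true P = reflect P := rfl

@[simp] theorem flip_flip (c : Bool) (P : PolyPair) : flip c (flip c P) = P := by
  cases c <;> simp

theorem flip_not (c : Bool) (P : PolyPair) : flip (!c) P = reflect (flip c P) := by
  cases c <;> simp

theorem flip_mem_spline {s n : ℕ} {P : PolyPair} (c : Bool) (hP : P ∈ spline s n) :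
    flip c P ∈ spline s n := by
  cases c
  · exact hP
  · exact reflect_mem_spline hP

theorem toFun_flip_of_mem {s n : ℕ} {P : PolyPair} (hP : P ∈ spline (s + 1) n) (c : Bool) (x : ℝ) :
    toFun (flip c P) x = toFun P (MeshFlag.flip c x) := by
  cases c
  · rfl
  · exact toFun_reflect_of_mem hP x

/-- The value (`n = false`) or the derivative (`n = true`) at the origin. -/
def jet₀ (n : Bool) : PolyPair →ₗ[ℝ] ℝ :=
  leval 0 ∘ₗ (if n then derivative else LinearMap.id) ∘ₗ LinearMap.fst ℝ ℝ[X] ℝ[X]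

theorem jet₀_false (P : PolyPair) : jet₀ false P = P.1.eval 0 := rfl

theorem jet₀_true (P : PolyPair) : jet₀ true P = (derivative P.1).eval 0 := rfl

/-- The value (`n = false`) or the derivative in the inward direction (`n = true`) at the end point
`0` (`c = false`) or `1` (`c = true`) of `[0, 1]`. -/
def jetEnd (c n : Bool) : PolyPair →ₗ[ℝ] ℝ := jet₀ n ∘ₗ (flip c).toLinearMap

theorem jetEnd_apply (c n : Bool) (P : PolyPair) : jetEnd c n P = jet₀ n (flip c P) := rfl

theorem toFun_zero_eq (P : PolyPair) : toFun P 0 = jet₀ false P := toFun_of_le P (by norm_num)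

theorem deriv_toFun_zero (P : PolyPair) : _root_.deriv (toFun P) 0 = jet₀ true P := by
  rw [(hasDerivAt_toFun P (by norm_num)).deriv, toFun_of_le _ (by norm_num), deriv_fst, jet₀_true]

theorem exists_derivative_eq (p : ℝ[X]) : ∃ q : ℝ[X], derivative q = p := by
  induction p using Polynomial.induction_on' with
  | add p q hp hq =>
    obtain ⟨a, rfl⟩ := hp
    obtain ⟨b, rfl⟩ := hq
    exact ⟨a + b, by simp⟩
  | monomial n t =>
    refine ⟨monomial (n + 1) (t / (n + 1)), ?_⟩
    rw [derivative_monomial]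
    have : ((n : ℝ) + 1) ≠ 0 := by positivity
    congr 1
    push_cast
    field_simp

theorem degree_lt_succ_of_derivative {p : ℝ[X]} {n : ℕ} (h : (derivative p).degree < n) :
    p.degree < (n + 1 : ℕ) := by
  rcases Nat.eq_zero_or_pos p.natDegree with h0 | h0
  · refine degree_le_natDegree.trans_lt ?_
    rw [h0]
    exact_mod_cast Nat.succ_pos n
  · rw [degree_derivative h0.ne'] at h
    refine degree_le_natDegree.trans_lt ?_
    have : p.natDegree - 1 < n := by exact_mod_cast h
    have : p.natDegree < n + 1 := by omega
    exact_mod_cast this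

theorem deriv_mem_spline {s n : ℕ} {P : PolyPair} (hP : P ∈ spline (s + 1) (n + 1)) :
    deriv P ∈ spline s n := by
  rw [mem_spline] at hP ⊢
  have aux : ∀ p : ℝ[X], p.degree < (n + 1 : ℕ) → (derivative p).degree < n := by
    intro p hp
    rcases Nat.eq_zero_or_pos p.natDegree with h0 | h0
    · rw [derivative_of_natDegree_zero h0, degree_zero]
      exact WithBot.bot_lt_coe n
    · rw [degree_derivative h0.ne']
      rw [degree_eq_natDegree (by rintro rfl; simp at h0)] at hp
      have : p.natDegree < n + 1 := by exact_mod_cast hp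
      have : p.natDegree - 1 < n := by omega
      exact_mod_cast this
  exact ⟨aux _ hP.1, aux _ hP.2.1, fun j hj => hP.2.2 (j + 1) (by omega)⟩

/-- Antiderivatives of splines are splines, of one more order of smoothness and degree. -/
theorem exists_deriv_eq {s n : ℕ} {A : PolyPair} (hA : A ∈ spline s n) (z : ℝ) :
    ∃ P ∈ spline (s + 1) (n + 1), deriv P = A ∧ jet₀ false P = z := by
  obtain ⟨p, hp⟩ := exists_derivative_eq A.1
  obtain ⟨q, hq⟩ := exists_derivative_eq A.2
  rw [mem_spline] at hA
  set p' := p + C (z - p.eval 0) with hp'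
  set q' := q + C (p'.eval (1 / 2) - q.eval (1 / 2)) with hq'
  have dp : derivative p' = A.1 := by simp [hp', hp]
  have dq : derivative q' = A.2 := by simp [hq', hq]
  refine ⟨(p', q'), mem_spline.2 ⟨?_, ?_, ?_⟩, ?_, ?_⟩
  · exact degree_lt_succ_of_derivative (by rw [dp]; exact hA.1)
  · exact degree_lt_succ_of_derivative (by rw [dq]; exact hA.2.1)
  · rintro (_ | j) hj
    · simp [hq']
    · simp only [Function.iterate_succ_apply, dp, dq]
      exact hA.2.2 j (by omega)
  · ext1
    · exact dp
    · exact dq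
  · simp [jet₀_false, hp']

theorem eq_of_deriv_eq_zero {s n : ℕ} {P : PolyPair} (hP : P ∈ spline (s + 1) n)
    (h : deriv P = 0) (h0 : jet₀ false P = 0) : P = 0 := by
  have h1 : derivative P.1 = 0 := congrArg Prod.fst h
  have h2 : derivative P.2 = 0 := congrArg Prod.snd h
  have e1 := eq_C_of_derivative_eq_zero h1
  have e2 := eq_C_of_derivative_eq_zero h2
  have e := toFun_half_of_mem hP
  rw [jet₀_false] at h0
  rw [e1] at e h0
  rw [e2] at e
  simp only [eval_C] at e h0
  ext1
  · rw [e1, h0]; simp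
  · rw [e2, ← e, h0]; simp

/-! ### The dimension of the spline spaces -/

/-- The jump at `1/2` of the Taylor coefficients of order `< s`. -/
def jump (s n : ℕ) : (degreeLT ℝ n × degreeLT ℝ n) →ₗ[ℝ] (Fin s → ℝ) :=
  LinearMap.pi fun j => lcoeff ℝ j ∘ₗ taylor (1 / 2 : ℝ) ∘ₗ
    ((degreeLT ℝ n).subtype ∘ₗ LinearMap.fst ℝ _ _ - (degreeLT ℝ n).subtype ∘ₗ LinearMap.snd ℝ _ _)

theorem jump_surjective {s n : ℕ} (h : s ≤ n) : Function.Surjective (jump s n) := by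
  intro v
  let w := (degreeLTEquiv ℝ s).symm v
  have hw : (w : ℝ[X]).degree < n :=
    (mem_degreeLT.1 w.2).trans_le (by exact_mod_cast h)
  refine ⟨(⟨taylor (-(1 / 2)) (w : ℝ[X]), mem_degreeLT.2 (by rwa [degree_taylor])⟩, 0), ?_⟩
  funext j
  have : (degreeLTEquiv ℝ s) w j = v j := by simp [w]
  rw [← this]
  simp [jump, taylor_taylor, degreeLTEquiv]

theorem mem_ker_jump {s n : ℕ} (x : degreeLT ℝ n × degreeLT ℝ n) :
    x ∈ LinearMap.ker (jump s n) ↔ ((x.1 : ℝ[X]), (x.2 : ℝ[X])) ∈ spline s n := by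
  rw [mem_spline, LinearMap.mem_ker, funext_iff]
  have h1 := mem_degreeLT.1 x.1.2
  have h2 := mem_degreeLT.1 x.2.2
  simp only [h1, h2, true_and]
  have key : ∀ j : Fin s, jump s n x j = (0 : Fin s → ℝ) j ↔
      (derivative^[j] (x.1 : ℝ[X])).eval (1 / 2) = (derivative^[j] (x.2 : ℝ[X])).eval (1 / 2) := by
    intro j
    have hj : jump s n x j = (hasseDeriv j (x.1 : ℝ[X])).eval (1 / 2)
        - (hasseDeriv j (x.2 : ℝ[X])).eval (1 / 2) := by
      simp [jump, taylor_coeff]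
    have hd : ∀ p : ℝ[X], (derivative^[j] p).eval (1 / 2) =
        (j.1.factorial : ℝ) * (hasseDeriv j p).eval (1 / 2) := by
      intro p
      rw [← factorial_smul_hasseDeriv]
      simp
    have hf : (j.1.factorial : ℝ) ≠ 0 := by exact_mod_cast j.1.factorial_ne_zero
    rw [hj, hd, hd, Pi.zero_apply, sub_eq_zero]
    exact ⟨fun h => by rw [h], fun h => mul_left_cancel₀ hf h⟩
  constructor
  · intro h j hj
    exact (key ⟨j, hj⟩).1 (h ⟨j, hj⟩)
  · intro h j
    exact (key j).2 (h j j.2)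

/-- The splines are the pairs of polynomials without jump at `1/2`. -/
def kerJumpEquiv (s n : ℕ) : LinearMap.ker (jump s n) ≃ₗ[ℝ] spline s n where
  toFun x := ⟨(x.1.1, x.1.2), (mem_ker_jump x.1).1 x.2⟩
  map_add' _ _ := rfl
  map_smul' _ _ := rfl
  invFun P := ⟨(⟨P.1.1, mem_degreeLT.2 (mem_spline.1 P.2).1⟩,
    ⟨P.1.2, mem_degreeLT.2 (mem_spline.1 P.2).2.1⟩), (mem_ker_jump _).2 P.2⟩
  left_inv _ := rfl
  right_inv _ := rfl

instance degreeLT_finite (n : ℕ) : Module.Finite ℝ (degreeLT ℝ n) :=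
  Module.Finite.equiv (degreeLTEquiv ℝ n).symm

instance spline_finite (s n : ℕ) : Module.Finite ℝ (spline s n) :=
  Module.Finite.equiv (kerJumpEquiv s n)

theorem finrank_spline {s n : ℕ} (h : s ≤ n) : Module.finrank ℝ (spline s n) + s = 2 * n := by
  have h1 := LinearMap.finrank_range_add_finrank_ker (jump s n)
  rw [LinearMap.range_eq_top.2 (jump_surjective h), finrank_top, Module.finrank_prod,
    (kerJumpEquiv s n).finrank_eq, (degreeLTEquiv ℝ n).finrank_eq] at h1
  simp only [Module.finrank_fin_fun] at h1
  omega

end PolyPair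

end

noncomputable section

open Polynomial

/-! ### Jets of macro-patches along the sides of a face -/

section MacroPatch

open PolyPair

variable {Φ : Type*} {r k : ℕ}

/-- The macro-patch `(u, v) ↦ P(u) Q(v)`. -/
def prodPatch (r k : ℕ) :
    spline (r + 1) (k + 1) →ₗ[ℝ] spline (r + 1) (k + 1) →ₗ[ℝ] macroPatch r k :=
  LinearMap.mk₂ ℝ
    (fun P Q => ⟨fun u v => toFun P.1 u * toFun Q.1 v,
      Submodule.subset_span ⟨_, P.2, _, Q.2, rfl⟩⟩)
    (fun P P' Q => by ext u v; simp [add_mul])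
    (fun t P Q => by ext u v; simp [mul_assoc])
    (fun P Q Q' => by ext u v; simp [mul_add])
    (fun t P Q => by ext u v; simp [mul_left_comm])

theorem prodPatch_apply (P Q : spline (r + 1) (k + 1)) (u v : ℝ) :
    (prodPatch r k P Q : ℝ → ℝ → ℝ) u v = toFun P.1 u * toFun Q.1 v := rfl

theorem macroPatch_induction {p : macroPatch r k → Prop} (h : ∀ P Q, p (prodPatch r k P Q))
    (h0 : p 0) (hadd : ∀ F G, p F → p G → p (F + G)) (hsmul : ∀ (t : ℝ) F, p F → p (t • F))
    (F : macroPatch r k) : p F := by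
  obtain ⟨F, hF⟩ := F
  induction hF using Submodule.span_induction with
  | mem F hF =>
    obtain ⟨g, hg, h', hh, rfl⟩ := hF
    obtain ⟨P, hP, rfl⟩ := exists_of_mem hg
    obtain ⟨Q, hQ, rfl⟩ := exists_of_mem hh
    exact h ⟨P, hP⟩ ⟨Q, hQ⟩
  | zero => exact h0
  | add F G hF hG h1 h2 => exact hadd _ _ h1 h2
  | smul t F hF h1 => exact hsmul t _ h1

theorem macroPatch_hom_ext {V : Type*} [AddCommGroup V] [Module ℝ V]
    {f g : macroPatch r k →ₗ[ℝ] V} (h : ∀ P Q, f (prodPatch r k P Q) = g (prodPatch r k P Q)) :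
    f = g := by
  ext F
  induction F using macroPatch_induction with
  | h P Q => exact h P Q
  | h0 => rw [map_zero, map_zero]
  | hadd F G hF hG => rw [map_add, map_add, hF, hG]
  | hsmul t F hF => rw [map_smul, map_smul, hF]

namespace MeshFlag

/-- The factor of `P(u) Q(v)` that varies along the side of `d`, in the adapted coordinates. -/
def along (d : MeshFlag Φ) (P Q : PolyPair) : PolyPair :=
  if d.axis then PolyPair.flip d.cv Q else PolyPair.flip d.cu P

/-- The factor of `P(u) Q(v)` that is constant along the side of `d`, in the adapted coordinates. -/
def across (d : MeshFlag Φ) (P Q : PolyPair) : PolyPair :=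
  if d.axis then PolyPair.flip d.cu P else PolyPair.flip d.cv Q

/-- The restriction of `F` (`n = false`) or of its normal derivative (`n = true`) to the side
of `d`. -/
def sideFun (d : MeshFlag Φ) (n : Bool) (F : ℝ → ℝ → ℝ) : ℝ → ℝ := fun x =>
  if n then _root_.deriv (fun y => d.adapted F x y) 0 else d.adapted F x 0

theorem adapted_prodPatch (d : MeshFlag Φ) (P Q : spline (r + 1) (k + 1)) (x y : ℝ) :
    d.adapted (prodPatch r k P Q) x y = toFun (d.along P Q) x * toFun (d.across P Q) y := by
  obtain ⟨σ, cu, cv, ax⟩ := d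
  cases ax
  · simp [adapted, along, across, prodPatch_apply, toFun_flip_of_mem P.2, toFun_flip_of_mem Q.2]
  · simp [adapted, along, across, prodPatch_apply, toFun_flip_of_mem P.2, toFun_flip_of_mem Q.2,
      mul_comm]

theorem along_mem (d : MeshFlag Φ) (P Q : spline (r + 1) (k + 1)) :
    d.along P Q ∈ spline (r + 1) (k + 1) := by
  unfold along
  split_ifs
  · exact flip_mem_spline _ Q.2
  · exact flip_mem_spline _ P.2

theorem sideFun_prodPatch (d : MeshFlag Φ) (n : Bool) (P Q : spline (r + 1) (k + 1)) :
    d.sideFun n (prodPatch r k P Q) = toFun (jet₀ n (d.across P Q) • d.along P Q) := by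
  funext x
  cases n
  · simp only [sideFun, adapted_prodPatch, toFun_zero_eq]
    simp [mul_comm]
  · simp only [sideFun, adapted_prodPatch, if_true]
    rw [deriv_const_mul_field, deriv_toFun_zero]
    simp [mul_comm]

theorem sideFun_add (d : MeshFlag Φ) (n : Bool) (F G : macroPatch r k) :
    d.sideFun n (F + G : macroPatch r k) = d.sideFun n F + d.sideFun n G := by
  funext x
  have h0 : (0 : ℝ) ≠ 1 / 2 := by norm_num
  cases n
  · exact d.adapted_add _ _ _ _
  · simp only [sideFun, if_true, Pi.add_apply, Submodule.coe_add, adapted_add]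
    exact deriv_fun_add ((d.adapted_differentiableAt F.2).2 x 0 h0)
      ((d.adapted_differentiableAt G.2).2 x 0 h0)

theorem sideFun_smul (d : MeshFlag Φ) (n : Bool) (t : ℝ) (F : macroPatch r k) :
    d.sideFun n (t • F : macroPatch r k) = t • d.sideFun n F := by
  funext x
  cases n
  · exact d.adapted_smul _ _ _ _
  · simp only [sideFun, if_true, Pi.smul_apply, Submodule.coe_smul, adapted_smul, smul_eq_mul]
    exact deriv_const_mul_field _

/-- The restriction of `F` (`n = false`) or of its normal derivative (`n = true`) to the side
of `d`, as a pair of polynomials. -/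
def sideJet (r k : ℕ) (d : MeshFlag Φ) (n : Bool) : macroPatch r k →ₗ[ℝ] PolyPair where
  toFun F := ofFun (d.sideFun n F)
  map_add' F G := by rw [sideFun_add, map_add]
  map_smul' t F := by rw [sideFun_smul, map_smul]; rfl

@[simp] theorem sideJet_prodPatch (d : MeshFlag Φ) (n : Bool) (P Q : spline (r + 1) (k + 1)) :
    sideJet r k d n (prodPatch r k P Q) = jet₀ n (d.across P Q) • d.along P Q := by
  change ofFun (d.sideFun n _) = _
  rw [sideFun_prodPatch, ofFun_toFun]

theorem sideJet_mem (d : MeshFlag Φ) (n : Bool) (F : macroPatch r k) :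
    sideJet r k d n F ∈ spline (r + 1) (k + 1) := by
  induction F using macroPatch_induction with
  | h P Q => rw [sideJet_prodPatch]; exact Submodule.smul_mem _ _ (d.along_mem P Q)
  | h0 => rw [map_zero]; exact zero_mem _
  | hadd F G hF hG => rw [map_add]; exact add_mem hF hG
  | hsmul t F hF => rw [map_smul]; exact Submodule.smul_mem _ _ hF

theorem toFun_sideJet (d : MeshFlag Φ) (n : Bool) (F : macroPatch r k) :
    toFun (sideJet r k d n F) = d.sideFun n F := by
  induction F using macroPatch_induction with
  | h P Q => rw [sideJet_prodPatch, sideFun_prodPatch]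
  | h0 =>
    rw [map_zero, map_zero]
    have := d.sideFun_smul n 0 (0 : macroPatch r k)
    rw [zero_smul, zero_smul] at this
    exact this.symm
  | hadd F G hF hG => rw [map_add, map_add, hF, hG, sideFun_add]
  | hsmul t F hF => rw [map_smul, map_smul, hF, sideFun_smul]

theorem rev_rev (d : MeshFlag Φ) : d.rev.rev = d := by
  obtain ⟨σ, cu, cv, ax⟩ := d
  cases ax <;> simp [rev]

theorem rev_ne (d : MeshFlag Φ) : d.rev ≠ d := by
  obtain ⟨σ, cu, cv, ax⟩ := d
  cases ax <;> simp [rev]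

theorem rev_face (d : MeshFlag Φ) : d.rev.face = d.face := by
  obtain ⟨σ, cu, cv, ax⟩ := d
  cases ax <;> simp [rev]

theorem turn_turn (d : MeshFlag Φ) : d.turn.turn = d := by
  obtain ⟨σ, cu, cv, ax⟩ := d
  simp [turn]

theorem turn_ne (d : MeshFlag Φ) : d.turn ≠ d := by
  obtain ⟨σ, cu, cv, ax⟩ := d
  simp [turn]

theorem sideJet_rev (d : MeshFlag Φ) (n : Bool) (F : macroPatch r k) :
    sideJet r k d.rev n F = reflect (sideJet r k d n F) := by
  suffices h : sideJet r k d.rev n = reflect.toLinearMap ∘ₗ sideJet r k d n from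
    LinearMap.congr_fun h F
  refine macroPatch_hom_ext fun P Q => ?_
  simp only [LinearMap.comp_apply, sideJet_prodPatch, AlgHom.toLinearMap_apply, map_smul]
  obtain ⟨σ, cu, cv, ax⟩ := d
  cases ax <;> simp [rev, along, across, flip_not]

/-- The symmetry of the mixed derivative at a corner. -/
theorem jet₀_sideJet_turn (d : MeshFlag Φ) (m n : Bool) (F : macroPatch r k) :
    jet₀ m (sideJet r k d.turn n F) = jet₀ n (sideJet r k d m F) := by
  suffices h : jet₀ m ∘ₗ sideJet r k d.turn n = jet₀ n ∘ₗ sideJet r k d m from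
    LinearMap.congr_fun h F
  refine macroPatch_hom_ext fun P Q => ?_
  simp only [LinearMap.comp_apply, sideJet_prodPatch, map_smul, smul_eq_mul]
  obtain ⟨σ, cu, cv, ax⟩ := d
  cases ax <;> simp [turn, along, across, mul_comm]

end MeshFlag

/-- The Taylor data `f, ∂_x f, ∂_y f, ∂_x ∂_y f` at the origin, for a function with restriction
`D false` and normal derivative `D true` along the side `y = 0`. -/
def endJet (D : Bool → PolyPair) : Fin 4 → ℝ :=
  ![jet₀ false (D false), jet₀ true (D false), jet₀ false (D true), jet₀ true (D true)]

theorem taylor_adapted (d : MeshFlag Φ) (F : macroPatch r k) :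
    _root_.taylor (d.adapted F) = endJet fun n => MeshFlag.sideJet r k d n F := by
  have h1 : d.sideFun false F = fun x => d.adapted F x 0 := rfl
  have h2 : d.sideFun true F = fun x => deriv (fun y => d.adapted F x y) 0 := rfl
  unfold _root_.taylor endJet
  simp only [← toFun_zero_eq, ← deriv_toFun_zero, MeshFlag.toFun_sideJet]
  rw [h1, h2]

/-! ### Macro-patches with prescribed jets along the sides -/

/-- Cardinal functions of Hermite interpolation: `e (c, n)` has value or inward derivative `1`
(according to `n`) at the end point `c`, all other such data being `0`. -/
def IsHermiteBasis (e : Bool × Bool → spline (r + 1) (k + 1)) : Prop :=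
  ∀ i j : Bool × Bool, jetEnd i.1 i.2 (e j).1 = if i = j then 1 else 0

/-- Transfinite (Coons) interpolation of jets along the four sides of the face `σ`. -/
theorem exists_sideJet_eq {e : Bool × Bool → spline (r + 1) (k + 1)} (he : IsHermiteBasis e)
    (σ : Φ) (D : MeshFlag Φ → Bool → PolyPair)
    (hmem : ∀ d n, D d n ∈ spline (r + 1) (k + 1))
    (hrev : ∀ d n, D d.rev n = reflect (D d n))
    (hturn : ∀ d m n, jet₀ m (D d.turn n) = jet₀ n (D d m)) :
    ∃ F : macroPatch r k,
      (∀ d n, d.face = σ → MeshFlag.sideJet r k d n F = D d n) ∧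
      ((∀ d, d.face = σ → D d = 0) → F = 0) := by
  let q : Bool × Bool → spline (r + 1) (k + 1) := fun i => ⟨D ⟨σ, false, i.1, false⟩ i.2, hmem _ _⟩
  let p : Bool × Bool → spline (r + 1) (k + 1) := fun i => ⟨D ⟨σ, i.1, false, true⟩ i.2, hmem _ _⟩
  have hq : ∀ cu cv n, D ⟨σ, cu, cv, false⟩ n = PolyPair.flip cu (q (cv, n)).1 := by
    intro cu cv n
    cases cu
    · rfl
    · exact hrev ⟨σ, false, cv, false⟩ n
  have hp : ∀ cu cv n, D ⟨σ, cu, cv, true⟩ n = PolyPair.flip cv (p (cu, n)).1 := by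
    intro cu cv n
    cases cv
    · rfl
    · exact hrev ⟨σ, cu, false, true⟩ n
  have hpq : ∀ i j : Bool × Bool, jetEnd i.1 i.2 (p j).1 = jetEnd j.1 j.2 (q i).1 := by
    rintro ⟨c, n⟩ ⟨c', n'⟩
    rw [jetEnd_apply, jetEnd_apply, ← hp, ← hq]
    exact hturn ⟨σ, c', c, false⟩ n n'
  have he' : ∀ c n j, jetEnd c n (e j).1 = if (c, n) = j then 1 else 0 := fun c n => he (c, n)
  have hpq' : ∀ c n j, jetEnd c n (p j).1 = jetEnd j.1 j.2 (q (c, n)).1 := fun c n => hpq (c, n)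
  refine ⟨∑ i, prodPatch r k (q i) (e i) + ∑ i, prodPatch r k (e i) (p i)
    - ∑ i, ∑ j, jetEnd j.1 j.2 (q i).1 • prodPatch r k (e j) (e i), ?_, ?_⟩
  · rintro ⟨σ', cu, cv, ax⟩ n rfl
    cases ax
    · have key : ∀ P : PolyPair, jet₀ n (PolyPair.flip cv P) = jetEnd cv n P :=
        fun _ => rfl
      simp only [map_sub, map_add, map_sum, map_smul, MeshFlag.sideJet_prodPatch, MeshFlag.along,
        MeshFlag.across, Bool.false_eq_true, if_false, key, he', hpq']
      simp only [ite_smul, one_smul, zero_smul, smul_ite, smul_zero]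
      rw [Finset.sum_comm (f := fun i j => ite _ _ _)]
      simp only [Finset.sum_ite_eq, Finset.mem_univ, if_true]
      rw [hq]
      abel
    · have key : ∀ P : PolyPair, jet₀ n (PolyPair.flip cu P) = jetEnd cu n P :=
        fun _ => rfl
      simp only [map_sub, map_add, map_sum, map_smul, MeshFlag.sideJet_prodPatch, MeshFlag.along,
        MeshFlag.across, if_true, key, he']
      simp only [ite_smul, one_smul, zero_smul, smul_ite, smul_zero]
      simp only [Finset.sum_ite_eq, Finset.mem_univ, if_true]
      rw [hp]
      abel
  · intro h
    have hq0 : ∀ i, q i = 0 := fun i => Subtype.ext (congrFun (h _ rfl) i.2)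
    have hp0 : ∀ i, p i = 0 := fun i => Subtype.ext (congrFun (h _ rfl) i.2)
    simp [hq0, hp0]

/-- The splines whose values and derivatives vanish at `0` and `1`. -/
def clampedSpline (r k : ℕ) : Submodule ℝ (spline (r + 1) (k + 1)) :=
  LinearMap.ker (LinearMap.pi fun i : Bool × Bool => jetEnd i.1 i.2 ∘ₗ Submodule.subtype _)

theorem mem_clampedSpline {P : spline (r + 1) (k + 1)} :
    P ∈ clampedSpline r k ↔ ∀ i : Bool × Bool, jetEnd i.1 i.2 P.1 = 0 := by
  simp only [clampedSpline, LinearMap.mem_ker, funext_iff]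
  rfl

theorem finrank_clampedSpline {e : Bool × Bool → spline (r + 1) (k + 1)} (he : IsHermiteBasis e) :
    Module.finrank ℝ (clampedSpline r k) + 4 = Module.finrank ℝ (spline (r + 1) (k + 1)) := by
  rw [← LinearMap.finrank_range_add_finrank_ker (LinearMap.pi fun i : Bool × Bool =>
    jetEnd i.1 i.2 ∘ₗ Submodule.subtype (spline (r + 1) (k + 1))), LinearMap.range_eq_top.2,
    finrank_top, Module.finrank_pi, add_comm]
  · rfl
  · intro v
    refine ⟨∑ j, v j • e j, ?_⟩
    funext i
    have : ∀ i j : Bool × Bool, (jetEnd i.1 i.2) (e j).1 = if i = j then 1 else 0 := he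
    simp [this]

/-- The macro-patches vanishing to first order along all sides. -/
def clampedPatch (Φ : Type*) (r k : ℕ) : Submodule ℝ (macroPatch r k) :=
  ⨅ (d : MeshFlag Φ) (n : Bool), LinearMap.ker (MeshFlag.sideJet r k d n)

theorem mem_clampedPatch {F : macroPatch r k} :
    F ∈ clampedPatch Φ r k ↔ ∀ (d : MeshFlag Φ) n, MeshFlag.sideJet r k d n F = 0 := by
  simp [clampedPatch]

theorem prodPatch_mem_clampedPatch {P Q : spline (r + 1) (k + 1)} (hP : P ∈ clampedSpline r k)
    (hQ : Q ∈ clampedSpline r k) : prodPatch r k P Q ∈ clampedPatch Φ r k := by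
  rw [mem_clampedSpline] at hP hQ
  rw [mem_clampedPatch]
  rintro ⟨σ, cu, cv, ax⟩ n
  rw [MeshFlag.sideJet_prodPatch]
  cases ax
  · have := hQ (cv, n)
    rw [jetEnd_apply] at this
    simp [MeshFlag.across, this]
  · have := hP (cu, n)
    rw [jetEnd_apply] at this
    simp [MeshFlag.across, this]

/-- Removing from a macro-patch its Coons interpolant amounts to removing the Hermite interpolant
in both factors of a product; so a macro-patch vanishing to first order along the sides is a sum of
products of clamped splines. -/
theorem mem_span_of_mem_clampedPatch [Nonempty Φ] {e : Bool × Bool → spline (r + 1) (k + 1)}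
    (he : IsHermiteBasis e) {F : macroPatch r k} (hF : F ∈ clampedPatch Φ r k) :
    F ∈ Submodule.span ℝ {F | ∃ P ∈ clampedSpline r k, ∃ Q ∈ clampedSpline r k,
      F = prodPatch r k P Q} := by
  obtain ⟨σ⟩ := ‹Nonempty Φ›
  set Z := Submodule.span ℝ {F | ∃ P ∈ clampedSpline r k, ∃ Q ∈ clampedSpline r k,
      F = prodPatch r k P Q}
  let q : Bool × Bool → macroPatch r k →ₗ[ℝ] spline (r + 1) (k + 1) := fun i =>
    LinearMap.codRestrict _ (MeshFlag.sideJet r k ⟨σ, false, i.1, false⟩ i.2)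
      (MeshFlag.sideJet_mem _ _)
  let p : Bool × Bool → macroPatch r k →ₗ[ℝ] spline (r + 1) (k + 1) := fun i =>
    LinearMap.codRestrict _ (MeshFlag.sideJet r k ⟨σ, i.1, false, true⟩ i.2)
      (MeshFlag.sideJet_mem _ _)
  have hq : ∀ i P Q, q i (prodPatch r k P Q) = jetEnd i.1 i.2 Q.1 • P := fun i P Q =>
    Subtype.ext (MeshFlag.sideJet_prodPatch _ _ _ _)
  have hp : ∀ i P Q, p i (prodPatch r k P Q) = jetEnd i.1 i.2 P.1 • Q := fun i P Q =>
    Subtype.ext (MeshFlag.sideJet_prodPatch _ _ _ _)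
  have hproj : ∀ P : spline (r + 1) (k + 1), P - ∑ i, jetEnd i.1 i.2 P.1 • e i ∈
      clampedSpline r k := by
    intro P
    rw [mem_clampedSpline]
    intro i
    have : ∀ i j : Bool × Bool, (jetEnd i.1 i.2) (e j).1 = if i = j then 1 else 0 := he
    simp [this]
  have key : ∀ F : macroPatch r k, F - (∑ i, prodPatch r k (q i F) (e i)
      + ∑ i, prodPatch r k (e i) (p i F)
      - ∑ i, ∑ j, jetEnd j.1 j.2 (q i F).1 • prodPatch r k (e j) (e i)) ∈ Z := by
    intro F
    induction F using macroPatch_induction with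
    | h P Q =>
      refine Submodule.subset_span ⟨_, hproj P, _, hproj Q, ?_⟩
      simp only [hq, hp, map_sub, map_sum, map_smul, LinearMap.sub_apply, LinearMap.sum_apply,
        LinearMap.smul_apply, Submodule.coe_smul, smul_eq_mul, smul_sub,
        Finset.sum_sub_distrib, Finset.smul_sum, smul_smul]
      abel
    | h0 => simp
    | hadd F G hF hG =>
      convert add_mem hF hG using 1
      simp only [map_add, LinearMap.add_apply, Submodule.coe_add, add_smul, Finset.sum_add_distrib]
      abel
    | hsmul t F hF =>
      convert Submodule.smul_mem _ t hF using 1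
      simp only [map_smul, LinearMap.smul_apply, Submodule.coe_smul, smul_eq_mul, smul_sub,
        smul_add, Finset.smul_sum, smul_smul]
  rw [mem_clampedPatch] at hF
  have hq0 : ∀ i, q i F = 0 := fun i => Subtype.ext (hF _ _)
  have hp0 : ∀ i, p i F = 0 := fun i => Subtype.ext (hF _ _)
  have := key F
  simpa [hq0, hp0] using this

/-- Products of linearly independent functions of two different variables are linearly
independent. -/
theorem linearIndependent_prodPatch {ι : Type*} [Fintype ι] {b : ι → spline (r + 1) (k + 1)}
    (hb : LinearIndependent ℝ b) :
    LinearIndependent ℝ fun i : ι × ι => prodPatch r k (b i.1) (b i.2) := by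
  rw [Fintype.linearIndependent_iff] at hb ⊢
  intro c hc
  have h1 : ∀ v i, ∑ j, c (i, j) * toFun (b j).1 v = 0 := by
    intro v
    refine hb (fun i => ∑ j, c (i, j) * toFun (b j).1 v) (Subtype.ext (toFun_injective ?_))
    funext u
    have := congrFun (congrFun (congrArg Subtype.val hc) u) v
    rw [Fintype.sum_prod_type] at this
    simp only [Submodule.coe_sum, Submodule.coe_smul, Finset.sum_apply, Pi.smul_apply,
      prodPatch_apply, smul_eq_mul, Submodule.coe_zero, Pi.zero_apply] at this
    simp only [Submodule.coe_sum, Submodule.coe_smul, map_sum, map_smul, Finset.sum_apply,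
      Pi.smul_apply, smul_eq_mul, Submodule.coe_zero, map_zero, Pi.zero_apply]
    rw [← this]
    refine Finset.sum_congr rfl fun i _ => ?_
    rw [Finset.sum_mul]
    exact Finset.sum_congr rfl fun j _ => by ring
  rintro ⟨i, j⟩
  refine hb (fun j => c (i, j)) (Subtype.ext (toFun_injective ?_)) j
  funext v
  have := h1 v i
  simpa using this

theorem exists_family_of_submodule {V : Type*} [AddCommGroup V] [Module ℝ V] [Module.Finite ℝ V]
    (W : Submodule ℝ V) : ∃ (m : ℕ) (b : Fin m → V), m = Module.finrank ℝ W ∧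
      LinearIndependent ℝ b ∧ (∀ i, b i ∈ W) ∧ ∀ x ∈ W, ∃ c : Fin m → ℝ, x = ∑ i, c i • b i := by
  let b := Module.finBasis ℝ W
  refine ⟨_, fun i => b i, rfl, b.linearIndependent.map' W.subtype W.ker_subtype,
    fun i => (b i).2, fun x hx => ⟨b.repr ⟨x, hx⟩, ?_⟩⟩
  have := congrArg Subtype.val (b.sum_repr ⟨x, hx⟩)
  rw [Submodule.coe_sum] at this
  exact this.symm

theorem finrank_clampedPatch [Nonempty Φ] {e : Bool × Bool → spline (r + 1) (k + 1)}
    (he : IsHermiteBasis e) : Module.finrank ℝ (clampedPatch Φ r k) =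
      Module.finrank ℝ (clampedSpline r k) ^ 2 := by
  obtain ⟨m, b', hm, hli, hmem, hb⟩ := exists_family_of_submodule (clampedSpline r k)
  have h2 := linearIndependent_prodPatch hli
  have hspan : clampedPatch Φ r k =
      Submodule.span ℝ (Set.range fun i : Fin m × Fin m => prodPatch r k (b' i.1) (b' i.2)) := by
    apply le_antisymm
    · intro F hF
      refine Submodule.span_le.2 ?_ (mem_span_of_mem_clampedPatch he hF)
      rintro _ ⟨P, hP, Q, hQ, rfl⟩
      obtain ⟨c, rfl⟩ := hb P hP
      obtain ⟨c', rfl⟩ := hb Q hQ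
      simp only [map_sum, map_smul, LinearMap.sum_apply, LinearMap.smul_apply]
      refine sum_mem fun i _ => Submodule.smul_mem _ _ (sum_mem fun j _ =>
        Submodule.smul_mem _ _ (Submodule.subset_span ⟨(j, i), rfl⟩))
    · rw [Submodule.span_le]
      rintro _ ⟨i, rfl⟩
      exact prodPatch_mem_clampedPatch (hmem i.1) (hmem i.2)
  rw [← hm]
  rw [hspan, finrank_span_eq_card h2]
  simp [sq]

end MacroPatch

end

noncomputable section

open Polynomial PolyPair

/-! ### The gluing conditions as identities between polynomials -/

namespace PolyPair

theorem spline_anti {s t n : ℕ} (h : s ≤ t) : spline t n ≤ spline s n := fun P hP => by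
  rw [mem_spline] at hP ⊢
  exact ⟨hP.1, hP.2.1, fun j hj => hP.2.2 j (hj.trans_le h)⟩

theorem jet₀_false_mul (P Q : PolyPair) : jet₀ false (P * Q) = jet₀ false P * jet₀ false Q := by
  simp [jet₀_false]

theorem jet₀_true_mul (P Q : PolyPair) :
    jet₀ true (P * Q) = jet₀ true P * jet₀ false Q + jet₀ false P * jet₀ true Q := by
  simp [jet₀_false, jet₀_true]

theorem jet₀_false_deriv (P : PolyPair) : jet₀ false (deriv P) = jet₀ true P := rfl

end PolyPair

namespace QuadMesh

variable {Φ : Type*} (M : QuadMesh Φ)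

theorem glued_rev {d : MeshFlag Φ} : M.Glued d.rev ↔ M.Glued d := by
  unfold Glued
  rw [M.glue_rev]
  constructor
  · intro h h'
    exact h (by rw [h'])
  · intro h h'
    apply h
    rw [← MeshFlag.rev_rev (M.glue d), h', MeshFlag.rev_rev]

theorem glued_glue {d : MeshFlag Φ} : M.Glued (M.glue d) ↔ M.Glued d := by
  unfold Glued
  rw [M.glue_glue, ne_comm]

theorem glue_eq_of_not_glued {d : MeshFlag Φ} (h : ¬M.Glued d) : M.glue d = d := not_not.1 h

theorem edge_rev (d : MeshFlag Φ) : M.edge d.rev = M.edge d := by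
  symm
  exact Quot.sound (Or.inl rfl)

theorem edge_glue (d : MeshFlag Φ) : M.edge (M.glue d) = M.edge d := by
  symm
  exact Quot.sound (Or.inr rfl)

theorem vertex_turn (d : MeshFlag Φ) : M.vertex d.turn = M.vertex d := by
  symm
  exact Quot.sound (Or.inl rfl)

theorem vertex_glue (d : MeshFlag Φ) : M.vertex (M.glue d) = M.vertex d := by
  symm
  exact Quot.sound (Or.inr rfl)

/-- An edge is represented by at most four flags. -/
theorem edge_eq_iff {d e : MeshFlag Φ} : M.edge e = M.edge d ↔
    e = d ∨ e = d.rev ∨ e = M.glue d ∨ e = M.glue d.rev := by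
  constructor
  · intro h
    have h' := Quot.eqvGen_exact h
    clear h
    induction h' with
    | rel x y h =>
      rcases h with rfl | rfl
      · right; left; rw [MeshFlag.rev_rev]
      · right; right; left; rw [M.glue_glue]
    | refl x => exact Or.inl rfl
    | symm x y _ ih =>
      rcases ih with rfl | rfl | rfl | rfl
      · exact Or.inl rfl
      · right; left; rw [MeshFlag.rev_rev]
      · right; right; left; rw [M.glue_glue]
      · right; right; right; rw [← M.glue_rev, MeshFlag.rev_rev, M.glue_glue]
    | trans x y z _ _ ih₁ ih₂ =>
      rcases ih₁ with rfl | rfl | rfl | rfl <;> rcases ih₂ with rfl | rfl | rfl | rfl <;>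
        simp [M.glue_rev, MeshFlag.rev_rev, M.glue_glue]
  · rintro (rfl | rfl | rfl | rfl)
    · rfl
    · exact M.edge_rev d
    · exact M.edge_glue d
    · rw [edge_glue, edge_rev]

end QuadMesh

namespace GluingData

variable {Φ : Type*} {M : QuadMesh Φ} (G : GluingData M)

/-- The gluing function `a`, as a pair of polynomials. -/
def polyA (d : MeshFlag Φ) : PolyPair := ofFun (G.a d)

/-- The gluing function `b`, as a pair of polynomials. -/
def polyB (d : MeshFlag Φ) : PolyPair := ofFun (G.b d)

/-- The gluing function `c`, as a pair of polynomials. -/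
def polyC (d : MeshFlag Φ) : PolyPair := ofFun (G.c d)

variable {G} in
theorem poly_spec {d : MeshFlag Φ} (hd : M.Glued d) : ∃ n,
    (G.polyA d ∈ PolyPair.spline 1 n ∧ toFun (G.polyA d) = G.a d) ∧
    (G.polyB d ∈ PolyPair.spline 1 n ∧ toFun (G.polyB d) = G.b d) ∧
    (G.polyC d ∈ PolyPair.spline 1 n ∧ toFun (G.polyC d) = G.c d) := by
  obtain ⟨n, ha, hb, hc⟩ := G.spline d hd
  obtain ⟨A, hA, eA⟩ := exists_of_mem ha
  obtain ⟨B, hB, eB⟩ := exists_of_mem hb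
  obtain ⟨C, hC, eC⟩ := exists_of_mem hc
  refine ⟨n, ?_, ?_, ?_⟩
  · rw [polyA, ← eA, ofFun_toFun]; exact ⟨hA, rfl⟩
  · rw [polyB, ← eB, ofFun_toFun]; exact ⟨hB, rfl⟩
  · rw [polyC, ← eC, ofFun_toFun]; exact ⟨hC, rfl⟩

variable {G} {d : MeshFlag Φ}

theorem toFun_polyA (hd : M.Glued d) : toFun (G.polyA d) = G.a d := (poly_spec hd).choose_spec.1.2

theorem toFun_polyB (hd : M.Glued d) : toFun (G.polyB d) = G.b d := (poly_spec hd).choose_spec.2.1.2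

theorem toFun_polyC (hd : M.Glued d) : toFun (G.polyC d) = G.c d := (poly_spec hd).choose_spec.2.2.2

theorem polyA_glue (hd : M.Glued d) : G.polyA (M.glue d) = -G.polyA d := by
  rw [polyA, polyA, ← map_neg, show G.a (M.glue d) = -G.a d from funext (G.glue_a d hd)]

theorem polyB_glue (hd : M.Glued d) : G.polyB (M.glue d) = G.polyC d := by
  rw [polyB, polyC, show G.b (M.glue d) = G.c d from funext (G.glue_b d hd)]

theorem polyC_glue (hd : M.Glued d) : G.polyC (M.glue d) = G.polyB d := by
  rw [polyB, polyC, show G.c (M.glue d) = G.b d from funext (G.glue_c d hd)]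

theorem polyA_rev (hd : M.Glued d) : G.polyA d.rev = -reflect (G.polyA d) := by
  obtain ⟨n, ⟨hA, eA⟩, -⟩ := poly_spec (G := G) hd
  apply toFun_injective
  funext u
  rw [toFun_polyA (M.glued_rev.2 hd), G.rev_a d hd, map_neg, Pi.neg_apply,
    toFun_reflect_of_mem hA, eA]

theorem polyB_rev (hd : M.Glued d) : G.polyB d.rev = reflect (G.polyB d) := by
  obtain ⟨n, -, ⟨hB, eB⟩, -⟩ := poly_spec (G := G) hd
  apply toFun_injective
  funext u
  rw [toFun_polyB (M.glued_rev.2 hd), G.rev_b d hd, toFun_reflect_of_mem hB, eB]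

theorem polyC_rev (hd : M.Glued d) : G.polyC d.rev = reflect (G.polyC d) := by
  obtain ⟨n, -, -, hC, eC⟩ := poly_spec (G := G) hd
  apply toFun_injective
  funext u
  rw [toFun_polyC (M.glued_rev.2 hd), G.rev_c d hd, toFun_reflect_of_mem hC, eC]

theorem b_ne_zero (hd : M.Glued d) {u : ℝ} (hu : u ∈ Set.Icc (0 : ℝ) 1) : G.b d u ≠ 0 := by
  rw [← G.glue_c d hd]
  exact G.c_ne_zero _ (M.glued_glue.2 hd) u hu

theorem fb_ne_zero (hd : M.Glued d) : G.fb d 0 ≠ 0 :=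
  div_ne_zero (b_ne_zero hd (by simp)) (G.c_ne_zero d hd 0 (by simp))

theorem jet₀_polyC_ne_zero (hd : M.Glued d) : jet₀ false (G.polyC d) ≠ 0 := by
  rw [← toFun_zero_eq, toFun_polyC hd]
  exact G.c_ne_zero d hd 0 (by simp)

theorem fa_zero (hd : M.Glued d) :
    G.fa d 0 = jet₀ false (G.polyA d) / jet₀ false (G.polyC d) := by
  rw [← toFun_zero_eq, ← toFun_zero_eq, toFun_polyA hd, toFun_polyC hd]
  rfl

theorem fb_zero (hd : M.Glued d) :
    G.fb d 0 = jet₀ false (G.polyB d) / jet₀ false (G.polyC d) := by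
  rw [← toFun_zero_eq, ← toFun_zero_eq, toFun_polyB hd, toFun_polyC hd]
  rfl

theorem deriv_div_toFun_zero {P Q : PolyPair} (hQ : jet₀ false Q ≠ 0) :
    _root_.deriv (fun u => toFun P u / toFun Q u) 0 =
      (jet₀ true P * jet₀ false Q - jet₀ false P * jet₀ true Q) / jet₀ false Q ^ 2 := by
  rw [← toFun_zero_eq] at hQ
  have h0 : (0 : ℝ) ≠ 1 / 2 := by norm_num
  have := ((hasDerivAt_toFun P h0).div (hasDerivAt_toFun Q h0) hQ).deriv
  rw [toFun_zero_eq, toFun_zero_eq, toFun_zero_eq, toFun_zero_eq, jet₀_false_deriv,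
    jet₀_false_deriv] at this
  exact this

theorem deriv_fa_zero (hd : M.Glued d) : _root_.deriv (G.fa d) 0 =
    (jet₀ true (G.polyA d) * jet₀ false (G.polyC d)
      - jet₀ false (G.polyA d) * jet₀ true (G.polyC d)) / jet₀ false (G.polyC d) ^ 2 := by
  rw [← deriv_div_toFun_zero (jet₀_polyC_ne_zero hd), toFun_polyA hd, toFun_polyC hd]
  rfl

theorem deriv_fb_zero (hd : M.Glued d) : _root_.deriv (G.fb d) 0 =
    (jet₀ true (G.polyB d) * jet₀ false (G.polyC d)
      - jet₀ false (G.polyB d) * jet₀ true (G.polyC d)) / jet₀ false (G.polyC d) ^ 2 := by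
  rw [← deriv_div_toFun_zero (jet₀_polyC_ne_zero hd), toFun_polyB hd, toFun_polyC hd]
  rfl

variable (G)

/-- The `G¹` conditions across the edge of `d` on the restrictions and normal derivatives along
the sides of the faces, with the denominators cleared. -/
def JetGlued (d : MeshFlag Φ) (D : MeshFlag Φ → Bool → PolyPair) : Prop :=
  M.Glued d → D d false = D (M.glue d) false ∧
    G.polyC d * D d true =
      G.polyB d * D (M.glue d) true + G.polyA d * PolyPair.deriv (D (M.glue d) false)

/-- The restrictions and the normal derivatives of a family of macro-patches along all sides. -/
def jets {r k : ℕ} (f : Φ → macroPatch r k) (d : MeshFlag Φ) (n : Bool) : PolyPair :=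
  MeshFlag.sideJet r k d n (f d.face)

theorem gluedAlong_iff {r k : ℕ} (f : Φ → macroPatch r k) (d : MeshFlag Φ) :
    G.GluedAlong d (fun σ => (f σ : ℝ → ℝ → ℝ)) ↔ G.JetGlued d (jets f) := by
  have e0 : ∀ (d : MeshFlag Φ) x, d.adapted (f d.face) x 0 = toFun (jets f d false) x :=
    fun d x => (congrFun (d.toFun_sideJet false (f d.face)) x).symm
  have e1 : ∀ (d : MeshFlag Φ) x, _root_.deriv (fun y => d.adapted (f d.face) x y) 0 =
      toFun (jets f d true) x := fun d x => (congrFun (d.toFun_sideJet true (f d.face)) x).symm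
  have e2 : ∀ (d : MeshFlag Φ) x, x ≠ 1 / 2 →
      _root_.deriv (fun x => d.adapted (f d.face) x 0) x =
        toFun (PolyPair.deriv (jets f d false)) x := by
    intro d x hx
    simp only [e0]
    exact (hasDerivAt_toFun _ hx).deriv
  refine forall_congr' fun hd => ?_
  have ec : ∀ u ∈ Set.Icc (0 : ℝ) 1, toFun (G.polyC d) u ≠ 0 := fun u hu => by
    rw [toFun_polyC hd]; exact G.c_ne_zero d hd u hu
  have ea : ∀ u, G.fa d u = toFun (G.polyA d) u / toFun (G.polyC d) u := fun u => by
    rw [toFun_polyC hd, toFun_polyA hd]; rfl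
  have eb : ∀ u, G.fb d u = toFun (G.polyB d) u / toFun (G.polyC d) u := fun u => by
    rw [toFun_polyC hd, toFun_polyB hd]; rfl
  constructor
  · intro h
    constructor
    · refine eq_of_eqOn fun u hu hu' => ?_
      rw [← e0, ← e0]
      exact (h u hu).1
    · refine eq_of_eqOn fun u hu hu' => ?_
      have := (h u hu).2 hu'
      rw [e1, e1, e2 _ _ hu', ea, eb] at this
      have hc := ec u hu
      simp only [map_mul, map_add, Pi.mul_apply, Pi.add_apply]
      rw [this]
      field_simp
  · rintro ⟨h0, h1⟩ u hu
    constructor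
    · rw [e0, e0, h0]
    · intro hu'
      rw [e1, e1, e2 _ _ hu', ea, eb]
      have := congrFun (congrArg toFun h1) u
      have hc := ec u hu
      simp only [map_mul, map_add, Pi.mul_apply, Pi.add_apply] at this
      field_simp
      linear_combination this

variable {G}

theorem JetGlued.glue {D : MeshFlag Φ → Bool → PolyPair} (h : G.JetGlued d D) :
    G.JetGlued (M.glue d) D := by
  intro hd
  rw [M.glued_glue] at hd
  obtain ⟨h0, h1⟩ := h hd
  rw [M.glue_glue, polyA_glue hd, polyB_glue hd, polyC_glue hd, h0]
  exact ⟨rfl, by rw [h1]; ring⟩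

theorem JetGlued.rev {D : MeshFlag Φ → Bool → PolyPair} (hD : ∀ d n, D d.rev n = reflect (D d n))
    (h : G.JetGlued d D) : G.JetGlued d.rev D := by
  intro hd
  rw [M.glued_rev] at hd
  obtain ⟨h0, h1⟩ := h hd
  rw [M.glue_rev, polyA_rev hd, polyB_rev hd, polyC_rev hd, hD, hD, hD, hD, h0, deriv_reflect]
  refine ⟨rfl, ?_⟩
  rw [← map_mul, h1, map_add, map_mul, map_mul]
  ring

/-- The `G¹` conditions across an edge can be checked at any of the flags representing it. -/
theorem JetGlued.of_edge_eq {D : MeshFlag Φ → Bool → PolyPair}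
    (hD : ∀ d n, D d.rev n = reflect (D d n)) (h : G.JetGlued d D) {e : MeshFlag Φ}
    (he : M.edge e = M.edge d) : G.JetGlued e D := by
  rcases M.edge_eq_iff.1 he with rfl | rfl | rfl | rfl
  · exact h
  · exact h.rev hD
  · exact h.glue
  · exact (h.rev hD).glue

theorem jets_rev {r k : ℕ} (f : Φ → macroPatch r k) (d : MeshFlag Φ) (n : Bool) :
    jets f d.rev n = reflect (jets f d n) := by
  unfold jets
  rw [MeshFlag.rev_face, MeshFlag.sideJet_rev]

theorem jets_turn {r k : ℕ} (f : Φ → macroPatch r k) (d : MeshFlag Φ) (m n : Bool) :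
    jet₀ m (jets f d.turn n) = jet₀ n (jets f d m) :=
  MeshFlag.jet₀_sideJet_turn d m n (f d.face)

theorem jets_mem {r k : ℕ} (f : Φ → macroPatch r k) (d : MeshFlag Φ) (n : Bool) :
    jets f d n ∈ PolyPair.spline (r + 1) (k + 1) := MeshFlag.sideJet_mem d n _

theorem cornerTaylor_eq {r k : ℕ} (f : Φ → macroPatch r k) (d : MeshFlag Φ) :
    cornerTaylor (fun σ => (f σ : ℝ → ℝ → ℝ)) d = endJet (jets f d) := taylor_adapted d _

theorem vanishesAlong_iff {r k : ℕ} (f : Φ → macroPatch r k) (d : MeshFlag Φ) :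
    VanishesAlong (fun σ => (f σ : ℝ → ℝ → ℝ)) d ↔ jets f d = 0 := by
  have e0 : ∀ x, d.adapted (f d.face) x 0 = toFun (jets f d false) x :=
    fun x => (congrFun (d.toFun_sideJet false (f d.face)) x).symm
  have e1 : ∀ x, _root_.deriv (fun y => d.adapted (f d.face) x y) 0 =
      toFun (jets f d true) x := fun x => (congrFun (d.toFun_sideJet true (f d.face)) x).symm
  unfold VanishesAlong
  simp only [e0, e1]
  constructor
  · intro h
    funext n
    refine eq_of_eqOn fun u hu _ => ?_
    cases n
    · simp [(h u hu).1]
    · simp [(h u hu).2]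
  · intro h u _
    simp [h]

/-! ### The Taylor data at one end of an edge -/

variable (G) in
/-- The pairs of Taylor data, on the faces of `d` and of `glue d`, that occur at the end point of
the edge of `d` at which `d` is based. -/
def endSpace (d : MeshFlag Φ) : Submodule ℝ ((Fin 4 → ℝ) × (Fin 4 → ℝ)) where
  carrier := {p | (¬M.Glued d → p.1 = p.2) ∧ (M.Glued d → p.1 0 = p.2 0 ∧ p.1 1 = p.2 1 ∧
    p.1 2 = G.fb d 0 * p.2 2 + G.fa d 0 * p.2 1 ∧
    (G.fa d 0 = 0 → p.1 3 = _root_.deriv (G.fb d) 0 * p.2 2 + G.fb d 0 * p.2 3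
      + _root_.deriv (G.fa d) 0 * p.2 1))}
  zero_mem' := by simp
  add_mem' := by
    rintro p q ⟨h1, h2⟩ ⟨h1', h2'⟩
    refine ⟨fun h => ?_, fun h => ?_⟩
    · rw [Prod.fst_add, Prod.snd_add, h1 h, h1' h]
    · obtain ⟨a, b, c, e⟩ := h2 h
      obtain ⟨a', b', c', e'⟩ := h2' h
      simp only [Prod.fst_add, Prod.snd_add, Pi.add_apply]
      refine ⟨by rw [a, a'], by rw [b, b'], by rw [c, c']; ring, fun h => ?_⟩
      rw [e h, e' h]
      ring
  smul_mem' := by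
    rintro t p ⟨h1, h2⟩
    refine ⟨fun h => ?_, fun h => ?_⟩
    · rw [Prod.smul_fst, Prod.smul_snd, h1 h]
    · obtain ⟨a, b, c, e⟩ := h2 h
      simp only [Prod.smul_fst, Prod.smul_snd, Pi.smul_apply, smul_eq_mul]
      refine ⟨by rw [a], by rw [b], by rw [c]; ring, fun h => ?_⟩
      rw [e h]
      ring

theorem mem_endSpace_of_not_glued (hd : ¬M.Glued d) {p : (Fin 4 → ℝ) × (Fin 4 → ℝ)} :
    p ∈ G.endSpace d ↔ p.1 = p.2 :=
  ⟨fun h => h.1 hd, fun h => ⟨fun _ => h, fun h' => absurd h' hd⟩⟩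

theorem mem_endSpace_of_glued (hd : M.Glued d) {p : (Fin 4 → ℝ) × (Fin 4 → ℝ)} :
    p ∈ G.endSpace d ↔ p.1 0 = p.2 0 ∧ p.1 1 = p.2 1 ∧
    p.1 2 = G.fb d 0 * p.2 2 + G.fa d 0 * p.2 1 ∧
    (G.fa d 0 = 0 → p.1 3 = _root_.deriv (G.fb d) 0 * p.2 2 + G.fb d 0 * p.2 3
      + _root_.deriv (G.fa d) 0 * p.2 1) :=
  ⟨fun h => h.2 hd, fun h => ⟨fun h' => absurd hd h', fun _ => h⟩⟩

theorem JetGlued.endJet_mem {D : MeshFlag Φ → Bool → PolyPair} (h : G.JetGlued d D) :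
    (endJet (D d), endJet (D (M.glue d))) ∈ G.endSpace d := by
  by_cases hd : M.Glued d
  · obtain ⟨h0, h1⟩ := h hd
    rw [mem_endSpace_of_glued hd]
    have hc := jet₀_polyC_ne_zero (G := G) hd
    have e0 := congrArg (jet₀ false) h1
    have e1 := congrArg (jet₀ true) h1
    simp only [map_add, jet₀_false_mul, jet₀_true_mul, jet₀_false_deriv] at e0 e1
    refine ⟨by simp [endJet, h0], by simp [endJet, h0], ?_, fun ha => ?_⟩
    · simp only [endJet, Matrix.cons_val]
      rw [fa_zero hd, fb_zero hd]
      field_simp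
      linear_combination e0
    · rw [fa_zero hd, div_eq_zero_iff, or_iff_left hc] at ha
      simp only [endJet, Matrix.cons_val]
      rw [deriv_fb_zero hd, fb_zero hd, deriv_fa_zero hd, ha]
      rw [ha] at e0 e1
      field_simp
      linear_combination jet₀ false (G.polyC d) * e1 - jet₀ true (G.polyC d) * e0
  · rw [mem_endSpace_of_not_glued hd, M.glue_eq_of_not_glued hd]

/-- Polynomials vanishing to a given order at `1/2` have arbitrary value and derivative at `0`. -/
theorem exists_dvd_jet (m : ℕ) (x y : ℝ) : ∃ p : ℝ[X], (X - C (1 / 2)) ^ m ∣ p ∧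
    p.eval 0 = x ∧ (derivative p).eval 0 = y := by
  set w : ℝ[X] := (X - C (1 / 2)) ^ m
  have hw : w.eval 0 ≠ 0 := by simp [w]
  refine ⟨w * (C (x / w.eval 0)
    + C ((y - (derivative w).eval 0 * (x / w.eval 0)) / w.eval 0) * X), dvd_mul_right _ _, ?_, ?_⟩
  · simp only [eval_mul, eval_add, eval_C, eval_X]
    field_simp
    ring
  · simp only [derivative_mul, derivative_add, derivative_C, derivative_X, eval_mul, eval_add,
      eval_C, eval_X, eval_one, eval_zero]
    field_simp
    ring

theorem left_mem_spline {m n : ℕ} {p : ℝ[X]} (h : (X - C (1 / 2)) ^ m ∣ p) (hn : p.natDegree < n) :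
    (p, 0) ∈ PolyPair.spline m n := by
  rw [mem_spline]
  refine ⟨degree_le_natDegree.trans_lt (by exact_mod_cast hn), by simp, fun j hj => ?_⟩
  have := pow_sub_dvd_iterate_derivative_of_pow_dvd j h
  have h2 : (X - C (1 / 2 : ℝ)) ∣ derivative^[j] p := (dvd_pow_self _ (by omega)).trans this
  rw [dvd_iff_isRoot] at h2
  rw [h2.eq_zero]
  simp

theorem vec_eq_iff {s : Fin 4 → ℝ} {a b c d : ℝ} :
    ![a, b, c, d] = s ↔ a = s 0 ∧ b = s 1 ∧ c = s 2 ∧ d = s 3 := by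
  constructor
  · rintro rfl
    simp
  · rintro ⟨rfl, rfl, rfl, rfl⟩
    funext i
    fin_cases i <;> rfl

/-- All Taylor data in `endSpace` are attained in some degree. The restriction and the normal
derivatives constructed are multiples of `(X - 1/2) ^ (r + 1)` (up to a constant) before the node
and constant after it, so that smoothness at the node is automatic. -/
theorem exists_glued_triple (hd : M.Glued d) (r : ℕ) {p : (Fin 4 → ℝ) × (Fin 4 → ℝ)}
    (hp : p ∈ G.endSpace d) : ∃ n, 1 ≤ n ∧ ∃ g ∈ PolyPair.spline (r + 1) (n + 1),
      ∃ h ∈ PolyPair.spline (r + 1) (n + 1), ∃ h' ∈ PolyPair.spline (r + 1) (n + 1),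
      G.polyC d * h = G.polyB d * h' + G.polyA d * PolyPair.deriv g ∧
      ![jet₀ false g, jet₀ true g, jet₀ false h, jet₀ true h] = p.1 ∧
      ![jet₀ false g, jet₀ true g, jet₀ false h', jet₀ true h'] = p.2 := by
  obtain ⟨s, t⟩ := p
  rw [mem_endSpace_of_glued hd] at hp
  obtain ⟨h0, h1, h2, h3⟩ := hp
  dsimp only at h0 h1 h2 h3
  rw [deriv_fb_zero hd, fb_zero hd, deriv_fa_zero hd, fa_zero hd] at h3
  rw [fb_zero hd, fa_zero hd] at h2
  have hc := jet₀_polyC_ne_zero (G := G) hd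
  set a₀ := jet₀ false (G.polyA d) with ha₀
  set b₀ := jet₀ false (G.polyB d) with hb₀
  set c₀ := jet₀ false (G.polyC d) with hc₀
  set a₁ := jet₀ true (G.polyA d) with ha₁
  set b₁ := jet₀ true (G.polyB d) with hb₁
  set c₁ := jet₀ true (G.polyC d) with hc₁
  rw [jet₀_false] at ha₀ hb₀ hc₀
  rw [jet₀_true] at ha₁ hb₁ hc₁
  obtain ⟨β, hβ, hβ0, hβ1⟩ := exists_dvd_jet (r + 1) (t 2 / c₀) ((t 3 - c₁ * (t 2 / c₀)) / c₀)
  obtain ⟨α, hα, hα0, hα1⟩ := exists_dvd_jet (r + 1) (s 1 / c₀)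
    ((s 3 - b₁ * (t 2 / c₀) - b₀ * ((t 3 - c₁ * (t 2 / c₀)) / c₀) - a₁ * (s 1 / c₀)) / a₀)
  set a := (G.polyA d).1
  set b := (G.polyB d).1
  set c := (G.polyC d).1
  set n := (c * α).natDegree + (c * β).natDegree + (b * β + a * α).natDegree + 1 with hn
  have hA : (c * α, 0) ∈ PolyPair.spline r n :=
    spline_anti (Nat.le_succ r) (left_mem_spline (hα.mul_left _) (by omega))
  obtain ⟨g, hg, hg1, hg0⟩ := exists_deriv_eq hA (s 0)
  refine ⟨n, by omega, g, hg, (b * β + a * α, 0),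
    left_mem_spline (dvd_add (hβ.mul_left _) (hα.mul_left _)) (by omega), (c * β, 0),
    left_mem_spline (hβ.mul_left _) (by omega), ?_, ?_, ?_⟩
  · rw [hg1]
    ext1
    · simp only [Prod.fst_mul, Prod.fst_add]
      ring
    · simp
  · have e1 : jet₀ true g = s 1 := by
      rw [← jet₀_false_deriv, hg1, jet₀_false]
      simp only [eval_mul, ← hc₀, hα0]
      field_simp
    rw [vec_eq_iff]
    refine ⟨hg0, e1, ?_, ?_⟩
    · rw [jet₀_false]
      simp only [eval_mul, eval_add, ← hb₀, ← ha₀, hα0, hβ0]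
      rw [h2, h1]
      ring
    · rw [jet₀_true]
      simp only [derivative_add, derivative_mul, eval_mul, eval_add, ← hb₀, ← ha₀, ← hb₁, ← ha₁,
        hα0, hβ0, hα1, hβ1]
      by_cases h : a₀ = 0
      · rw [h3 (by rw [h, zero_div]), h, h1]
        field_simp
        ring
      · field_simp
        ring
  · rw [vec_eq_iff]
    refine ⟨hg0.trans h0, ?_, ?_, ?_⟩
    · rw [← jet₀_false_deriv, hg1, jet₀_false]
      refine Eq.trans ?_ h1
      simp only [eval_mul, ← hc₀, hα0]
      field_simp
    · rw [jet₀_false]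
      simp only [eval_mul, ← hc₀, hβ0]
      field_simp
    · rw [jet₀_true]
      simp only [derivative_mul, eval_mul, eval_add, ← hc₀, ← hc₁, hβ0, hβ1]
      field_simp
      ring

/-- The patch which is the product of a function along the side of `d` with a function of the
transversal coordinate. -/
def sidePatch {r k : ℕ} (d : MeshFlag Φ) (P Q : PolyPair.spline (r + 1) (k + 1)) :
    macroPatch r k :=
  if d.axis then prodPatch r k ⟨PolyPair.flip d.cu Q, flip_mem_spline _ Q.2⟩
      ⟨PolyPair.flip d.cv P, flip_mem_spline _ P.2⟩
    else prodPatch r k ⟨PolyPair.flip d.cu P, flip_mem_spline _ P.2⟩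
      ⟨PolyPair.flip d.cv Q, flip_mem_spline _ Q.2⟩

theorem sideJet_sidePatch {r k : ℕ} (d : MeshFlag Φ) (P Q : PolyPair.spline (r + 1) (k + 1))
    (n : Bool) : MeshFlag.sideJet r k d n (sidePatch d P Q) = jet₀ n Q.1 • P.1 := by
  unfold sidePatch
  split_ifs with h <;> simp [MeshFlag.across, MeshFlag.along, h]

/-- Patches with arbitrary jets along a given side. -/
theorem exists_patch_sideJet {r k : ℕ} (hk : 1 ≤ k) (d : MeshFlag Φ)
    (D : Bool → PolyPair) (hD : ∀ n, D n ∈ PolyPair.spline (r + 1) (k + 1)) :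
    ∃ F : macroPatch r k, ∀ n, MeshFlag.sideJet r k d n F = D n := by
  have hone : ((1 : ℝ[X]), (1 : ℝ[X])) ∈ PolyPair.spline (r + 1) (k + 1) :=
    diag_mem_spline (degree_one_le.trans_lt (by exact_mod_cast Nat.succ_pos k))
  have hX : ((X : ℝ[X]), (X : ℝ[X])) ∈ PolyPair.spline (r + 1) (k + 1) :=
    diag_mem_spline (degree_X_le.trans_lt (by exact_mod_cast Nat.lt_succ_of_le hk))
  refine ⟨sidePatch d ⟨_, hD false⟩ ⟨_, hone⟩ + sidePatch d ⟨_, hD true⟩ ⟨_, hX⟩, fun n => ?_⟩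
  rw [map_add, sideJet_sidePatch, sideJet_sidePatch]
  cases n
  · simp [jet₀_false]
  · simp [jet₀_true]

theorem exists_eq_of_mem_edgeSplines {r k : ℕ} {f : Φ → ℝ → ℝ → ℝ} (hf : f ∈ G.edgeSplines r k d) :
    ∃ f' : Φ → macroPatch r k, f = (fun σ => (f' σ : ℝ → ℝ → ℝ)) ∧ G.JetGlued d (jets f') := by
  refine ⟨fun σ => ⟨f σ, hf.1 σ⟩, rfl, ?_⟩
  rw [← gluedAlong_iff]
  exact hf.2.2

theorem endTaylor_eq {r k : ℕ} (f : Φ → macroPatch r k) (d : MeshFlag Φ) :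
    M.endTaylor d (fun σ => (f σ : ℝ → ℝ → ℝ)) = (endJet (jets f d), endJet (jets f (M.glue d))) :=
  Prod.ext (cornerTaylor_eq f d) (cornerTaylor_eq f _)

/-- `endSpace` is the set of Taylor data of splines of arbitrary degree. -/
theorem iUnion_endTaylor (r : ℕ) (d : MeshFlag Φ) :
    ⋃ j, M.endTaylor d '' G.edgeSplines r j d = (G.endSpace d : Set _) := by
  classical
  apply Set.Subset.antisymm
  · intro p hp
    obtain ⟨j, f, hf, rfl⟩ := Set.mem_iUnion.1 hp
    obtain ⟨f, rfl, hf'⟩ := exists_eq_of_mem_edgeSplines hf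
    rw [endTaylor_eq]
    exact hf'.endJet_mem
  · intro p hp
    rw [SetLike.mem_coe] at hp
    rw [Set.mem_iUnion]
    by_cases hd : M.Glued d
    · obtain ⟨n, hn, g, hg, h, hh, h', hh', hrel, e1, e2⟩ := exists_glued_triple hd r hp
      obtain ⟨F, hF⟩ := exists_patch_sideJet hn d (fun b => if b then h else g)
        (by rintro (_ | _) <;> simpa)
      obtain ⟨F', hF'⟩ := exists_patch_sideJet hn (M.glue d) (fun b => if b then h' else g)
        (by rintro (_ | _) <;> simpa)
      let f : Φ → macroPatch r n := fun σ =>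
        if σ = d.face then F else if σ = (M.glue d).face then F' else 0
      have hf1 : jets f d = fun b => if b then h else g := by
        funext b; simp only [jets, f, if_true]; exact hF b
      have hf2 : jets f (M.glue d) = fun b => if b then h' else g := by
        funext b; simp only [jets, f, if_neg (M.face_ne d hd), if_true]; exact hF' b
      refine ⟨n, fun σ => f σ, ⟨fun σ => (f σ).2, fun σ h1 h2 => ?_, ?_⟩, ?_⟩
      · simp only [f, if_neg h1, if_neg h2]; rfl
      · rw [gluedAlong_iff]
        intro _
        rw [hf1, hf2]
        exact ⟨rfl, hrel⟩
      · rw [endTaylor_eq, hf1, hf2]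
        exact Prod.ext e1 e2
    · rw [mem_endSpace_of_not_glued hd] at hp
      have hlin : ∀ x y : ℝ, (C x + C y * X, C x + C y * X) ∈ PolyPair.spline (r + 1) (1 + 1) :=
        fun x y => diag_mem_spline (by
          rw [add_comm]; exact degree_linear_le.trans_lt (by norm_num))
      obtain ⟨F, hF⟩ := exists_patch_sideJet le_rfl d
        (fun b => if b then (C (p.1 2) + C (p.1 3) * X, C (p.1 2) + C (p.1 3) * X) else
          (C (p.1 0) + C (p.1 1) * X, C (p.1 0) + C (p.1 1) * X))
        (by rintro (_ | _) <;> simpa using hlin _ _)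
      let f : Φ → macroPatch r 1 := fun σ => if σ = d.face then F else 0
      refine ⟨1, fun σ => f σ, ⟨fun σ => (f σ).2, fun σ h1 h2 => ?_, fun h => absurd h hd⟩, ?_⟩
      · simp only [f, if_neg h1]; rfl
      · rw [endTaylor_eq, M.glue_eq_of_not_glued hd]
        have : endJet (jets f d) = p.1 := by
          have : jets f d = _ := funext fun b => by
            simp only [jets, f, if_true]; exact hF b
          rw [this, endJet, vec_eq_iff]
          simp [jet₀_false, jet₀_true]
        exact Prod.ext this (this.trans hp)

theorem edgeSplines_rev (r k : ℕ) (d : MeshFlag Φ) :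
    G.edgeSplines r k d.rev = G.edgeSplines r k d := by
  have key : ∀ d : MeshFlag Φ, G.edgeSplines r k d ⊆ G.edgeSplines r k d.rev := by
    rintro d f ⟨h1, h2, h3⟩
    refine ⟨h1, ?_, ?_⟩
    · rw [M.glue_rev, MeshFlag.rev_face, MeshFlag.rev_face]
      exact h2
    · have := (G.gluedAlong_iff (fun σ => ⟨f σ, h1 σ⟩) d).1 h3
      exact (G.gluedAlong_iff (fun σ => ⟨f σ, h1 σ⟩) d.rev).2 (this.rev (jets_rev _))
  refine Set.Subset.antisymm ?_ (key d)
  have := key d.rev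
  rwa [MeshFlag.rev_rev] at this

theorem macroPatch_mono {r k l : ℕ} (h : k ≤ l) : macroPatch r k ≤ macroPatch r l := by
  refine Submodule.span_mono ?_
  rintro F ⟨g, hg, h', hh, rfl⟩
  have key : ∀ g ∈ splineSpace (r + 1) (k + 1), g ∈ splineSpace (r + 1) (l + 1) := by
    intro g hg
    obtain ⟨P, hP, rfl⟩ := exists_of_mem hg
    exact spline_mono (by omega) hP
  exact ⟨g, key g hg, h', key h' hh, rfl⟩

/-- Separation of the end points of an edge passes to higher degree. -/
theorem exists_jets_of_maxSeparability_le {r k : ℕ} (hk : G.maxSeparability r ≤ (k : ℕ∞))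
    (d : MeshFlag Φ) {p q : (Fin 4 → ℝ) × (Fin 4 → ℝ)} (hp : p ∈ G.endSpace d)
    (hq : q ∈ G.endSpace d.rev) : ∃ f : Φ → macroPatch r k, G.JetGlued d (jets f) ∧
      endJet (jets f d) = p.1 ∧ endJet (jets f (M.glue d)) = p.2 ∧
      endJet (jets f d.rev) = q.1 ∧ endJet (jets f (M.glue d.rev)) = q.2 := by
  have hsep : G.separability r d ≤ k :=
    (le_iSup (fun d => G.separability r d) d).trans hk
  obtain ⟨j, hj, hjk⟩ : ∃ j, G.Separates r j d ∧ j ≤ k := by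
    by_contra! h
    have : ((k + 1 : ℕ) : ℕ∞) ≤ G.separability r d :=
      le_iInf₂ fun j hj => by exact_mod_cast h j hj
    have := this.trans hsep
    have : k + 1 ≤ k := by exact_mod_cast this
    omega
  have hmem : (p, q) ∈ (⋃ j, M.endTaylor d '' G.edgeSplines r j d) ×ˢ
      (⋃ j, M.endTaylor d.rev '' G.edgeSplines r j d) := by
    refine ⟨?_, ?_⟩
    · rw [iUnion_endTaylor]; exact hp
    · simp only [← edgeSplines_rev r _ d]
      rw [iUnion_endTaylor]; exact hq
  rw [← hj] at hmem
  obtain ⟨f, ⟨hf1, -, hf3⟩, he⟩ := hmem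
  let f' : Φ → macroPatch r k := fun σ => ⟨f σ, macroPatch_mono hjk (hf1 σ)⟩
  have e1 : M.endTaylor d (fun σ => (f' σ : ℝ → ℝ → ℝ)) = p := congrArg Prod.fst he
  have e2 : M.endTaylor d.rev (fun σ => (f' σ : ℝ → ℝ → ℝ)) = q := congrArg Prod.snd he
  rw [endTaylor_eq] at e1 e2
  exact ⟨f', (G.gluedAlong_iff f' d).1 hf3, congrArg Prod.fst e1, congrArg Prod.snd e1,
    congrArg Prod.fst e2, congrArg Prod.snd e2⟩

theorem swap_mem_endSpace {p : (Fin 4 → ℝ) × (Fin 4 → ℝ)} (hp : p ∈ G.endSpace d) :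
    p.swap ∈ G.endSpace (M.glue d) := by
  rw [← SetLike.mem_coe, ← iUnion_endTaylor 0] at hp
  obtain ⟨j, f, hf, rfl⟩ := Set.mem_iUnion.1 hp
  obtain ⟨f, rfl, hf'⟩ := exists_eq_of_mem_edgeSplines hf
  have := hf'.glue.endJet_mem
  rw [M.glue_glue] at this
  rw [endTaylor_eq]
  exact this

/-- Separability of a single edge implies that Hermite interpolation is possible. -/
theorem exists_isHermiteBasis [Nonempty Φ] {r k : ℕ} (hk : G.maxSeparability r ≤ (k : ℕ∞)) :
    ∃ e : Bool × Bool → PolyPair.spline (r + 1) (k + 1), IsHermiteBasis e := by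
  obtain ⟨σ⟩ := ‹Nonempty Φ›
  have hex : ∀ (d : MeshFlag Φ) (x y : ℝ), ∃ p ∈ G.endSpace d, p.1 0 = x ∧ p.1 1 = y := by
    intro d x y
    by_cases hd : M.Glued d
    · refine ⟨(![x, y, G.fa d 0 * y, _root_.deriv (G.fa d) 0 * y], ![x, y, 0, 0]), ?_, rfl, rfl⟩
      rw [mem_endSpace_of_glued hd]
      simp
    · exact ⟨(![x, y, 0, 0], ![x, y, 0, 0]), (mem_endSpace_of_not_glued hd).2 rfl, rfl, rfl⟩
  let d : MeshFlag Φ := ⟨σ, false, false, false⟩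
  have key : ∀ v : Bool × Bool → ℝ, ∃ P : PolyPair.spline (r + 1) (k + 1),
      ∀ i : Bool × Bool, jetEnd i.1 i.2 P.1 = v i := by
    intro v
    obtain ⟨p, hp, p0, p1⟩ := hex d (v (false, false)) (v (false, true))
    obtain ⟨q, hq, q0, q1⟩ := hex d.rev (v (true, false)) (v (true, true))
    obtain ⟨f, -, h1, -, h2, -⟩ := exists_jets_of_maxSeparability_le hk d hp hq
    refine ⟨⟨jets f d false, jets_mem f d false⟩, ?_⟩
    have e0 := congrFun h1 0
    have e1 := congrFun h1 1
    have e2 := congrFun h2 0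
    have e3 := congrFun h2 1
    simp only [endJet, Matrix.cons_val, jets_rev] at e0 e1 e2 e3
    rintro ⟨_ | _, _ | _⟩
    · exact e0.trans p0
    · exact e1.trans p1
    · exact e2.trans q0
    · exact e3.trans q1
  choose e he using fun j : Bool × Bool => key fun i => if i = j then 1 else 0
  exact ⟨e, fun i j => he j i⟩

end GluingData

end

noncomputable section

open Polynomial PolyPair

namespace GluingData

variable {Φ : Type*} {M : QuadMesh Φ} {G : GluingData M} {r k : ℕ}

/-! ### Splines with prescribed jets -/

variable (G) in
/-- The family of macro-patches underlying a spline. -/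
def patches (r k : ℕ) : G.splines r k →ₗ[ℝ] (Φ → macroPatch r k) where
  toFun f σ := ⟨f.1 σ, f.2.1 σ⟩
  map_add' _ _ := rfl
  map_smul' _ _ := rfl

theorem patches_apply (f : G.splines r k) (σ : Φ) :
    (G.patches r k f σ : ℝ → ℝ → ℝ) = f.1 σ := rfl

theorem jetGlued_patches (f : G.splines r k) (d : MeshFlag Φ) :
    G.JetGlued d (jets (G.patches r k f)) :=
  (G.gluedAlong_iff (G.patches r k f) d).1 (f.2.2 d)

theorem exists_patches_eq {f : Φ → macroPatch r k} (hf : ∀ d, G.JetGlued d (jets f)) :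
    ∃ f' : G.splines r k, G.patches r k f' = f :=
  ⟨⟨fun σ => f σ, fun σ => (f σ).2, fun d => (G.gluedAlong_iff f d).2 (hf d)⟩, rfl⟩

/-- Exchange of the two coordinates in the Taylor data. -/
def swapJet : (Fin 4 → ℝ) →ₗ[ℝ] (Fin 4 → ℝ) where
  toFun s := ![s 0, s 2, s 1, s 3]
  map_add' s t := by
    funext i; fin_cases i <;> rfl
  map_smul' c s := by
    funext i; fin_cases i <;> rfl

@[simp] theorem swapJet_apply (s : Fin 4 → ℝ) : swapJet s = ![s 0, s 2, s 1, s 3] := rfl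

theorem swapJet_swapJet (s : Fin 4 → ℝ) : swapJet (swapJet s) = s := by
  funext i; fin_cases i <;> rfl

theorem endJet_jets_turn (f : Φ → macroPatch r k) (d : MeshFlag Φ) :
    endJet (jets f d.turn) = swapJet (endJet (jets f d)) := by
  simp [endJet, jets_turn]

/-- A family of jets along the sides of the faces comes from a spline if it satisfies the gluing
conditions and if its Taylor data agree at the corners of the faces. -/
theorem exists_spline_jets_eq {e : Bool × Bool → PolyPair.spline (r + 1) (k + 1)}
    (he : IsHermiteBasis e) {D : MeshFlag Φ → Bool → PolyPair}
    (hmem : ∀ d n, D d n ∈ PolyPair.spline (r + 1) (k + 1))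
    (hrev : ∀ d n, D d.rev n = reflect (D d n)) (hglue : ∀ d, G.JetGlued d D)
    (hturn : ∀ d, endJet (D d.turn) = swapJet (endJet (D d))) :
    ∃ f : G.splines r k, jets (G.patches r k f) = D ∧
      ∀ σ, (∀ d, d.face = σ → D d = 0) → f.1 σ = 0 := by
  have hturn' : ∀ d m n, jet₀ m (D d.turn n) = jet₀ n (D d m) := by
    intro d m n
    have h := hturn d
    simp only [endJet, swapJet_apply, vec_eq_iff, Matrix.cons_val] at h
    obtain ⟨h0, h1, h2, h3⟩ := h
    cases m <;> cases n <;> assumption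
  choose F hF hF0 using fun σ => exists_sideJet_eq he σ D hmem hrev hturn'
  have hj : jets F = D := by
    funext d n
    exact hF d.face d n rfl
  obtain ⟨f, hf⟩ := exists_patches_eq (G := G) (f := F) (by rw [hj]; exact hglue)
  refine ⟨f, by rw [hf, hj], fun σ hσ => ?_⟩
  rw [← patches_apply, hf, hF0 σ hσ]
  rfl

variable (G) in
/-- The systems of Taylor data at the corners at the vertex `γ` that are compatible across all the
edges at `γ`; data at the other vertices are zero. -/
def vertexSpace (γ : M.Vertex) : Submodule ℝ (MeshFlag Φ → Fin 4 → ℝ) where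
  carrier := {t | (∀ d, M.vertex d ≠ γ → t d = 0) ∧ (∀ d, (t d, t (M.glue d)) ∈ G.endSpace d) ∧
    ∀ d, t d.turn = swapJet (t d)}
  zero_mem' := ⟨fun _ _ => rfl, fun d => zero_mem (G.endSpace d), fun d => (map_zero swapJet).symm⟩
  add_mem' := by
    rintro s t ⟨h1, h2, h3⟩ ⟨h1', h2', h3'⟩
    refine ⟨fun d hd => ?_, fun d => add_mem (h2 d) (h2' d), fun d => ?_⟩
    · rw [Pi.add_apply, h1 d hd, h1' d hd, add_zero]
    · rw [Pi.add_apply, Pi.add_apply, h3, h3', map_add]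
  smul_mem' := by
    rintro c t ⟨h1, h2, h3⟩
    refine ⟨fun d hd => ?_, fun d => Submodule.smul_mem _ c (h2 d), fun d => ?_⟩
    · rw [Pi.smul_apply, h1 d hd, smul_zero]
    · rw [Pi.smul_apply, Pi.smul_apply, h3, map_smul]

open Classical in
/-- The Taylor data at `γ` of a spline. -/
theorem taylor_mem_vertexSpace (f : G.splines r k) (γ : M.Vertex) :
    (fun d => if M.vertex d = γ then cornerTaylor f.1 d else 0) ∈ G.vertexSpace γ := by
  have e : ∀ d, cornerTaylor f.1 d = endJet (jets (G.patches r k f) d) := fun d =>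
    cornerTaylor_eq (G.patches r k f) d
  refine ⟨fun d hd => if_neg hd, fun d => ?_, fun d => ?_⟩
  · beta_reduce
    rw [M.vertex_glue]
    split_ifs
    · rw [e, e]
      exact (jetGlued_patches f d).endJet_mem
    · exact zero_mem _
  · beta_reduce
    rw [M.vertex_turn]
    split_ifs
    · rw [e, e, endJet_jets_turn]
    · rw [map_zero]

/-- Compatible Taylor data at a vertex are those of a spline attached to the vertex. The jets along
the edges are provided by separability, the data at the far ends being zero. -/
theorem exists_attachedToVertex {e : Bool × Bool → PolyPair.spline (r + 1) (k + 1)}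
    (he : IsHermiteBasis e) (hk : G.maxSeparability r ≤ (k : ℕ∞)) {γ : M.Vertex}
    {t : MeshFlag Φ → Fin 4 → ℝ} (ht : t ∈ G.vertexSpace γ) :
    ∃ f : G.splines r k, M.AttachedToVertex γ f.1 ∧ ∀ d, cornerTaylor f.1 d = t d := by
  obtain ⟨h1, h2, h3⟩ := ht
  have hedge : ∀ τ : M.Edge, ∃ f : Φ → macroPatch r k,
      (∀ d, M.edge d = τ → G.JetGlued d (jets f) ∧ endJet (jets f d) = t d) ∧
      ((∀ d, M.edge d = τ → t d = 0) → f = 0) := by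
    intro τ
    by_cases h0 : ∀ d, M.edge d = τ → t d = 0
    · have hz : ∀ d, jets (0 : Φ → macroPatch r k) d = 0 := fun d => by
        funext n; exact map_zero _
      refine ⟨0, fun d hd => ⟨fun _ => ?_, ?_⟩, fun _ => rfl⟩
      · simp [hz]
      · rw [h0 d hd, hz]
        funext i
        fin_cases i <;> simp [endJet]
    · obtain ⟨d, rfl⟩ : ∃ d, M.edge d = τ := Quot.exists_rep τ
      obtain ⟨f, hf, e1, e2, e3, e4⟩ := exists_jets_of_maxSeparability_le hk d (h2 d) (h2 d.rev)
      refine ⟨f, fun e he => ⟨hf.of_edge_eq (jets_rev f) he, ?_⟩, fun h => absurd h h0⟩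
      rcases M.edge_eq_iff.1 he with rfl | rfl | rfl | rfl
      · exact e1
      · exact e3
      · exact e2
      · exact e4
  choose F hF hF0 using hedge
  obtain ⟨f, hf, hf0⟩ := exists_spline_jets_eq (G := G) he (D := fun d => jets (F (M.edge d)) d)
    (fun d n => jets_mem _ _ _) (fun d n => by rw [M.edge_rev, jets_rev])
    (fun d hd => by beta_reduce; rw [M.edge_glue]; exact (hF _ d rfl).1 hd)
    (fun d => by rw [(hF _ d rfl).2, (hF _ d.turn rfl).2, h3])
  have hzero : ∀ d, M.vertex d ≠ γ → M.vertex d.rev ≠ γ → jets (F (M.edge d)) d = 0 := by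
    intro d hd hd'
    rw [hF0 (M.edge d)]
    · funext n
      exact map_zero _
    · intro e he
      apply h1
      rcases M.edge_eq_iff.1 he with rfl | rfl | rfl | rfl
      · exact hd
      · exact hd'
      · rwa [M.vertex_glue]
      · rwa [M.vertex_glue]
  have htay : ∀ d, cornerTaylor f.1 d = t d := fun d => by
    have := cornerTaylor_eq (G.patches r k f) d
    rw [hf] at this
    exact this.trans (hF _ d rfl).2
  refine ⟨f, ⟨fun σ hσ => hf0 σ fun d hd => ?_, fun d hd hd' => ?_, fun d hd => ?_⟩, htay⟩
  · exact hzero d (hσ d hd) (hσ d.rev (by rw [MeshFlag.rev_face, hd]))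
  · refine (vanishesAlong_iff (G.patches r k f) d).2 ?_
    rw [hf]
    exact hzero d hd hd'
  · rw [htay, h1 d hd]

/-! ### Jets along an edge -/

/-- `endJet` as a linear map. -/
def endJetₗ : PolyPair × PolyPair →ₗ[ℝ] (Fin 4 → ℝ) where
  toFun x := endJet fun n => if n then x.2 else x.1
  map_add' x y := by
    funext i; fin_cases i <;> simp [endJet]
  map_smul' c x := by
    funext i; fin_cases i <;> simp [endJet]

theorem endJetₗ_apply (D : Bool → PolyPair) : endJetₗ (D false, D true) = endJet D := rfl

variable (G) in
/-- The space of triples `(g, h, h')`, where `g` is the restriction of a spline to the edge of `d`,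
and `h`, `h'` are its normal derivatives on the faces of `d` and of `glue d`. These faces coincide
if the edge is a boundary edge; then `h = h'` is required. -/
def edgeSpace (r k : ℕ) (d : MeshFlag Φ) : Submodule ℝ (PolyPair × PolyPair × PolyPair) where
  carrier := {q | q.1 ∈ PolyPair.spline (r + 1) (k + 1) ∧ q.2.1 ∈ PolyPair.spline (r + 1) (k + 1) ∧
    q.2.2 ∈ PolyPair.spline (r + 1) (k + 1) ∧ (¬M.Glued d → q.2.1 = q.2.2) ∧
    (M.Glued d → G.polyC d * q.2.1 = G.polyB d * q.2.2 + G.polyA d * PolyPair.deriv q.1)}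
  zero_mem' := ⟨zero_mem _, zero_mem _, zero_mem _, fun _ => rfl, fun _ => by simp⟩
  add_mem' := by
    rintro p q ⟨h1, h2, h3, h4, h5⟩ ⟨h1', h2', h3', h4', h5'⟩
    refine ⟨add_mem h1 h1', add_mem h2 h2', add_mem h3 h3', fun h => ?_, fun h => ?_⟩
    · simp only [Prod.fst_add, Prod.snd_add, h4 h, h4' h]
    · simp only [Prod.fst_add, Prod.snd_add, map_add, mul_add, h5 h, h5' h]
      ring
  smul_mem' := by
    rintro c q ⟨h1, h2, h3, h4, h5⟩
    refine ⟨Submodule.smul_mem _ c h1, Submodule.smul_mem _ c h2, Submodule.smul_mem _ c h3,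
      fun h => ?_, fun h => ?_⟩
    · simp only [Prod.smul_fst, Prod.smul_snd, h4 h]
    · simp only [Prod.smul_fst, Prod.smul_snd, map_smul, mul_smul_comm, h5 h, smul_add]

instance edgeSpace_finite (d : MeshFlag Φ) : Module.Finite ℝ (G.edgeSpace r k d) := by
  have hle : G.edgeSpace r k d ≤ (PolyPair.spline (r + 1) (k + 1)).prod
      ((PolyPair.spline (r + 1) (k + 1)).prod (PolyPair.spline (r + 1) (k + 1))) :=
    fun q hq => ⟨hq.1, hq.2.1, hq.2.2.1⟩
  have hfg : ((PolyPair.spline (r + 1) (k + 1)).prod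
      ((PolyPair.spline (r + 1) (k + 1)).prod (PolyPair.spline (r + 1) (k + 1)))).FG := by
    have : (PolyPair.spline (r + 1) (k + 1)).FG := Module.Finite.iff_fg.1 inferInstance
    exact this.prod (this.prod this)
  have : Module.Finite ℝ ((PolyPair.spline (r + 1) (k + 1)).prod
      ((PolyPair.spline (r + 1) (k + 1)).prod (PolyPair.spline (r + 1) (k + 1)))) :=
    Module.Finite.iff_fg.2 hfg
  exact Submodule.finiteDimensional_of_le hle

/-- The Taylor data of `(g, h, h')` at the two ends of the edge, on both faces. -/
def endsMap : PolyPair × PolyPair × PolyPair →ₗ[ℝ]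
    ((Fin 4 → ℝ) × (Fin 4 → ℝ)) × ((Fin 4 → ℝ) × (Fin 4 → ℝ)) where
  toFun q := ((endJetₗ (q.1, q.2.1), endJetₗ (q.1, q.2.2)),
    (endJetₗ (reflect q.1, reflect q.2.1), endJetₗ (reflect q.1, reflect q.2.2)))
  map_add' p q := by
    simp only [Prod.fst_add, Prod.snd_add, map_add, ← Prod.mk_add_mk]
  map_smul' c q := by
    simp only [Prod.smul_fst, Prod.smul_snd, map_smul, ← Prod.smul_mk, RingHom.id_apply]

/-- The triple of jets of a family of functions along the edge of `d`. -/
def edgeTriple (M : QuadMesh Φ) (d : MeshFlag Φ) (D : MeshFlag Φ → Bool → PolyPair) :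
    PolyPair × PolyPair × PolyPair := (D d false, D d true, D (M.glue d) true)

theorem JetGlued.edgeTriple_mem {D : MeshFlag Φ → Bool → PolyPair} {d : MeshFlag Φ}
    (hmem : ∀ d n, D d n ∈ PolyPair.spline (r + 1) (k + 1)) (h : G.JetGlued d D) :
    edgeTriple M d D ∈ G.edgeSpace r k d := by
  refine ⟨hmem _ _, hmem _ _, hmem _ _, fun hd => ?_, fun hd => ?_⟩
  · simp only [edgeTriple, M.glue_eq_of_not_glued hd]
  · simp only [edgeTriple, (h hd).2, (h hd).1]

theorem endsMap_edgeTriple {D : MeshFlag Φ → Bool → PolyPair} {d : MeshFlag Φ}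
    (hrev : ∀ d n, D d.rev n = reflect (D d n)) (h : G.JetGlued d D) :
    endsMap (edgeTriple M d D) = ((endJet (D d), endJet (D (M.glue d))),
      (endJet (D d.rev), endJet (D (M.glue d.rev)))) := by
  have h0 : D d false = D (M.glue d) false := by
    by_cases hd : M.Glued d
    · exact (h hd).1
    · rw [M.glue_eq_of_not_glued hd]
  rw [M.glue_rev]
  simp only [← endJetₗ_apply, hrev, ← h0]
  rfl

/-- Every triple in `edgeSpace` extends to jets along the sides of all faces which satisfy the
gluing conditions and vanish off the edge. -/
theorem exists_edgeTriple_eq {d : MeshFlag Φ} {q : PolyPair × PolyPair × PolyPair}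
    (hq : q ∈ G.edgeSpace r k d) : ∃ D : MeshFlag Φ → Bool → PolyPair,
      (∀ d n, D d n ∈ PolyPair.spline (r + 1) (k + 1)) ∧ (∀ d n, D d.rev n = reflect (D d n)) ∧
      (∀ d, G.JetGlued d D) ∧ edgeTriple M d D = q ∧ ∀ e, M.edge e ≠ M.edge d → D e = 0 := by
  classical
  obtain ⟨h1, h2, h3, h4, h5⟩ := hq
  let p : Bool → PolyPair := fun n => if n then q.2.1 else q.1
  let p' : Bool → PolyPair := fun n => if n then q.2.2 else q.1
  have hp : ∀ n, p n ∈ PolyPair.spline (r + 1) (k + 1) := by rintro (_ | _) <;> assumption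
  have hp' : ∀ n, p' n ∈ PolyPair.spline (r + 1) (k + 1) := by rintro (_ | _) <;> assumption
  let D : MeshFlag Φ → Bool → PolyPair := fun e n =>
    if e = d then p n else if e = d.rev then reflect (p n) else
    if e = M.glue d then p' n else if e = M.glue d.rev then reflect (p' n) else 0
  have hpp : ¬M.Glued d → p' = p := fun hd => by simp only [p, p', h4 hd]
  have hrd := d.rev_ne
  have v1 : ∀ n, D d n = p n := fun n => if_pos rfl
  have v2 : ∀ n, D d.rev n = reflect (p n) := fun n => by simp only [D, if_neg hrd, if_true]
  have v3 : ∀ n, D (M.glue d) n = p' n := fun n => by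
    by_cases hd : M.Glued d
    · have n1 : M.glue d ≠ d := hd
      have n2 : M.glue d ≠ d.rev := fun h => M.face_ne d hd (by rw [h, MeshFlag.rev_face])
      simp only [D, if_neg n1, if_neg n2, if_true]
    · rw [M.glue_eq_of_not_glued hd, hpp hd, v1]
  have v4 : ∀ n, D (M.glue d.rev) n = reflect (p' n) := fun n => by
    by_cases hd : M.Glued d
    · have n0 : (M.glue d.rev).face ≠ d.face := by
        have := M.face_ne d.rev (M.glued_rev.2 hd)
        rwa [MeshFlag.rev_face] at this
      have n1 : M.glue d.rev ≠ d := fun h => n0 (by rw [h])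
      have n2 : M.glue d.rev ≠ d.rev := M.glued_rev.2 hd
      have n3 : M.glue d.rev ≠ M.glue d := by rw [M.glue_rev]; exact MeshFlag.rev_ne _
      simp only [D, if_neg n1, if_neg n2, if_neg n3, if_true]
    · rw [M.glue_eq_of_not_glued (mt M.glued_rev.1 hd), hpp hd, v2]
  have v0 : ∀ e, M.edge e ≠ M.edge d → D e = 0 := fun e he => by
    rw [Ne, M.edge_eq_iff] at he
    push Not at he
    funext n
    simp only [D, if_neg he.1, if_neg he.2.1, if_neg he.2.2.1, if_neg he.2.2.2, Pi.zero_apply]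
  have hrev : ∀ e n, D e.rev n = reflect (D e n) := by
    intro e n
    by_cases he : M.edge e = M.edge d
    · rcases M.edge_eq_iff.1 he with rfl | rfl | rfl | rfl
      · rw [v1, v2]
      · rw [MeshFlag.rev_rev, v1, v2, reflect_reflect]
      · rw [← M.glue_rev, v3, v4]
      · rw [← M.glue_rev, MeshFlag.rev_rev, v3, v4, reflect_reflect]
    · rw [v0 e he, v0 _ (by rwa [M.edge_rev])]
      simp
  have hd : G.JetGlued d D := fun hd => by
    rw [v1, v3, v1, v3]
    exact ⟨rfl, h5 hd⟩
  refine ⟨D, fun e n => ?_, hrev, fun e => ?_, ?_, v0⟩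
  · by_cases he : M.edge e = M.edge d
    · rcases M.edge_eq_iff.1 he with rfl | rfl | rfl | rfl
      · rw [v1]; exact hp n
      · rw [v2]; exact reflect_mem_spline (hp n)
      · rw [v3]; exact hp' n
      · rw [v4]; exact reflect_mem_spline (hp' n)
    · rw [v0 e he]
      exact zero_mem _
  · by_cases he : M.edge e = M.edge d
    · exact hd.of_edge_eq hrev he
    · intro _
      rw [v0 e he, v0 _ (by rwa [M.edge_glue])]
      simp
  · simp only [edgeTriple, v1, v3]
    rfl

/-- At degrees beyond the separability, the pairs of Taylor data at both ends of an edge are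
independent of each other. -/
theorem map_endsMap_edgeSpace (hk : G.maxSeparability r ≤ (k : ℕ∞)) (d : MeshFlag Φ) :
    (G.edgeSpace r k d).map endsMap = (G.endSpace d).prod (G.endSpace d.rev) := by
  apply le_antisymm
  · rintro _ ⟨q, hq, rfl⟩
    obtain ⟨D, -, hrev, hglue, rfl, -⟩ := exists_edgeTriple_eq hq
    rw [endsMap_edgeTriple hrev (hglue d)]
    exact ⟨(hglue d).endJet_mem, (hglue d.rev).endJet_mem⟩
  · rintro ⟨p, q⟩ ⟨hp, hq⟩
    obtain ⟨f, hf, e1, e2, e3, e4⟩ := exists_jets_of_maxSeparability_le hk d hp hq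
    refine ⟨_, hf.edgeTriple_mem (jets_mem f), ?_⟩
    rw [endsMap_edgeTriple (jets_rev f) hf, e1, e2, e3, e4]

variable (G) in
/-- The triples of jets along the edge of `d` with zero Taylor data at both ends. -/
def clampedEdgeSpace (r k : ℕ) (d : MeshFlag Φ) : Submodule ℝ (PolyPair × PolyPair × PolyPair) :=
  G.edgeSpace r k d ⊓ LinearMap.ker endsMap

instance clampedEdgeSpace_finite (d : MeshFlag Φ) : Module.Finite ℝ (G.clampedEdgeSpace r k d) :=
  Submodule.finiteDimensional_of_le inf_le_left

theorem edgeTriple_mem_clampedEdgeSpace {f : G.splines r k} (hf : ∀ d, cornerTaylor f.1 d = 0)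
    (d : MeshFlag Φ) : edgeTriple M d (jets (G.patches r k f)) ∈ G.clampedEdgeSpace r k d := by
  refine ⟨(jetGlued_patches f d).edgeTriple_mem (jets_mem _), ?_⟩
  have h0 : ∀ d, endJet (jets (G.patches r k f) d) = 0 := fun d =>
    (cornerTaylor_eq (G.patches r k f) d).symm.trans (hf d)
  rw [SetLike.mem_coe, LinearMap.mem_ker, endsMap_edgeTriple (jets_rev _) (jetGlued_patches f d)]
  simp only [h0]
  rfl

/-- Clamped jets along an edge are those of a spline attached to the edge. -/
theorem exists_attachedToEdge {e : Bool × Bool → PolyPair.spline (r + 1) (k + 1)}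
    (he : IsHermiteBasis e) {d : MeshFlag Φ} {q : PolyPair × PolyPair × PolyPair}
    (hq : q ∈ G.clampedEdgeSpace r k d) : ∃ f : G.splines r k, M.AttachedToEdge (M.edge d) f.1 ∧
      edgeTriple M d (jets (G.patches r k f)) = q ∧
      ∀ e, M.edge e ≠ M.edge d → jets (G.patches r k f) e = 0 := by
  obtain ⟨D, hmem, hrev, hglue, rfl, h0⟩ := exists_edgeTriple_eq hq.1
  have hend := hq.2
  rw [SetLike.mem_coe, LinearMap.mem_ker, endsMap_edgeTriple hrev (hglue d)] at hend
  simp only [Prod.mk_eq_zero] at hend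
  have htay : ∀ e, endJet (D e) = 0 := by
    intro e
    by_cases he : M.edge e = M.edge d
    · rcases M.edge_eq_iff.1 he with rfl | rfl | rfl | rfl
      · exact hend.1.1
      · exact hend.2.1
      · exact hend.1.2
      · exact hend.2.2
    · rw [h0 e he]
      funext i
      fin_cases i <;> simp [endJet]
  obtain ⟨f, hf, hf0⟩ := exists_spline_jets_eq he hmem hrev hglue
    (fun d => by rw [htay, htay, map_zero])
  refine ⟨f, ⟨fun σ hσ => hf0 σ fun d hd => h0 d (hσ d hd), fun e he => ?_, fun e => ?_⟩, ?_, ?_⟩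
  · refine (vanishesAlong_iff (G.patches r k f) e).2 ?_
    rw [hf, h0 e he]
  · have := cornerTaylor_eq (G.patches r k f) e
    rw [hf, htay] at this
    exact this
  · rw [hf]
  · rw [hf]; exact h0

/-! ### Dimension counts for an edge -/

theorem finrank_edgeSpace_of_not_glued (hrk : r ≤ k) {d : MeshFlag Φ} (hd : ¬M.Glued d) :
    (Module.finrank ℝ (G.edgeSpace r k d) : ℤ) = 4 * k - 2 * r + 2 := by
  let φ : (PolyPair.spline (r + 1) (k + 1) × PolyPair.spline (r + 1) (k + 1)) ≃ₗ[ℝ]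
      G.edgeSpace r k d :=
    { toFun := fun p => ⟨(p.1.1, p.2.1, p.2.1), p.1.2, p.2.2, p.2.2, fun _ => rfl,
        fun h => absurd h hd⟩
      map_add' := fun _ _ => rfl
      map_smul' := fun _ _ => rfl
      invFun := fun q => (⟨q.1.1, q.2.1⟩, ⟨q.1.2.1, q.2.2.1⟩)
      left_inv := fun _ => rfl
      right_inv := fun q => Subtype.ext (Prod.ext rfl (Prod.ext rfl (q.2.2.2.2.1 hd))) }
  have h := φ.finrank_eq
  rw [Module.finrank_prod] at h
  have h2 := finrank_spline (s := r + 1) (n := k + 1) (by omega)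
  omega

/-- A triple `(g, h, h')` is determined by `g(0)` and the syzygy `(g', h', -h)`. -/
theorem finrank_edgeSpace_of_glued {d : MeshFlag Φ} (hd : M.Glued d) :
    Module.finrank ℝ (G.edgeSpace r k d) =
      Module.finrank ℝ (syzygies r k (G.a d) (G.b d) (G.c d)) + 1 := by
  let φ : G.edgeSpace r k d →ₗ[ℝ] syzygies r k (G.a d) (G.b d) (G.c d) × ℝ :=
    { toFun := fun q => (⟨(toFun (PolyPair.deriv q.1.1), toFun q.1.2.2, -toFun q.1.2.1),
        deriv_mem_spline q.2.1, q.2.2.2.1, neg_mem q.2.2.1, fun u _ => by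
          have := congrFun (congrArg toFun (q.2.2.2.2.2 hd)) u
          rw [← toFun_polyA hd, ← toFun_polyB hd, ← toFun_polyC hd]
          simp only [map_mul, map_add, Pi.mul_apply, Pi.add_apply, Pi.neg_apply] at this ⊢
          linear_combination -this⟩, jet₀ false q.1.1)
      map_add' := fun p q => by
        refine Prod.ext (Subtype.ext (Prod.ext ?_ (Prod.ext ?_ ?_))) ?_
        · change toFun (PolyPair.deriv (p.1.1 + q.1.1)) = _
          rw [map_add, map_add]
          rfl
        · change toFun (p.1.2.2 + q.1.2.2) = _
          rw [map_add]
          rfl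
        · change -toFun (p.1.2.1 + q.1.2.1) = _
          rw [map_add, neg_add]
          rfl
        · exact map_add (jet₀ false) p.1.1 q.1.1
      map_smul' := fun c q => by
        refine Prod.ext (Subtype.ext (Prod.ext ?_ (Prod.ext ?_ ?_))) ?_
        · change toFun (PolyPair.deriv (c • q.1.1)) = _
          rw [map_smul, map_smul]
          rfl
        · change toFun (c • q.1.2.2) = _
          rw [map_smul]
          rfl
        · change -toFun (c • q.1.2.1) = _
          rw [map_smul, ← smul_neg]
          rfl
        · exact map_smul (jet₀ false) c q.1.1 }
  have hinj : Function.Injective φ := by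
    rw [injective_iff_map_eq_zero]
    intro q hq
    have h1 : toFun (PolyPair.deriv q.1.1) = 0 :=
      congrArg (fun x => x.1.1.1) hq
    have h2 : toFun q.1.2.2 = 0 := congrArg (fun x => x.1.1.2.1) hq
    have h3 : -toFun q.1.2.1 = 0 := congrArg (fun x => x.1.1.2.2) hq
    have h4 : jet₀ false q.1.1 = 0 := congrArg Prod.snd hq
    rw [← map_zero toFun] at h1 h2
    rw [neg_eq_zero, ← map_zero toFun] at h3
    exact Subtype.ext (Prod.ext (eq_of_deriv_eq_zero q.2.1 (toFun_injective h1) h4)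
      (Prod.ext (toFun_injective h3) (toFun_injective h2)))
  have hsurj : Function.Surjective φ := by
    rintro ⟨⟨⟨A, B, C⟩, hA, hB, hC, h⟩, z⟩
    obtain ⟨A, hA, rfl⟩ := exists_of_mem hA
    obtain ⟨B, hB, rfl⟩ := exists_of_mem hB
    obtain ⟨C, hC, rfl⟩ := exists_of_mem hC
    obtain ⟨g, hg, rfl, hz⟩ := exists_deriv_eq hA z
    refine ⟨⟨(g, -C, B), hg, neg_mem hC, hB, fun h => absurd hd h, fun _ => ?_⟩, ?_⟩
    · refine eq_of_eqOn fun u hu _ => ?_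
      have := h u hu
      rw [← toFun_polyA hd, ← toFun_polyB hd, ← toFun_polyC hd] at this
      simp only [map_mul, map_add, map_neg, Pi.mul_apply, Pi.add_apply, Pi.neg_apply]
      linear_combination -this
    · refine Prod.ext (Subtype.ext (Prod.ext rfl (Prod.ext rfl ?_))) hz
      change -toFun (-C) = toFun C
      rw [map_neg, neg_neg]
  let ψ := LinearEquiv.ofBijective φ ⟨hinj, hsurj⟩
  have : Module.Finite ℝ (syzygies r k (G.a d) (G.b d) (G.c d) × ℝ) := Module.Finite.equiv ψ
  have : Module.Finite ℝ (syzygies r k (G.a d) (G.b d) (G.c d)) :=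
    Module.Finite.of_surjective (LinearMap.fst ℝ _ ℝ) LinearMap.fst_surjective
  rw [ψ.finrank_eq, Module.finrank_prod, Module.finrank_self]

variable (G) in
/-- The second components of the elements of `endSpace` with first component zero. -/
def freeSpace (d : MeshFlag Φ) : Submodule ℝ (Fin 4 → ℝ) :=
  (G.endSpace d).comap (LinearMap.inr ℝ (Fin 4 → ℝ) (Fin 4 → ℝ))

theorem mem_freeSpace {d : MeshFlag Φ} {t : Fin 4 → ℝ} :
    t ∈ G.freeSpace d ↔ (0, t) ∈ G.endSpace d := Iff.rfl

/-- Across an edge which is not a crossing edge, exactly the mixed derivative can be chosen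
freely. -/
theorem finrank_freeSpace {d : MeshFlag Φ} (hd : M.Glued d) :
    (Module.finrank ℝ (G.freeSpace d) : ℤ) = 1 - G.crossing d := by
  have hb := fb_ne_zero (G := G) hd
  by_cases ha : G.fa d 0 = 0
  · have h0 : G.freeSpace d = ⊥ := by
      rw [eq_bot_iff]
      intro t ht
      rw [mem_freeSpace, mem_endSpace_of_glued hd] at ht
      obtain ⟨h0, h1, h2, h3⟩ := ht
      have h3 := h3 ha
      simp only [Pi.zero_apply] at h0 h1 h2 h3
      rw [← h1] at h2 h3
      have h2' : t 2 = 0 := by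
        have : G.fb d 0 * t 2 = 0 := by linarith
        exact (mul_eq_zero.1 this).resolve_left hb
      rw [h2'] at h3
      have h3' : t 3 = 0 := by
        have : G.fb d 0 * t 3 = 0 := by linarith
        exact (mul_eq_zero.1 this).resolve_left hb
      rw [Submodule.mem_bot]
      funext i
      fin_cases i
      · exact h0.symm
      · exact h1.symm
      · exact h2'
      · exact h3'
    rw [h0, finrank_bot, crossing, if_pos ⟨hd, ha⟩]
    norm_num
  · have h0 : G.freeSpace d = Submodule.span ℝ {Pi.single 3 1} := by
      ext t
      rw [Submodule.mem_span_singleton, mem_freeSpace, mem_endSpace_of_glued hd]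
      constructor
      · rintro ⟨h0, h1, h2, -⟩
        simp only [Pi.zero_apply] at h0 h1 h2
        rw [← h1] at h2
        have h2' : t 2 = 0 := by
          have : G.fb d 0 * t 2 = 0 := by linarith
          exact (mul_eq_zero.1 this).resolve_left hb
        refine ⟨t 3, ?_⟩
        funext i
        fin_cases i
        · simpa using h0
        · simpa using h1
        · simpa using h2'.symm
        · simp
      · rintro ⟨c, rfl⟩
        simp [ha]
    rw [h0, finrank_span_singleton (by
      intro h; simpa using congrFun h (3 : Fin 4)), crossing, if_neg (fun h => ha h.2)]
    norm_num

theorem exists_mem_endSpace (d : MeshFlag Φ) (s : Fin 4 → ℝ) : ∃ t, (s, t) ∈ G.endSpace d := by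
  by_cases hd : M.Glued d
  · have hb := fb_ne_zero (G := G) hd
    set x := (s 2 - G.fa d 0 * s 1) / G.fb d 0
    refine ⟨![s 0, s 1, x, (s 3 - _root_.deriv (G.fb d) 0 * x - _root_.deriv (G.fa d) 0 * s 1) /
      G.fb d 0], ?_⟩
    rw [mem_endSpace_of_glued hd]
    simp only [Matrix.cons_val, true_and]
    constructor
    · simp only [x]
      field_simp
      ring
    · intro _
      field_simp
      ring
  · exact ⟨s, (mem_endSpace_of_not_glued hd).2 rfl⟩

theorem finrank_endSpace (d : MeshFlag Φ) :
    Module.finrank ℝ (G.endSpace d) = 4 + Module.finrank ℝ (G.freeSpace d) := by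
  let φ : G.endSpace d →ₗ[ℝ] (Fin 4 → ℝ) := LinearMap.fst ℝ _ _ ∘ₗ (G.endSpace d).subtype
  have hφ : Function.Surjective φ := fun s => by
    obtain ⟨t, ht⟩ := exists_mem_endSpace d s
    exact ⟨⟨_, ht⟩, rfl⟩
  let ψ : LinearMap.ker φ ≃ₗ[ℝ] G.freeSpace d :=
    { toFun := fun x => ⟨x.1.1.2, by
        have : (0, x.1.1.2) = x.1.1 := Prod.ext (show 0 = φ x.1 from x.2.symm) rfl
        rw [mem_freeSpace, this]
        exact x.1.2⟩
      map_add' := fun _ _ => rfl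
      map_smul' := fun _ _ => rfl
      invFun := fun t => ⟨⟨(0, t.1), t.2⟩, rfl⟩
      left_inv := fun x => Subtype.ext (Subtype.ext
        (Prod.ext (show 0 = φ x.1 from x.2.symm) rfl))
      right_inv := fun _ => rfl }
  have h := LinearMap.finrank_range_add_finrank_ker φ
  rw [LinearMap.range_eq_top.2 hφ, finrank_top, ψ.finrank_eq, Module.finrank_fin_fun] at h
  exact h.symm

theorem finrank_endSpace_of_glued {d : MeshFlag Φ} (hd : M.Glued d) :
    (Module.finrank ℝ (G.endSpace d) : ℤ) = 5 - G.crossing d := by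
  rw [finrank_endSpace]
  push_cast
  rw [finrank_freeSpace hd]
  ring

theorem finrank_endSpace_of_not_glued {d : MeshFlag Φ} (hd : ¬M.Glued d) :
    Module.finrank ℝ (G.endSpace d) = 4 := by
  have h0 : G.freeSpace d = ⊥ := by
    rw [eq_bot_iff]
    intro t ht
    rw [mem_freeSpace, mem_endSpace_of_not_glued hd] at ht
    exact ht.symm
  rw [finrank_endSpace, h0, finrank_bot]

theorem finrank_prod_submodule {V W : Type*} [AddCommGroup V] [Module ℝ V] [AddCommGroup W]
    [Module ℝ W] [Module.Finite ℝ V] [Module.Finite ℝ W] (p : Submodule ℝ V) (q : Submodule ℝ W) :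
    Module.finrank ℝ (p.prod q) = Module.finrank ℝ p + Module.finrank ℝ q := by
  let φ : p.prod q ≃ₗ[ℝ] p × q :=
    { toFun := fun x => (⟨x.1.1, x.2.1⟩, ⟨x.1.2, x.2.2⟩)
      map_add' := fun _ _ => rfl
      map_smul' := fun _ _ => rfl
      invFun := fun x => ⟨(x.1.1, x.2.1), x.1.2, x.2.2⟩
      left_inv := fun _ => rfl
      right_inv := fun _ => rfl }
  rw [φ.finrank_eq, Module.finrank_prod]

theorem finrank_map_add_finrank_inf_ker {V W : Type*} [AddCommGroup V] [Module ℝ V]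
    [AddCommGroup W] [Module ℝ W] (p : Submodule ℝ V) [Module.Finite ℝ p] (φ : V →ₗ[ℝ] W) :
    Module.finrank ℝ (p.map φ) + Module.finrank ℝ (p ⊓ LinearMap.ker φ : Submodule ℝ V) =
      Module.finrank ℝ p := by
  let ψ : LinearMap.ker (φ.domRestrict p) ≃ₗ[ℝ] (p ⊓ LinearMap.ker φ : Submodule ℝ V) :=
    { toFun := fun x => ⟨x.1.1, x.1.2, x.2⟩
      map_add' := fun _ _ => rfl
      map_smul' := fun _ _ => rfl
      invFun := fun x => ⟨⟨x.1, x.2.1⟩, x.2.2⟩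
      left_inv := fun _ => rfl
      right_inv := fun _ => rfl }
  have h := LinearMap.finrank_range_add_finrank_ker (φ.domRestrict p)
  rwa [LinearMap.range_domRestrict, ψ.finrank_eq] at h

theorem crossing_of_not_glued {d : MeshFlag Φ} (hd : ¬M.Glued d) : G.crossing d = 0 :=
  if_neg fun h => hd h.1

theorem finrank_clampedEdgeSpace (hrk : r ≤ k) (hk : G.maxSeparability r ≤ (k : ℕ∞))
    (τ : M.Edge) : (Module.finrank ℝ (G.clampedEdgeSpace r k τ.out) : ℤ) =
      G.dTilde r k τ - 9 + G.crossing τ.out + G.crossing τ.out.rev := by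
  have h := finrank_map_add_finrank_inf_ker (G.edgeSpace r k τ.out) endsMap
  rw [map_endsMap_edgeSpace hk, finrank_prod_submodule] at h
  rw [clampedEdgeSpace]
  by_cases hd : M.Glued τ.out
  · have h1 := finrank_edgeSpace_of_glued (G := G) (r := r) (k := k) hd
    have h2 := finrank_endSpace_of_glued (G := G) hd
    have h3 := finrank_endSpace_of_glued (G := G) (M.glued_rev.2 hd)
    rw [dTilde, if_pos hd]
    zify at h h1
    linarith
  · have h1 := finrank_edgeSpace_of_not_glued (G := G) hrk hd
    have h2 := finrank_endSpace_of_not_glued (G := G) hd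
    have hd' := mt M.glued_rev.1 hd
    have h3 := finrank_endSpace_of_not_glued (G := G) hd'
    rw [dTilde, if_neg hd, crossing_of_not_glued hd, crossing_of_not_glued hd']
    zify at h h2 h3
    linarith

end GluingData

end

noncomputable section

open Polynomial PolyPair

/-! ### The flags around a vertex -/

instance MeshFlag.finite {Φ : Type*} [Finite Φ] : Finite (MeshFlag Φ) :=
  Finite.of_injective (fun d : MeshFlag Φ => (d.face, d.cu, d.cv, d.axis)) fun d e h => by
    cases d
    cases e
    simp only [Prod.mk.injEq] at h
    obtain ⟨rfl, rfl, rfl, rfl⟩ := h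
    rfl

namespace QuadMesh

variable {Φ : Type*} (M : QuadMesh Φ)

theorem rot_injective : Function.Injective M.rot := fun d e h => by
  have h1 : M.glue d = M.glue e := by
    rw [← MeshFlag.turn_turn (M.glue d), ← MeshFlag.turn_turn (M.glue e)]
    exact congrArg _ h
  rw [← M.glue_glue d, h1, M.glue_glue]

theorem turn_rot (d : MeshFlag Φ) : (M.rot d).turn = M.glue d := MeshFlag.turn_turn _

theorem vertex_rot (d : MeshFlag Φ) : M.vertex (M.rot d) = M.vertex d := by
  rw [rot, vertex_turn, vertex_glue]

theorem vertex_iterate_rot (d : MeshFlag Φ) (i : ℕ) : M.vertex (M.rot^[i] d) = M.vertex d := by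
  induction i with
  | zero => rfl
  | succ i ih => rw [Function.iterate_succ_apply', vertex_rot, ih]

/-- The flags `d, rot d, …, rot^n d`, together with their images under `turn`, are the flags
at `γ`, without repetition. Either the two extreme sides are boundary sides, or they are glued and
`rot` closes up after `n + 1` steps. -/
structure IsFan (γ : M.Vertex) (d : MeshFlag Φ) (n : ℕ) : Prop where
  vertex_eq : M.vertex d = γ
  glued : ∀ i < n, M.Glued (M.rot^[i] d)
  inj : ∀ i ≤ n, ∀ j ≤ n, M.rot^[i] d = M.rot^[j] d → i = j
  closes : (¬M.Glued (M.rot^[n] d) ∧ ¬M.Glued d.turn) ∨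
    (M.IsInterior γ ∧ M.period d = n + 1 ∧ M.rot^[n + 1] d = d)

variable {M}
variable {γ : M.Vertex} {d : MeshFlag Φ} {n : ℕ}

theorem IsFan.turn_ne_add (h : M.IsFan γ d n) (m : ℕ) :
    ∀ i, i + m ≤ n → (M.rot^[i] d).turn ≠ M.rot^[i + m] d := by
  induction m using Nat.strong_induction_on with
  | _ m ih =>
    intro i hi heq
    rcases m with _ | _ | m
    · exact MeshFlag.turn_ne _ heq
    · rw [Function.iterate_succ_apply', rot] at heq
      have h1 := congrArg MeshFlag.turn heq
      rw [MeshFlag.turn_turn, MeshFlag.turn_turn] at h1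
      exact h.glued i (by omega) h1.symm
    · have h1 : M.rot^[i] d = M.glue (M.rot^[i + (m + 1)] d) := by
        rw [← turn_rot, ← Function.iterate_succ_apply' M.rot, ← MeshFlag.turn_turn (M.rot^[i] d)]
        exact congrArg MeshFlag.turn heq
      have h2 : (M.rot^[i + 1] d).turn = M.rot^[i + 1 + m] d := by
        rw [Function.iterate_succ_apply', turn_rot, h1, M.glue_glue]
        congr 1
        omega
      exact ih m (by omega) (i + 1) (by omega) h2

theorem IsFan.turn_ne (h : M.IsFan γ d n) {i j : ℕ} (hi : i ≤ n) (hj : j ≤ n) :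
    (M.rot^[i] d).turn ≠ M.rot^[j] d := by
  rcases le_total i j with hij | hij
  · obtain ⟨m, rfl⟩ := Nat.exists_eq_add_of_le hij
    exact h.turn_ne_add m i hj
  · obtain ⟨m, rfl⟩ := Nat.exists_eq_add_of_le hij
    intro heq
    apply h.turn_ne_add m j hi
    rw [← heq, MeshFlag.turn_turn]

/-- Crossing the first side of a fan. -/
theorem IsFan.glue_turn (h : M.IsFan γ d n) :
    M.glue d.turn = d.turn ∧ M.glue (M.rot^[n] d) = M.rot^[n] d ∨
    M.glue d.turn = M.rot^[n] d ∧ M.glue (M.rot^[n] d) = d.turn := by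
  rcases h.closes with ⟨h1, h2⟩ | ⟨-, -, h3⟩
  · exact Or.inl ⟨M.glue_eq_of_not_glued h2, M.glue_eq_of_not_glued h1⟩
  · right
    have : M.glue (M.rot^[n] d) = d.turn := by
      rw [← turn_rot, ← Function.iterate_succ_apply' M.rot, h3]
    exact ⟨by rw [← this, M.glue_glue], this⟩

theorem IsFan.exists_of_vertex_eq (h : M.IsFan γ d n) {e : MeshFlag Φ} (he : M.vertex e = γ) :
    ∃ i ≤ n, e = M.rot^[i] d ∨ e = (M.rot^[i] d).turn := by
  let S : MeshFlag Φ → Prop := fun e => ∃ i ≤ n, e = M.rot^[i] d ∨ e = (M.rot^[i] d).turn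
  have hturn : ∀ e, S e → S e.turn := by
    rintro _ ⟨i, hi, rfl | rfl⟩
    · exact ⟨i, hi, Or.inr rfl⟩
    · exact ⟨i, hi, Or.inl (MeshFlag.turn_turn _)⟩
  have hglue : ∀ e, S e → S (M.glue e) := by
    rintro _ ⟨i, hi, rfl | rfl⟩
    · rcases hi.lt_or_eq with hi | rfl
      · exact ⟨i + 1, hi, Or.inr (by rw [Function.iterate_succ_apply', turn_rot])⟩
      · rcases h.glue_turn with ⟨-, h1⟩ | ⟨-, h1⟩
        · exact ⟨i, le_rfl, Or.inl h1⟩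
        · exact ⟨0, Nat.zero_le _, Or.inr h1⟩
    · rcases i with _ | i
      · rcases h.glue_turn with ⟨h1, -⟩ | ⟨h1, -⟩
        · exact ⟨0, hi, Or.inr h1⟩
        · exact ⟨n, le_rfl, Or.inl h1⟩
      · exact ⟨i, by omega, Or.inl (by rw [Function.iterate_succ_apply', turn_rot, M.glue_glue])⟩
  have key : ∀ x y, Relation.EqvGen (fun d e => e = d.turn ∨ e = M.glue d) x y → (S x ↔ S y) := by
    intro x y hxy
    induction hxy with
    | rel x y hxy =>
      rcases hxy with rfl | rfl
      · exact ⟨hturn x, fun hx => by simpa [MeshFlag.turn_turn] using hturn _ hx⟩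
      · exact ⟨hglue x, fun hx => by simpa [M.glue_glue] using hglue _ hx⟩
    | refl x => exact Iff.rfl
    | symm x y _ ih => exact ih.symm
    | trans x y z _ _ ih₁ ih₂ => exact ih₁.trans ih₂
  rw [← h.vertex_eq] at he
  exact (key _ _ (Quot.eqvGen_exact he)).2 ⟨0, Nat.zero_le _, Or.inl rfl⟩

/-- The numbering of the flags at a vertex given by a fan. -/
def IsFan.equiv (h : M.IsFan γ d n) : Fin (n + 1) × Bool ≃ {e : MeshFlag Φ // M.vertex e = γ} :=
  Equiv.ofBijective
    (fun x => ⟨if x.2 then (M.rot^[x.1] d).turn else M.rot^[x.1] d, by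
      split_ifs
      · rw [vertex_turn, vertex_iterate_rot, h.vertex_eq]
      · rw [vertex_iterate_rot, h.vertex_eq]⟩)
    (by
      constructor
      · rintro ⟨i, b⟩ ⟨j, c⟩ hij
        have hi := Nat.lt_succ_iff.1 i.2
        have hj := Nat.lt_succ_iff.1 j.2
        have hij := congrArg Subtype.val hij
        cases b <;> cases c <;> simp only [Bool.false_eq_true, if_true, if_false] at hij
        · rw [Fin.ext (h.inj i hi j hj hij)]
        · exact absurd hij.symm (h.turn_ne hj hi)
        · exact absurd hij (h.turn_ne hi hj)
        · have := congrArg MeshFlag.turn hij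
          rw [MeshFlag.turn_turn, MeshFlag.turn_turn] at this
          rw [Fin.ext (h.inj i hi j hj this)]
      · rintro ⟨e, he⟩
        obtain ⟨i, hi, rfl | rfl⟩ := h.exists_of_vertex_eq he
        · exact ⟨(⟨i, Nat.lt_succ_iff.2 hi⟩, false), rfl⟩
        · exact ⟨(⟨i, Nat.lt_succ_iff.2 hi⟩, true), rfl⟩)

open Classical in
theorem IsFan.card_eq (h : M.IsFan γ d n) (p : MeshFlag Φ → Prop) :
    Nat.card {e : MeshFlag Φ // M.vertex e = γ ∧ p e} =
      ∑ i ∈ Finset.range (n + 1),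
        ((if p (M.rot^[i] d) then 1 else 0) + if p (M.rot^[i] d).turn then 1 else 0) := by
  have e1 : {x : Fin (n + 1) × Bool // p (h.equiv x).1} ≃
      {e : MeshFlag Φ // M.vertex e = γ ∧ p e} :=
    (h.equiv.subtypeEquiv (p := fun x => p (h.equiv x).1) (q := fun e => p e.1)
      fun x => Iff.rfl).trans (Equiv.subtypeSubtypeEquivSubtypeInter _ _)
  rw [← Nat.card_congr e1, Nat.card_eq_fintype_card, Fintype.card_subtype, Finset.card_filter,
    Fintype.sum_prod_type, Finset.sum_range]
  refine Finset.sum_congr rfl fun i _ => ?_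
  rw [Fintype.sum_bool, add_comm]
  rfl

theorem IsFan.numCorners_eq (h : M.IsFan γ d n) : M.numCorners γ = n + 1 := by
  rw [numCorners, h.card_eq]
  refine (Finset.sum_congr rfl (g := fun _ => 1) fun i _ => ?_).trans (by simp)
  cases hx : (M.rot^[i] d).axis <;> simp [MeshFlag.turn, hx]

theorem exists_isFan_of_not_isInterior [Finite Φ] (hγ : ¬M.IsInterior γ) :
    ∃ d n, M.IsFan γ d n ∧ ¬M.Glued (M.rot^[n] d) ∧ ¬M.Glued d.turn := by
  classical
  unfold IsInterior at hγ
  push Not at hγ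
  obtain ⟨b, rfl, hb⟩ := hγ
  have hrot : M.rot b = b.turn := by rw [rot, M.glue_eq_of_not_glued hb]
  have hper : b.turn ∈ Function.periodicPts M.rot := M.rot_injective.mem_periodicPts _
  have hp := Function.minimalPeriod_pos_of_mem_periodicPts hper
  set p := Function.minimalPeriod M.rot b.turn with hpdef
  have hlast : M.rot^[p - 1] b.turn = b := by
    apply M.rot_injective
    rw [← Function.iterate_succ_apply' M.rot, Nat.succ_eq_add_one, Nat.sub_add_cancel hp, hrot]
    exact Function.iterate_minimalPeriod
  have hex : ∃ i, ¬M.Glued (M.rot^[i] b.turn) := ⟨p - 1, by rwa [hlast]⟩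
  have hle : Nat.find hex ≤ p - 1 := Nat.find_le (by rwa [hlast])
  have hb' : ¬M.Glued b.turn.turn := by rwa [MeshFlag.turn_turn]
  refine ⟨b.turn, Nat.find hex, ⟨M.vertex_turn b, fun i hi => ?_, fun i hi j hj hij => ?_,
    Or.inl ⟨Nat.find_spec hex, hb'⟩⟩, Nat.find_spec hex, hb'⟩
  · exact not_not.1 (Nat.find_min hex hi)
  · exact Function.iterate_injOn_Iio_minimalPeriod (f := M.rot) (x := b.turn)
      (Set.mem_Iio.2 (by omega)) (Set.mem_Iio.2 (by omega)) hij

theorem isFan_of_isInterior [Finite Φ] (hγ : M.IsInterior γ) (hd : M.vertex d = γ) :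
    M.IsFan γ d (M.period d - 1) := by
  have hper : d ∈ Function.periodicPts M.rot := M.rot_injective.mem_periodicPts _
  have hp : 0 < M.period d := Function.minimalPeriod_pos_of_mem_periodicPts hper
  refine ⟨hd, fun i _ => hγ _ ?_, fun i hi j hj hij => ?_, Or.inr ⟨hγ, by omega, ?_⟩⟩
  · rw [vertex_iterate_rot, hd]
  · exact Function.iterate_injOn_Iio_minimalPeriod (f := M.rot) (x := d)
      (Set.mem_Iio.2 (by unfold period at hi hp; omega))
      (Set.mem_Iio.2 (by unfold period at hj hp; omega)) hij
  · rw [Nat.sub_add_cancel hp]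
    exact Function.iterate_minimalPeriod

end QuadMesh

namespace GluingData

variable {Φ : Type*} {M : QuadMesh Φ} {G : GluingData M} {γ : M.Vertex} {d : MeshFlag Φ} {n : ℕ}

theorem isCrossing_glue : G.IsCrossing (M.glue d) ↔ G.IsCrossing d := by
  have key : ∀ d, G.IsCrossing d → G.IsCrossing (M.glue d) := by
    rintro d ⟨hd, h⟩
    refine ⟨M.glued_glue.2 hd, ?_⟩
    rw [fa_zero hd, div_eq_zero_iff, or_iff_left (jet₀_polyC_ne_zero hd)] at h
    rw [fa_zero (M.glued_glue.2 hd), polyA_glue hd, map_neg, h, neg_zero, zero_div]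
  exact ⟨fun h => by simpa [M.glue_glue] using key _ h, key d⟩

variable (G) in
/-- Around every vertex there is a fan whose last side, if it is a crossing edge, is so only
because the vertex is a crossing vertex. -/
theorem exists_isFan [Finite Φ] (γ : M.Vertex) : ∃ d n, M.IsFan γ d n ∧
    (G.IsCrossing (M.rot^[n] d) ↔ G.IsCrossingVertex γ) := by
  by_cases hγ : M.IsInterior γ
  · by_cases hc : G.IsCrossingVertex γ
    · obtain ⟨d, hd⟩ : ∃ d, M.vertex d = γ := Quot.exists_rep γ
      exact ⟨d, _, QuadMesh.isFan_of_isInterior hγ hd,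
        fun _ => hc, fun _ => hc _ (by rw [M.vertex_iterate_rot, hd])⟩
    · have hc' := hc
      unfold IsCrossingVertex at hc'
      push Not at hc'
      obtain ⟨b, hb, hbc⟩ := hc'
      have h := QuadMesh.isFan_of_isInterior hγ ((M.vertex_rot b).trans hb)
      refine ⟨M.rot b, _, h, ?_⟩
      rcases h.closes with ⟨h1, -⟩ | ⟨-, -, h3⟩
      · exact absurd (hγ _ (by rw [M.vertex_iterate_rot, M.vertex_rot, hb])) h1
      · rw [← Function.iterate_succ_apply, Function.iterate_succ_apply'] at h3
        rw [← Function.iterate_succ_apply, M.rot_injective h3]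
        exact ⟨fun h => absurd h hbc, fun h => absurd h hc⟩
  · obtain ⟨d, n, h, h1, -⟩ := QuadMesh.exists_isFan_of_not_isInterior hγ
    refine ⟨d, n, h, fun h' => absurd h'.1 h1, fun h' => absurd (h' (M.rot^[n] d) ?_).1 h1⟩
    rw [M.vertex_iterate_rot, h.vertex_eq]

open Classical in
theorem card_isCrossing (h : M.IsFan γ d n) :
    Nat.card {e : MeshFlag Φ // M.vertex e = γ ∧ G.IsCrossing e} =
      2 * ∑ i ∈ Finset.range (n + 1), if G.IsCrossing (M.rot^[i] d) then 1 else 0 := by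
  let c : MeshFlag Φ → ℕ := fun e => if G.IsCrossing e then 1 else 0
  have hglue : ∀ e, c (M.glue e) = c e := fun e => by simp only [c, isCrossing_glue]
  have hshift : ∑ i ∈ Finset.range (n + 1), c (M.rot^[i] d).turn =
      ∑ i ∈ Finset.range (n + 1), c (M.rot^[i] d) := by
    rw [Finset.sum_range_succ', Finset.sum_range_succ]
    congr 1
    · refine Finset.sum_congr rfl fun i _ => ?_
      rw [Function.iterate_succ_apply', M.turn_rot, hglue]
    · rcases h.closes with ⟨h1, h2⟩ | ⟨-, -, h3⟩
      · simp only [c, Function.iterate_zero, id]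
        rw [if_neg fun h => h2 h.1, if_neg fun h => h1 h.1]
      · rw [← hglue (M.rot^[n] d), ← M.turn_rot, ← Function.iterate_succ_apply' M.rot, h3]
        rfl
  rw [h.card_eq, Finset.sum_add_distrib, two_mul]
  exact congrArg₂ _ rfl hshift

theorem numCrossingEdges_eq (h : M.IsFan γ d n) :
    (G.numCrossingEdges γ : ℤ) = ∑ i ∈ Finset.range (n + 1), G.crossing (M.rot^[i] d) := by
  rw [numCrossingEdges, card_isCrossing h, Nat.mul_div_cancel_left _ (by norm_num), Nat.cast_sum]
  refine Finset.sum_congr rfl fun i _ => ?_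
  simp only [crossing]
  split_ifs <;> simp

variable (G) in
theorem two_mul_numCrossingEdges [Finite Φ] (γ : M.Vertex) : 2 * G.numCrossingEdges γ =
    Nat.card {e : MeshFlag Φ // M.vertex e = γ ∧ G.IsCrossing e} := by
  obtain ⟨d, n, h, -⟩ := exists_isFan G γ
  rw [numCrossingEdges, card_isCrossing h, Nat.mul_div_cancel_left _ (by norm_num)]

/-! ### Compatible Taylor data along a chain of edges -/

variable (G) in
/-- Taylor data at the consecutive corners of a chain of faces, compatible across the successive
edges. -/
def chainSpace (e : ℕ → MeshFlag Φ) (n : ℕ) : Submodule ℝ (Fin (n + 1) → Fin 4 → ℝ) where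
  carrier := {s | ∀ i : Fin n, (s i.castSucc, swapJet (s i.succ)) ∈ G.endSpace (e i)}
  zero_mem' := fun i => by
    rw [Pi.zero_apply, Pi.zero_apply, map_zero]
    exact zero_mem (G.endSpace (e i))
  add_mem' := fun {s t} hs ht i => by
    rw [Pi.add_apply, Pi.add_apply, map_add]
    exact add_mem (hs i) (ht i)
  smul_mem' := fun c s hs i => by
    rw [Pi.smul_apply, Pi.smul_apply, map_smul]
    exact Submodule.smul_mem _ c (hs i)

theorem finrank_chainSpace (e : ℕ → MeshFlag Φ) (n : ℕ) :
    Module.finrank ℝ (G.chainSpace e n) =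
      4 + ∑ i ∈ Finset.range n, Module.finrank ℝ (G.freeSpace (e i)) := by
  induction n with
  | zero =>
    have : G.chainSpace e 0 = ⊤ := eq_top_iff.2 fun s _ i => i.elim0
    rw [this, finrank_top, Module.finrank_pi_fintype]
    simp
  | succ n ih =>
    let ρ : G.chainSpace e (n + 1) →ₗ[ℝ] G.chainSpace e n :=
      { toFun := fun s => ⟨Fin.init s.1, fun i => s.2 i.castSucc⟩
        map_add' := fun _ _ => rfl
        map_smul' := fun _ _ => rfl }
    have hρ : Function.Surjective ρ := by
      rintro ⟨s, hs⟩
      obtain ⟨t, ht⟩ := exists_mem_endSpace (G := G) (e n) (s (Fin.last n))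
      refine ⟨⟨Fin.snoc (α := fun _ => Fin 4 → ℝ) s (swapJet t), fun i => ?_⟩,
        Subtype.ext (Fin.init_snoc (α := fun _ => Fin 4 → ℝ) _ _)⟩
      refine Fin.lastCases ?_ (fun j => ?_) i
      · rw [Fin.snoc_castSucc, Fin.succ_last, Fin.snoc_last, swapJet_swapJet]
        exact ht
      · rw [Fin.snoc_castSucc, Fin.succ_castSucc, Fin.snoc_castSucc]
        exact hs j
    have hker : ∀ s : LinearMap.ker ρ, ∀ i : Fin (n + 1), s.1.1 i.castSucc = 0 := fun s i =>
      congrFun (congrArg Subtype.val (LinearMap.mem_ker.1 s.2)) i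
    let ψ : LinearMap.ker ρ ≃ₗ[ℝ] G.freeSpace (e n) :=
      { toFun := fun s => ⟨swapJet (s.1.1 (Fin.last (n + 1))), by
          have := s.1.2 (Fin.last n)
          rw [hker, Fin.succ_last] at this
          exact this⟩
        map_add' := fun s t => Subtype.ext (map_add swapJet _ _)
        map_smul' := fun c s => Subtype.ext (map_smul swapJet _ _)
        invFun := fun t => ⟨⟨Fin.snoc (α := fun _ => Fin 4 → ℝ) 0 (swapJet t.1), fun i => by
          refine Fin.lastCases ?_ (fun j => ?_) i
          · rw [Fin.snoc_castSucc, Fin.succ_last, Fin.snoc_last, swapJet_swapJet]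
            exact t.2
          · rw [Fin.snoc_castSucc, Fin.succ_castSucc, Fin.snoc_castSucc, Pi.zero_apply,
              Pi.zero_apply, map_zero]
            exact zero_mem (G.endSpace _)⟩,
          Subtype.ext (Fin.init_snoc (α := fun _ => Fin 4 → ℝ) _ _)⟩
        left_inv := fun s => by
          refine Subtype.ext (Subtype.ext (funext fun i => ?_))
          refine Fin.lastCases ?_ (fun j => ?_) i
          · change Fin.snoc (α := fun _ => Fin 4 → ℝ) _ _ _ = _
            rw [Fin.snoc_last, swapJet_swapJet]
          · change Fin.snoc (α := fun _ => Fin 4 → ℝ) _ _ _ = _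
            rw [Fin.snoc_castSucc, hker]
            rfl
        right_inv := fun t => by
          refine Subtype.ext ?_
          change swapJet (Fin.snoc (α := fun _ => Fin 4 → ℝ) _ _ _) = _
          rw [Fin.snoc_last, swapJet_swapJet] }
    have h := LinearMap.finrank_range_add_finrank_ker ρ
    rw [LinearMap.range_eq_top.2 hρ, finrank_top, ψ.finrank_eq, ih] at h
    rw [Finset.sum_range_succ, ← h, add_assoc]

/-- The elimination of the mixed derivatives `t₀, …, t₂` around a crossing vertex; `x₀, …, x₃` are
the derivatives along the four edges. -/
theorem mixed_derivative_closes {b₀ b₁ b₂ b₃ a₀' a₁' a₂' a₃' b₀' b₁' b₂' b₃' x₀ x₁ x₂ x₃ y t₀ t₁ t₂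
    t₃ : ℝ} (p₁ : b₁ * b₃ = 1)
    (p₂ : b₀ * b₂ = 1) (e₁ : a₀' + b₃' / b₃ = -b₀ * (a₂' + b₁' / b₁))
    (e₂ : a₁' + b₀' / b₀ = -b₁ * (a₃' + b₂' / b₂)) (hx₃ : x₃ = b₀ * x₁) (hx₂ : x₂ = b₃ * x₀)
    (ht₀ : t₀ = b₀' * x₁ + b₀ * t₁ + a₀' * x₀) (ht₁ : t₁ = b₁' * x₂ + b₁ * t₂ + a₁' * x₁)
    (ht₂ : t₂ = b₂' * x₃ + b₂ * t₃ + a₂' * x₂) (hy : x₃ = y) :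
    t₃ = b₃' * x₀ + b₃ * t₀ + a₃' * y := by
  have i₀ : b₀⁻¹ = b₂ := inv_eq_of_mul_eq_one_right p₂
  have i₁ : b₁⁻¹ = b₃ := inv_eq_of_mul_eq_one_right p₁
  have i₂ : b₂⁻¹ = b₀ := inv_eq_of_mul_eq_one_left p₂
  have i₃ : b₃⁻¹ = b₁ := inv_eq_of_mul_eq_one_left p₁
  rw [div_eq_mul_inv, div_eq_mul_inv, i₁, i₃] at e₁
  rw [div_eq_mul_inv, div_eq_mul_inv, i₀, i₂] at e₂
  rw [← hy, ht₀, ht₁, ht₂, hx₃, hx₂]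
  linear_combination -t₃ * (b₀ * b₂ * p₁ + p₂) - b₃ * x₀ * e₁
    + (b₃' * x₀ - b₃ * b₀ * a₂' * x₀) * p₁ - b₃ * b₀ * x₁ * e₂ + b₃ * b₀' * x₁ * p₂
    + a₃' * b₀ * x₁ * p₁

/-- Taylor data transported around an interior vertex are compatible across the last edge as well.
For the values and the gradients this is the first compatibility condition. For the mixed
derivatives it is a condition only if the last edge is a crossing edge, and then it follows from
the second one. -/
theorem chain_closes (h₁ : G.Compat₁) (h₂ : G.Compat₂) (hγ : M.IsInterior (M.vertex d))
    (hn : M.period d = n + 1)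
    (hc : G.IsCrossing (M.rot^[n] d) → G.IsCrossingVertex (M.vertex d)) {s : ℕ → Fin 4 → ℝ}
    (hs : ∀ i < n, (s i, swapJet (s (i + 1))) ∈ G.endSpace (M.rot^[i] d)) :
    (s n, swapJet (s 0)) ∈ G.endSpace (M.rot^[n] d) := by
  have hgl : ∀ i, M.Glued (M.rot^[i] d) := fun i => hγ _ (M.vertex_iterate_rot d i)
  simp only [mem_endSpace_of_glued (hgl _), swapJet_apply, Matrix.cons_val] at hs ⊢
  have hval : ∀ i ≤ n, s i 0 = s 0 0 := by
    intro i hi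
    induction i with
    | zero => rfl
    | succ i ih => rw [← (hs i (by omega)).1, ih (by omega)]
  let T : ℕ → Matrix (Fin 2) (Fin 2) ℝ := fun i =>
    !![0, 1; G.fb (M.rot^[i] d) 0, G.fa (M.rot^[i] d) 0]
  have hvec : ∀ i ≤ n, ![s 0 1, s 0 2] =
      ((List.range i).map T).prod.mulVec ![s i 1, s i 2] := by
    intro i hi
    induction i with
    | zero => simp
    | succ i ih =>
      obtain ⟨-, e1, e2, -⟩ := hs i (by omega)
      have step : ![s i 1, s i 2] = (T i).mulVec ![s (i + 1) 1, s (i + 1) 2] := by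
        funext j
        fin_cases j
        · simp [T, Matrix.mulVec, e1]
        · simp [T, Matrix.mulVec, e2]
      rw [ih (by omega), List.range_succ, List.map_append, List.prod_append, step,
        Matrix.mulVec_mulVec]
      simp
  have hprod : ((List.range n).map T).prod * T n = 1 := by
    have := h₁ d hγ
    rw [hn, List.range_succ, List.map_append, List.prod_append] at this
    simpa using this
  have hlast : ![s n 1, s n 2] = (T n).mulVec ![s 0 1, s 0 2] := by
    rw [hvec n le_rfl, Matrix.mulVec_mulVec, mul_eq_one_comm.1 hprod, Matrix.one_mulVec]
  have l1 : s n 1 = s 0 2 := by simpa [T, Matrix.mulVec] using congrFun hlast 0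
  have l2 : s n 2 = G.fb (M.rot^[n] d) 0 * s 0 1 + G.fa (M.rot^[n] d) 0 * s 0 2 := by
    simpa [T, Matrix.mulVec] using congrFun hlast 1
  refine ⟨hval n le_rfl, l1, l2, fun ha => ?_⟩
  have hcv := hc ⟨hgl n, ha⟩
  obtain ⟨hper, e1, e2⟩ := h₂ d hcv
  obtain rfl : n = 3 := by omega
  have hfa : ∀ i, G.fa (M.rot^[i] d) 0 = 0 := fun i => (hcv _ (M.vertex_iterate_rot d i)).2
  obtain ⟨-, x0, y0, m0⟩ := hs 0 (by norm_num)
  obtain ⟨-, x1, y1, m1⟩ := hs 1 (by norm_num)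
  obtain ⟨-, x2, y2, m2⟩ := hs 2 (by norm_num)
  have m0 := m0 (hfa 0)
  have m1 := m1 (hfa 1)
  have m2 := m2 (hfa 2)
  have hprod' := h₁ d hγ
  rw [hper] at hprod'
  simp only [List.range_succ, List.range_zero, List.nil_append, List.map_append, List.map_cons,
    List.map_nil, List.prod_append, List.prod_cons, List.prod_nil, mul_one, hfa] at hprod'
  have p1 := congrFun (congrFun hprod' 0) 0
  have p2 := congrFun (congrFun hprod' 1) 1
  simp only [one_mul, Matrix.mul_apply, Fin.sum_univ_two, Matrix.of_apply, Matrix.cons_val,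
    Matrix.one_apply, mul_zero, mul_one, zero_mul, add_zero, zero_add, if_true] at p1 p2
  rw [hfa, zero_mul, add_zero] at y0 y1 y2 l2
  rw [← x0] at m0
  rw [← x1] at m1
  rw [← x2] at m2
  exact mixed_derivative_closes p1 p2 e1 e2 (l1.trans y0) (x2.trans l2) m0 m1 m2 l1

/-- The compatible Taylor data at a vertex are determined by their values on the flags of a fan. -/
theorem finrank_vertexSpace_eq_chainSpace (h₁ : G.Compat₁) (h₂ : G.Compat₂) (h : M.IsFan γ d n)
    (hc : G.IsCrossing (M.rot^[n] d) ↔ G.IsCrossingVertex γ) :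
    Module.finrank ℝ (G.vertexSpace γ) =
      Module.finrank ℝ (G.chainSpace (fun i => M.rot^[i] d) n) := by
  let φ : G.vertexSpace γ →ₗ[ℝ] G.chainSpace (fun i => M.rot^[i] d) n :=
    { toFun := fun t => ⟨fun i => t.1 (M.rot^[i] d), fun i => by
        have := t.2.2.1 (M.rot^[i] d)
        rw [← M.turn_rot, t.2.2.2, ← Function.iterate_succ_apply' M.rot] at this
        exact this⟩
      map_add' := fun _ _ => rfl
      map_smul' := fun _ _ => rfl }
  refine (LinearEquiv.ofBijective φ ⟨?_, ?_⟩).finrank_eq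
  · rw [injective_iff_map_eq_zero]
    intro t ht
    have h0 : ∀ i ≤ n, t.1 (M.rot^[i] d) = 0 := fun i hi =>
      congrFun (congrArg Subtype.val ht) ⟨i, Nat.lt_succ_iff.2 hi⟩
    refine Subtype.ext (funext fun e => ?_)
    by_cases he : M.vertex e = γ
    · obtain ⟨i, hi, rfl | rfl⟩ := h.exists_of_vertex_eq he
      · exact h0 i hi
      · rw [t.2.2.2, h0 i hi, map_zero]
        rfl
    · exact t.2.1 e he
  · rintro ⟨s, hs⟩
    classical
    let t : MeshFlag Φ → Fin 4 → ℝ := fun e =>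
      if he : M.vertex e = γ then
        (if (h.equiv.symm ⟨e, he⟩).2 then swapJet (s (h.equiv.symm ⟨e, he⟩).1)
          else s (h.equiv.symm ⟨e, he⟩).1)
      else 0
    have hv : ∀ x, t (h.equiv x).1 = if x.2 then swapJet (s x.1) else s x.1 := fun x => by
      simp only [t, dif_pos (h.equiv x).2, Subtype.coe_eta, Equiv.symm_apply_apply]
    have t0 : ∀ i : Fin (n + 1), t (M.rot^[i] d) = s i := fun i => hv (i, false)
    have t1 : ∀ i : Fin (n + 1), t (M.rot^[i] d).turn = swapJet (s i) := fun i => hv (i, true)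
    have hzero : ∀ e, M.vertex e ≠ γ → t e = 0 := fun e he => dif_neg he
    have hend : ∀ i : Fin (n + 1),
        (t (M.rot^[i] d), t (M.glue (M.rot^[i] d))) ∈ G.endSpace (M.rot^[i] d) := by
      intro i
      refine Fin.lastCases ?_ (fun j => ?_) i
      · rcases h.closes with ⟨hn, -⟩ | ⟨hint, hper, hrot⟩
        · rw [Fin.val_last, mem_endSpace_of_not_glued hn, M.glue_eq_of_not_glued hn]
        · have hγ := h.vertex_eq
          subst hγ
          rw [Fin.val_last, ← M.turn_rot, ← Function.iterate_succ_apply' M.rot, hrot]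
          have a0 := t1 0
          rw [Fin.val_zero, Function.iterate_zero, id] at a0
          have an := t0 (Fin.last n)
          rw [Fin.val_last] at an
          rw [a0, an]
          have key := chain_closes h₁ h₂ hint hper hc.1
            (s := fun i => if hi : i < n + 1 then s ⟨i, hi⟩ else 0) (fun i hi => by
              rw [dif_pos (by omega), dif_pos (by omega)]
              exact hs ⟨i, hi⟩)
          rw [dif_pos (by omega), dif_pos (by omega)] at key
          exact key
      · have := t1 j.succ
        rw [Fin.val_succ, Function.iterate_succ_apply', M.turn_rot] at this
        rw [t0, Fin.val_castSucc, this]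
        exact hs j
    refine ⟨⟨t, hzero, fun e => ?_, fun e => ?_⟩, Subtype.ext (funext t0)⟩
    · by_cases he : M.vertex e = γ
      · obtain ⟨i, hi, rfl | rfl⟩ := h.exists_of_vertex_eq he
        · exact hend ⟨i, Nat.lt_succ_iff.2 hi⟩
        · have key : ∀ j : Fin (n + 1), (M.rot^[i] d).turn = M.glue (M.rot^[j] d) →
              (t (M.rot^[i] d).turn, t (M.glue (M.rot^[i] d).turn)) ∈
                G.endSpace (M.rot^[i] d).turn := fun j hj => by
            rw [hj]
            have := swap_mem_endSpace (hend j)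
            rwa [Prod.swap_prod_mk, ← M.glue_glue (M.rot^[j] d), M.glue_glue (M.glue _)] at this
          rcases i with _ | i
          · rcases h.glue_turn with ⟨h1, -⟩ | ⟨-, h1⟩
            · have h1' : ¬M.Glued d.turn := not_not.2 h1
              exact (mem_endSpace_of_not_glued h1').2 (congrArg t h1.symm)
            · exact key (Fin.last n) (by rw [Fin.val_last, h1]; rfl)
          · exact key ⟨i, by omega⟩ (by rw [Function.iterate_succ_apply', M.turn_rot])
      · rw [hzero e he, hzero _ (by rwa [M.vertex_glue])]
        exact zero_mem (G.endSpace e)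
    · by_cases he : M.vertex e = γ
      · obtain ⟨i, hi, rfl | rfl⟩ := h.exists_of_vertex_eq he
        · exact (t1 ⟨i, Nat.lt_succ_iff.2 hi⟩).trans
            (congrArg swapJet (t0 ⟨i, Nat.lt_succ_iff.2 hi⟩).symm)
        · rw [MeshFlag.turn_turn]
          refine (t0 ⟨i, Nat.lt_succ_iff.2 hi⟩).trans ?_
          rw [← swapJet_swapJet (s _)]
          exact congrArg swapJet (t1 ⟨i, Nat.lt_succ_iff.2 hi⟩).symm
      · rw [hzero e he, hzero _ (by rwa [M.vertex_turn]), map_zero]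

theorem finrank_vertexSpace [Finite Φ] (h₁ : G.Compat₁) (h₂ : G.Compat₂) (γ : M.Vertex) :
    (Module.finrank ℝ (G.vertexSpace γ) : ℤ) =
      M.numCorners γ + 3 - G.numCrossingEdges γ + G.crossingVertex γ := by
  obtain ⟨d, n, h, hc⟩ := exists_isFan G γ
  have hlast : G.crossing (M.rot^[n] d) = G.crossingVertex γ := by
    unfold crossing crossingVertex
    by_cases h' : G.IsCrossingVertex γ
    · rw [if_pos h', if_pos (hc.2 h')]
    · rw [if_neg h', if_neg (mt hc.1 h')]
  rw [finrank_vertexSpace_eq_chainSpace h₁ h₂ h hc, finrank_chainSpace, h.numCorners_eq,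
    numCrossingEdges_eq h, Finset.sum_range_succ, hlast]
  push_cast
  rw [Finset.sum_congr rfl fun i hi => finrank_freeSpace (h.glued i (Finset.mem_range.1 hi)),
    Finset.sum_sub_distrib]
  simp
  ring

end GluingData

end

noncomputable section

open Polynomial PolyPair

/-! ### Bases adapted to a linear map -/

/-- If every vector of each factor `W i` lifts along `π` to a vector with a given property, then a
basis of the kernel of `π` extends to a basis by vectors with this property. -/
theorem exists_basis_of_lifts {V ι κ : Type*} [AddCommGroup V] [Module ℝ V] [Finite ι]
    {W : ι → Type*} [∀ i, AddCommGroup (W i)] [∀ i, Module ℝ (W i)] [∀ i, Module.Finite ℝ (W i)]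
    [DecidableEq ι] (π : V →ₗ[ℝ] ∀ i, W i) (p : ι → V → Prop)
    (hp : ∀ i (w : W i), ∃ v, p i v ∧ π v = Pi.single i w)
    (b : Module.Basis κ ℝ (LinearMap.ker π)) :
    ∃ B : Module.Basis ((Σ i, Fin (Module.finrank ℝ (W i))) ⊕ κ) ℝ V,
      (∀ i j, p i (B (Sum.inl ⟨i, j⟩))) ∧ ∀ x, B (Sum.inr x) = b x := by
  have := Fintype.ofFinite ι
  let c : Module.Basis (Σ i, Fin (Module.finrank ℝ (W i))) ℝ (∀ i, W i) :=
    Pi.basis fun i => Module.finBasis ℝ (W i)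
  have hc : ∀ x, c x = Pi.single x.1 (Module.finBasis ℝ (W x.1) x.2) := fun x =>
    Pi.basis_apply (fun i => Module.finBasis ℝ (W i)) x
  choose s hs1 hs2 using fun x : (Σ i, Fin (Module.finrank ℝ (W i))) =>
    hp x.1 (Module.finBasis ℝ (W x.1) x.2)
  let σ : (∀ i, W i) →ₗ[ℝ] V := c.constr ℝ s
  have hσc : ∀ x, σ (c x) = s x := fun x => c.constr_basis ℝ s x
  have hπσ : ∀ w, π (σ w) = w := by
    intro w
    suffices h : π ∘ₗ σ = LinearMap.id from LinearMap.congr_fun h w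
    refine c.ext fun x => ?_
    rw [LinearMap.comp_apply, hσc, hs2, LinearMap.id_apply]
    exact (hc x).symm
  let φ : ((∀ i, W i) × LinearMap.ker π) ≃ₗ[ℝ] V :=
    { toFun := fun x => σ x.1 + x.2
      map_add' := fun x y => by
        simp only [Prod.fst_add, Prod.snd_add, map_add, Submodule.coe_add]
        abel
      map_smul' := fun t x => by
        simp only [Prod.smul_fst, Prod.smul_snd, map_smul, Submodule.coe_smul, smul_add,
          RingHom.id_apply]
      invFun := fun v => (π v, ⟨v - σ (π v), by
        rw [LinearMap.mem_ker, map_sub, hπσ, sub_self]⟩)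
      left_inv := fun x => by
        have hx : π (σ x.1 + x.2) = x.1 := by
          rw [map_add, hπσ, LinearMap.mem_ker.1 x.2.2, add_zero]
        refine Prod.ext hx (Subtype.ext ?_)
        change σ x.1 + x.2 - σ (π (σ x.1 + x.2)) = x.2
        rw [hx, add_sub_cancel_left]
      right_inv := fun v => by
        change σ (π v) + (v - σ (π v)) = v
        abel }
  have h1 : ∀ x, ((c.prod b).map φ) (Sum.inl x) = s x := fun x => by
    rw [Module.Basis.map_apply, Module.Basis.prod_apply]
    change σ (c x) + ((0 : LinearMap.ker π) : V) = s x
    rw [hσc]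
    simp
  have h2 : ∀ x, ((c.prod b).map φ) (Sum.inr x) = b x := fun x => by
    rw [Module.Basis.map_apply, Module.Basis.prod_apply]
    change σ 0 + (b x : V) = b x
    simp
  refine ⟨(c.prod b).map φ, fun i j => ?_, h2⟩
  rw [h1]
  exact hs1 ⟨i, j⟩

theorem exists_basis_pi {V X Φ : Type*} [AddCommMonoid V] [Module ℝ V] [AddCommGroup X]
    [Module ℝ X] (W : Submodule ℝ X) [Module.Finite ℝ W] [Finite Φ] [DecidableEq Φ]
    (e : V ≃ₗ[ℝ] (Φ → W)) :
    ∃ b : Module.Basis (Φ × Fin (Module.finrank ℝ W)) ℝ V,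
      ∀ σ i, ∃ w, b (σ, i) = e.symm (Pi.single σ w) := by
  have := Fintype.ofFinite Φ
  refine ⟨((Pi.basis fun _ : Φ => Module.finBasis ℝ W).map e.symm).reindex
    (Equiv.sigmaEquivProd _ _), fun σ i => ⟨Module.finBasis ℝ W i, ?_⟩⟩
  rw [Module.Basis.reindex_apply, Module.Basis.map_apply]
  exact congrArg _ (Pi.basis_apply _ _)

instance macroPatch_finite (r k : ℕ) : Module.Finite ℝ (macroPatch r k) := by
  refine Module.Finite.of_surjective (TensorProduct.lift (prodPatch r k)) fun F => ?_
  induction F using macroPatch_induction with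
  | h P Q => exact ⟨P ⊗ₜ Q, TensorProduct.lift.tmul _ _⟩
  | h0 => exact ⟨0, map_zero _⟩
  | hadd F G hF hG =>
    obtain ⟨x, rfl⟩ := hF
    obtain ⟨y, rfl⟩ := hG
    exact ⟨x + y, map_add _ _ _⟩
  | hsmul t F hF =>
    obtain ⟨x, rfl⟩ := hF
    exact ⟨t • x, map_smul _ _ _⟩

namespace GluingData

variable {Φ : Type*} {M : QuadMesh Φ} {G : GluingData M} {r k : ℕ}

/-! ### The filtration of the spline space by Taylor data and jets along the edges -/

theorem jets_patches_add (f g : G.splines r k) (d : MeshFlag Φ) (n : Bool) :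
    jets (G.patches r k (f + g)) d n =
      jets (G.patches r k f) d n + jets (G.patches r k g) d n := by
  unfold jets
  rw [map_add, Pi.add_apply, map_add]

theorem jets_patches_smul (t : ℝ) (f : G.splines r k) (d : MeshFlag Φ) (n : Bool) :
    jets (G.patches r k (t • f)) d n = t • jets (G.patches r k f) d n := by
  unfold jets
  rw [map_smul, Pi.smul_apply, map_smul]

theorem cornerTaylor_spline (f : G.splines r k) (d : MeshFlag Φ) : cornerTaylor f.1 d =
    endJetₗ (jets (G.patches r k f) d false, jets (G.patches r k f) d true) :=
  cornerTaylor_eq (G.patches r k f) d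

open Classical in
variable (G) in
/-- The Taylor data of a spline at all vertices. -/
def taylorMap (r k : ℕ) : G.splines r k →ₗ[ℝ] ∀ γ : M.Vertex, G.vertexSpace γ where
  toFun f γ := ⟨_, taylor_mem_vertexSpace f γ⟩
  map_add' f g := by
    refine funext fun γ => Subtype.ext (funext fun d => ?_)
    change (if M.vertex d = γ then cornerTaylor (f + g).1 d else 0) =
      (if M.vertex d = γ then cornerTaylor f.1 d else 0) +
        (if M.vertex d = γ then cornerTaylor g.1 d else 0)
    split_ifs
    · simp only [cornerTaylor_spline, jets_patches_add, ← map_add, Prod.mk_add_mk]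
    · rw [add_zero]
  map_smul' t f := by
    refine funext fun γ => Subtype.ext (funext fun d => ?_)
    change (if M.vertex d = γ then cornerTaylor (t • f).1 d else 0) =
      t • (if M.vertex d = γ then cornerTaylor f.1 d else 0)
    split_ifs
    · simp only [cornerTaylor_spline, jets_patches_smul, ← map_smul, Prod.smul_mk]
    · rw [smul_zero]

open Classical in
theorem taylorMap_apply (f : G.splines r k) (γ : M.Vertex) (d : MeshFlag Φ) :
    (G.taylorMap r k f γ).1 d = if M.vertex d = γ then cornerTaylor f.1 d else 0 := rfl

theorem mem_ker_taylorMap {f : G.splines r k} :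
    f ∈ LinearMap.ker (G.taylorMap r k) ↔ ∀ d, cornerTaylor f.1 d = 0 := by
  rw [LinearMap.mem_ker]
  constructor
  · intro h d
    have := congrFun (congrArg Subtype.val (congrFun h (M.vertex d))) d
    rwa [taylorMap_apply, if_pos rfl] at this
  · intro h
    refine funext fun γ => Subtype.ext (funext fun d => ?_)
    rw [taylorMap_apply, h]
    exact ite_self _

variable (G) in
/-- The jets along all edges of a spline with zero Taylor data. -/
def edgeMap (r k : ℕ) :
    LinearMap.ker (G.taylorMap r k) →ₗ[ℝ] ∀ τ : M.Edge, G.clampedEdgeSpace r k τ.out where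
  toFun f τ := ⟨_, edgeTriple_mem_clampedEdgeSpace (mem_ker_taylorMap.1 f.2) τ.out⟩
  map_add' f g := by
    refine funext fun τ => Subtype.ext ?_
    exact Prod.ext (jets_patches_add f.1 g.1 _ _)
      (Prod.ext (jets_patches_add f.1 g.1 _ _) (jets_patches_add f.1 g.1 _ _))
  map_smul' t f := by
    refine funext fun τ => Subtype.ext ?_
    exact Prod.ext (jets_patches_smul t f.1 _ _)
      (Prod.ext (jets_patches_smul t f.1 _ _) (jets_patches_smul t f.1 _ _))

theorem edge_out (τ : M.Edge) : M.edge τ.out = τ := Quot.out_eq τ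

theorem mem_ker_edgeMap {f : LinearMap.ker (G.taylorMap r k)} :
    f ∈ LinearMap.ker (G.edgeMap r k) ↔ ∀ d, jets (G.patches r k f.1) d = 0 := by
  rw [LinearMap.mem_ker]
  constructor
  · intro h d
    have h0 : edgeTriple M (M.edge d).out (jets (G.patches r k f.1)) = 0 :=
      congrArg Subtype.val (congrFun h (M.edge d))
    set e := (M.edge d).out with he
    have e1 : jets (G.patches r k f.1) e false = 0 := congrArg Prod.fst h0
    have e2 : jets (G.patches r k f.1) e true = 0 := congrArg (fun x => x.2.1) h0
    have e3 : jets (G.patches r k f.1) (M.glue e) true = 0 := congrArg (fun x => x.2.2) h0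
    have e4 : jets (G.patches r k f.1) (M.glue e) false = 0 := by
      by_cases hd : M.Glued e
      · rw [← (jetGlued_patches f.1 e hd).1, e1]
      · rw [M.glue_eq_of_not_glued hd, e1]
    have hd : M.edge d = M.edge e := (edge_out _).symm
    funext n
    rcases M.edge_eq_iff.1 hd with h | h | h | h <;> cases n <;> rw [h]
    · exact e1
    · exact e2
    · rw [jets_rev, e1, map_zero]; rfl
    · rw [jets_rev, e2, map_zero]; rfl
    · exact e4
    · exact e3
    · rw [M.glue_rev, jets_rev, e4, map_zero]; rfl
    · rw [M.glue_rev, jets_rev, e3, map_zero]; rfl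
  · intro h
    refine funext fun τ => Subtype.ext ?_
    change (jets _ _ _, jets _ _ _, jets _ _ _) = 0
    simp only [h, Pi.zero_apply]
    rfl

variable (G) in
/-- The splines vanishing to first order along all edges are arbitrary families of clamped
macro-patches on the faces. -/
def kerEdgeMapEquiv (r k : ℕ) :
    LinearMap.ker (G.edgeMap r k) ≃ₗ[ℝ] (Φ → clampedPatch Φ r k) :=
  LinearEquiv.ofBijective
    ({ toFun := fun f σ => ⟨G.patches r k f.1.1 σ, mem_clampedPatch.2 fun d n =>
        congrFun (mem_ker_edgeMap.1 f.2 ⟨σ, d.cu, d.cv, d.axis⟩) n⟩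
       map_add' := fun _ _ => rfl
       map_smul' := fun _ _ => rfl } : LinearMap.ker (G.edgeMap r k) →ₗ[ℝ] _)
    (by
      constructor
      · intro f g h
        refine Subtype.ext (Subtype.ext (Subtype.ext (funext fun σ => ?_)))
        exact congrArg (fun F => ((F σ).1 : ℝ → ℝ → ℝ)) h
      · intro F
        have hj : ∀ d, jets (fun σ => (F σ).1) d = 0 := fun d => funext fun n =>
          mem_clampedPatch.1 (F d.face).2 d n
        obtain ⟨f, hf⟩ := exists_patches_eq (G := G) (f := fun σ => (F σ).1) fun d _ => by
          simp [hj]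
        have h1 : f ∈ LinearMap.ker (G.taylorMap r k) := by
          rw [mem_ker_taylorMap]
          intro d
          rw [cornerTaylor_spline, hf, hj]
          exact map_zero endJetₗ
        refine ⟨⟨⟨f, h1⟩, mem_ker_edgeMap.2 fun d => ?_⟩, ?_⟩
        · rw [hf, hj]
        · exact funext fun σ => Subtype.ext (congrFun hf σ))

theorem patches_kerEdgeMapEquiv_symm (F : Φ → clampedPatch Φ r k) (σ : Φ) :
    (((G.kerEdgeMapEquiv r k).symm F).1.1.1 σ : ℝ → ℝ → ℝ) = (F σ).1.1 :=
  congrArg (fun F => ((F σ).1.1 : ℝ → ℝ → ℝ)) ((G.kerEdgeMapEquiv r k).apply_symm_apply F)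

theorem attachedToFace_kerEdgeMapEquiv_symm [DecidableEq Φ] (σ : Φ) (F : clampedPatch Φ r k) :
    AttachedToFace σ ((G.kerEdgeMapEquiv r k).symm (Pi.single σ F)).1.1.1 := by
  refine ⟨fun σ' h => ?_, fun d => ?_⟩
  · rw [patches_kerEdgeMapEquiv_symm, Pi.single_eq_of_ne h]
    rfl
  · exact (vanishesAlong_iff (G.patches r k _) d).2 (mem_ker_edgeMap.1 (Subtype.property _) d)

instance edge_finite [Finite Φ] : Finite M.Edge := inferInstanceAs (Finite (Quot _))

instance vertex_finite [Finite Φ] : Finite M.Vertex := inferInstanceAs (Finite (Quot _))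

instance vertexSpace_finite [Finite Φ] (γ : M.Vertex) : Module.Finite ℝ (G.vertexSpace γ) :=
  inferInstance

theorem edgeMap_apply (f : LinearMap.ker (G.taylorMap r k)) (τ : M.Edge) :
    (G.edgeMap r k f τ).1 = edgeTriple M τ.out (jets (G.patches r k f.1)) := rfl

theorem exists_edgeMap_eq_single [DecidableEq M.Edge]
    {e : Bool × Bool → PolyPair.spline (r + 1) (k + 1)} (he : IsHermiteBasis e) (τ : M.Edge)
    (q : G.clampedEdgeSpace r k τ.out) : ∃ f : LinearMap.ker (G.taylorMap r k),
      M.AttachedToEdge τ (f.1.1 : Φ → ℝ → ℝ → ℝ) ∧ G.edgeMap r k f = Pi.single τ q := by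
  obtain ⟨f, hf, hq, h0⟩ := exists_attachedToEdge he q.2
  rw [edge_out] at hf h0
  refine ⟨⟨f, mem_ker_taylorMap.2 hf.2.2⟩, hf, funext fun τ' => Subtype.ext ?_⟩
  rw [edgeMap_apply]
  by_cases hτ : τ' = τ
  · subst hτ
    rw [Pi.single_eq_same]
    exact hq
  · rw [Pi.single_eq_of_ne hτ, edgeTriple, h0 _ (by rwa [edge_out]),
      h0 _ (by rwa [M.edge_glue, edge_out])]
    rfl

theorem exists_taylorMap_eq_single [Finite Φ] [DecidableEq M.Vertex]
    {e : Bool × Bool → PolyPair.spline (r + 1) (k + 1)} (he : IsHermiteBasis e)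
    (hk : G.maxSeparability r ≤ (k : ℕ∞)) (γ : M.Vertex) (t : G.vertexSpace γ) :
    ∃ f : G.splines r k, M.AttachedToVertex γ (f.1 : Φ → ℝ → ℝ → ℝ) ∧
      G.taylorMap r k f = Pi.single γ t := by
  obtain ⟨f, hf, ht⟩ := exists_attachedToVertex he hk t.2
  refine ⟨f, hf, funext fun γ' => Subtype.ext (funext fun d => ?_)⟩
  rw [taylorMap_apply]
  by_cases hγ : γ' = γ
  · subst hγ
    rw [Pi.single_eq_same]
    split_ifs with hd
    · exact ht d
    · exact (t.2.1 d hd).symm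
  · rw [Pi.single_eq_of_ne hγ]
    split_ifs with hd
    · rw [ht, t.2.1 d (by rwa [hd])]
      rfl
    · rfl

set_option maxHeartbeats 800000 in
theorem exists_adapted_basis [Finite Φ] {e : Bool × Bool → PolyPair.spline (r + 1) (k + 1)}
    (he : IsHermiteBasis e) (hk : G.maxSeparability r ≤ (k : ℕ∞)) :
    ∃ B : Module.Basis ((Σ γ : M.Vertex, Fin (Module.finrank ℝ (G.vertexSpace γ))) ⊕
        (Σ τ : M.Edge, Fin (Module.finrank ℝ (G.clampedEdgeSpace r k τ.out))) ⊕
        (Φ × Fin (Module.finrank ℝ (clampedPatch Φ r k)))) ℝ (G.splines r k),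
      (∀ γ i, M.AttachedToVertex γ (B (Sum.inl ⟨γ, i⟩) : Φ → ℝ → ℝ → ℝ)) ∧
      (∀ τ i, M.AttachedToEdge τ (B (Sum.inr (Sum.inl ⟨τ, i⟩)) : Φ → ℝ → ℝ → ℝ)) ∧
      (∀ σ i, AttachedToFace σ (B (Sum.inr (Sum.inr (σ, i))) : Φ → ℝ → ℝ → ℝ)) := by
  classical
  have hfin : ∀ τ : M.Edge, Module.Finite ℝ (G.clampedEdgeSpace r k τ.out) := fun τ =>
    clampedEdgeSpace_finite τ.out
  obtain ⟨b₀, hb₀⟩ := exists_basis_pi (clampedPatch Φ r k) (G.kerEdgeMapEquiv r k)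
  obtain ⟨b₁, h1, h1'⟩ := exists_basis_of_lifts (V := LinearMap.ker (G.taylorMap r k))
    (W := fun τ : M.Edge => G.clampedEdgeSpace r k τ.out) (G.edgeMap r k)
    (fun τ f => M.AttachedToEdge τ (f.1.1 : Φ → ℝ → ℝ → ℝ)) (exists_edgeMap_eq_single he) b₀
  obtain ⟨B, h2, h2'⟩ := exists_basis_of_lifts (V := G.splines r k)
    (W := fun γ : M.Vertex => G.vertexSpace γ) (G.taylorMap r k)
    (fun γ f => M.AttachedToVertex γ (f.1 : Φ → ℝ → ℝ → ℝ)) (exists_taylorMap_eq_single he hk) b₁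
  refine ⟨B, h2, fun τ i => ?_, fun σ i => ?_⟩
  · rw [h2']
    exact h1 τ i
  · obtain ⟨w, hw⟩ := hb₀ σ i
    rw [h2', h1', hw]
    exact attachedToFace_kerEdgeMapEquiv_symm σ w

/-! ### Counting -/

theorem crossing_glue (d : MeshFlag Φ) : G.crossing (M.glue d) = G.crossing d := by
  unfold crossing
  by_cases h : G.IsCrossing d
  · rw [if_pos h, if_pos (isCrossing_glue.2 h)]
  · rw [if_neg h, if_neg (mt isCrossing_glue.1 h)]

/-- The number of crossing ends of an edge does not depend on the flag representing the edge. -/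
theorem crossing_add_crossing_rev {d e : MeshFlag Φ} (h : M.edge e = M.edge d) :
    G.crossing e + G.crossing e.rev = G.crossing d + G.crossing d.rev := by
  rcases M.edge_eq_iff.1 h with rfl | rfl | rfl | rfl
  · rfl
  · rw [MeshFlag.rev_rev, add_comm]
  · rw [← M.glue_rev, crossing_glue, crossing_glue]
  · rw [← M.glue_rev, MeshFlag.rev_rev, crossing_glue, crossing_glue, add_comm]

open Classical in
theorem sum_crossing_edge [Fintype (MeshFlag Φ)] (d : MeshFlag Φ) :
    ∑ e with M.edge e = M.edge d, G.crossing e = 2 * (G.crossing d + G.crossing d.rev) := by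
  by_cases hd : M.Glued d
  · have hset : (Finset.univ.filter fun e => M.edge e = M.edge d) =
        {d, d.rev, M.glue d, M.glue d.rev} := by
      ext e
      simp [M.edge_eq_iff]
    have n0 : (M.glue d.rev).face ≠ d.face := by
      have := M.face_ne d.rev (M.glued_rev.2 hd)
      rwa [MeshFlag.rev_face] at this
    have n0' := M.face_ne d hd
    rw [hset, Finset.sum_insert, Finset.sum_insert, Finset.sum_insert, Finset.sum_singleton,
      crossing_glue, crossing_glue]
    · ring
    · rw [Finset.mem_singleton, M.glue_rev]
      exact (MeshFlag.rev_ne _).symm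
    · simp only [Finset.mem_insert, Finset.mem_singleton, not_or]
      exact ⟨fun h => n0' (by rw [← h, MeshFlag.rev_face]),
        fun h => n0 (by rw [← h, MeshFlag.rev_face])⟩
    · simp only [Finset.mem_insert, Finset.mem_singleton, not_or]
      exact ⟨(MeshFlag.rev_ne _).symm, fun h => n0' (by rw [← h]), fun h => n0 (by rw [← h])⟩
  · have hd' := mt M.glued_rev.1 hd
    rw [crossing_of_not_glued hd, crossing_of_not_glued hd', Finset.sum_eq_zero]
    · ring
    · intro e he
      rcases M.edge_eq_iff.1 (Finset.mem_filter.1 he).2 with rfl | rfl | rfl | rfl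
      · exact crossing_of_not_glued hd
      · exact crossing_of_not_glued hd'
      · rw [crossing_glue, crossing_of_not_glued hd]
      · rw [crossing_glue, crossing_of_not_glued hd']

open Classical in
theorem natCard_subtype_eq_sum [Fintype (MeshFlag Φ)] (γ : M.Vertex) (p : MeshFlag Φ → Prop) :
    (Nat.card {e : MeshFlag Φ // M.vertex e = γ ∧ p e} : ℤ) =
      ∑ e with M.vertex e = γ, if p e then 1 else 0 := by
  rw [Nat.card_eq_fintype_card, Fintype.card_subtype, Finset.sum_boole, Finset.filter_filter]

/-- Both sides count the crossing edge ends. -/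
theorem sum_numCrossingEdges [Finite Φ] [Fintype M.Vertex] [Fintype M.Edge] :
    ∑ γ : M.Vertex, (G.numCrossingEdges γ : ℤ) =
      ∑ τ : M.Edge, (G.crossing τ.out + G.crossing τ.out.rev) := by
  classical
  have : Fintype (MeshFlag Φ) := Fintype.ofFinite _
  have h1 : ∀ γ : M.Vertex, 2 * (G.numCrossingEdges γ : ℤ) =
      ∑ e with M.vertex e = γ, G.crossing e := fun γ => by
    have h := congrArg (Nat.cast : ℕ → ℤ) (G.two_mul_numCrossingEdges γ)
    rw [natCard_subtype_eq_sum] at h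
    push_cast at h
    rw [h]
    exact Finset.sum_congr rfl fun e _ => by unfold crossing; congr
  have h2 : ∀ τ : M.Edge, ∑ e with M.edge e = τ, G.crossing e =
      2 * (G.crossing τ.out + G.crossing τ.out.rev) := fun τ => by
    have := sum_crossing_edge (G := G) τ.out
    rwa [edge_out] at this
  have h3 := Finset.sum_fiberwise (Finset.univ : Finset (MeshFlag Φ)) M.vertex G.crossing
  have h4 := Finset.sum_fiberwise (Finset.univ : Finset (MeshFlag Φ)) M.edge G.crossing
  simp only [← h1] at h3
  simp only [h2] at h4
  rw [← Finset.mul_sum] at h3 h4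
  linarith

theorem sum_numCorners [Finite Φ] [Fintype M.Vertex] :
    ∑ γ : M.Vertex, (M.numCorners γ : ℤ) = 4 * Nat.card Φ := by
  classical
  have : Fintype Φ := Fintype.ofFinite _
  have : Fintype (MeshFlag Φ) := Fintype.ofFinite _
  have h3 := Finset.sum_fiberwise (Finset.univ : Finset (MeshFlag Φ)) M.vertex
    (fun e => if e.axis = false then (1 : ℤ) else 0)
  have h1 : ∀ γ : M.Vertex, (M.numCorners γ : ℤ) =
      ∑ e with M.vertex e = γ, if e.axis = false then (1 : ℤ) else 0 := fun γ => by
    rw [QuadMesh.numCorners, natCard_subtype_eq_sum]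
    exact Finset.sum_congr rfl fun e _ => by congr
  simp only [h1]
  rw [h3]
  let ε : Φ × Bool × Bool × Bool ≃ MeshFlag Φ :=
    { toFun := fun x => ⟨x.1, x.2.1, x.2.2.1, x.2.2.2⟩
      invFun := fun d => (d.face, d.cu, d.cv, d.axis)
      left_inv := fun _ => rfl
      right_inv := fun _ => rfl }
  rw [← ε.sum_comp]
  simp only [ε, Equiv.coe_fn_mk, Fintype.sum_prod_type, Fintype.sum_bool]
  simp
  ring

theorem sum_crossingVertex [Finite Φ] [Fintype M.Vertex] :
    ∑ γ : M.Vertex, G.crossingVertex γ = Nat.card {γ : M.Vertex // G.IsCrossingVertex γ} := by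
  classical
  rw [Nat.card_eq_fintype_card, Fintype.card_subtype, ← Finset.sum_boole]
  exact Finset.sum_congr rfl fun γ _ => by unfold crossingVertex; congr

theorem finrank_clampedPatch_eq [Nonempty Φ] (hrk : r ≤ k)
    {e : Bool × Bool → PolyPair.spline (r + 1) (k + 1)} (he : IsHermiteBasis e) :
    (Module.finrank ℝ (clampedPatch Φ r k) : ℤ) = (2 * (k : ℤ) - r - 3) ^ 2 := by
  rw [finrank_clampedPatch he]
  have h1 := finrank_clampedSpline he
  have h2 := finrank_spline (s := r + 1) (n := k + 1) (by omega)
  have h3 : (Module.finrank ℝ (clampedSpline r k) : ℤ) = 2 * (k : ℤ) - r - 3 := by omega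
  rw [Nat.cast_pow, h3]

end GluingData

end

theorem theorem7p1 {Φ : Type*} [Finite Φ] (M : QuadMesh Φ) (G : GluingData M)
    (h₁ : G.Compat₁) (h₂ : G.Compat₂) (r k : ℕ) (hrk : r ≤ k)
    (hk : G.maxSeparability r ≤ (k : ℕ∞)) :
    (Module.finrank ℝ (G.splines r k) : ℤ) =
        (2 * (k : ℤ) - r - 3) ^ 2 * (Nat.card Φ : ℤ) + (∑ᶠ τ : M.Edge, G.dTilde r k τ)
          + 4 * (Nat.card Φ : ℤ) - 9 * (Nat.card M.Edge : ℤ) + 3 * (Nat.card M.Vertex : ℤ)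
          + (Nat.card {γ : M.Vertex // G.IsCrossingVertex γ} : ℤ) ∧
    ∃ (nV : M.Vertex → ℕ) (nE : M.Edge → ℕ) (nF : ℕ)
      (B : Module.Basis ((Σ γ : M.Vertex, Fin (nV γ)) ⊕ (Σ τ : M.Edge, Fin (nE τ)) ⊕ (Φ × Fin nF))
        ℝ (G.splines r k)),
      (∀ γ, (nV γ : ℤ) =
        M.numCorners γ + 3 - G.numCrossingEdges γ + G.crossingVertex γ) ∧
      (∀ d, (nE (M.edge d) : ℤ) =
        G.dTilde r k (M.edge d) - 9 + G.crossing d + G.crossing d.rev) ∧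
      ((nF : ℤ) = (2 * (k : ℤ) - r - 3) ^ 2) ∧
      (∀ γ i, M.AttachedToVertex γ (B (Sum.inl ⟨γ, i⟩) : Φ → ℝ → ℝ → ℝ)) ∧
      (∀ τ i, M.AttachedToEdge τ (B (Sum.inr (Sum.inl ⟨τ, i⟩)) : Φ → ℝ → ℝ → ℝ)) ∧
      (∀ σ i, AttachedToFace σ (B (Sum.inr (Sum.inr (σ, i))) : Φ → ℝ → ℝ → ℝ)) := by
  classical
  have : Fintype Φ := Fintype.ofFinite _
  have : Fintype M.Edge := Fintype.ofFinite _
  have : Fintype M.Vertex := Fintype.ofFinite _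
  rcases isEmpty_or_nonempty Φ with hΦ | hΦ
  · have hflag : IsEmpty (MeshFlag Φ) := ⟨fun d => hΦ.elim d.face⟩
    have hE : IsEmpty M.Edge := ⟨fun τ => hflag.elim τ.out⟩
    have hV : IsEmpty M.Vertex := ⟨fun γ => hflag.elim γ.out⟩
    have hS : Subsingleton (G.splines r k) :=
      ⟨fun f g => Subtype.ext (funext fun σ => hΦ.elim σ)⟩
    refine ⟨?_, fun _ => 0, fun _ => 0, (2 * (k : ℤ) - r - 3).natAbs ^ 2, Module.Basis.empty _,
      fun γ => hV.elim γ, fun d => hflag.elim d, ?_, fun γ => hV.elim γ, fun τ => hE.elim τ,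
      fun σ => hΦ.elim σ⟩
    · rw [Module.finrank_zero_of_subsingleton, finsum_of_isEmpty]
      simp
    · simp
  · obtain ⟨e, he⟩ := GluingData.exists_isHermiteBasis hk
    obtain ⟨B, hBV, hBE, hBF⟩ := GluingData.exists_adapted_basis he hk
    have hV := GluingData.finrank_vertexSpace h₁ h₂
    have hE := GluingData.finrank_clampedEdgeSpace (G := G) hrk hk
    have hF := GluingData.finrank_clampedPatch_eq (Φ := Φ) hrk he
    refine ⟨?_, _, _, _, B, hV, fun d => ?_, hF, hBV, hBE, hBF⟩
    · rw [Module.finrank_eq_card_basis B, Fintype.card_sum, Fintype.card_sum, Fintype.card_sigma,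
        Fintype.card_sigma, Fintype.card_prod]
      simp only [Fintype.card_fin]
      push_cast
      simp only [hV, hE, hF]
      simp only [add_assoc, Finset.sum_add_distrib, Finset.sum_sub_distrib, sub_add_eq_add_sub]
      have c1 := GluingData.sum_numCrossingEdges (G := G)
      have c2 := GluingData.sum_numCorners (M := M)
      have c3 := GluingData.sum_crossingVertex (G := G)
      rw [Finset.sum_add_distrib] at c1
      rw [finsum_eq_sum_of_fintype]
      simp only [Nat.card_eq_fintype_card] at c2 c3 ⊢
      simp only [Finset.sum_const, Finset.card_univ, nsmul_eq_mul]
      linarith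
    · have hout := GluingData.crossing_add_crossing_rev (G := G) (GluingData.edge_out (M.edge d))
      rw [hE]
      linarith
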